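/- Let $G$ be a second-countable compact (Hausdorff) group, let $A$ be a separable, not necessarily unital, $C^*$-algebra, and let $\alpha\colon G\to\mathrm{Aut}(A)$ be a (point-norm) continuous action with the Rokhlin property. Then the canonical inclusion $\iota\colon A^\alpha\to A$ of the fixed point algebra is sequence algebra extendible. Consequently, if $A$ is weakly semiprojective, then so is $A^\alpha$. If in addition $G$ is finite, then $A\rtimes_\alpha G\cong M_{|G|}\otimes A^\alpha$ as $C^*$-algebras, and if moreover $A$ is weakly semiprojective, then so is $A\rtimes_\alpha G$. Here homomorphisms are $*$-homomorphisms, not necessarily unital, and subalgebras are $C^*$-subalgebras. For a $C^*$-algebra $B$ put $B_\infty=\ell^\infty(\mathbb N,B)/c_0(\mathbb N,B)$, with quotient map $\eta_B$; $B$ embeds in $B_\infty$ as (classes of) constant sequences. A $C^*$-algebra $A$ is weakly semiprojective if for every $C^*$-algebra $B$ every homomorphism $\psi\colon A\to B_\infty$ is of the form $\eta_B\circ\varphi$ for some homomorphism $\varphi\colon A\to\ell^\infty(\mathbb N,B)$. A homomorphism $\theta\colon A\to B$ is sequence algebra extendible if for every $C^*$-algebra $E$ and every homomorphism $\varphi\colon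 A\to E_\infty$ there is a homomorphism $\rho\colon B\to E_\infty$ with $\varphi=\rho\circ\theta$. For an $\alpha$-invariant subalgebra $D\subseteq A$ put $F(D,A)=(A_\infty\cap D')/\mathrm{Ann}(D,A_\infty)$, with quotient map $\kappa_{D,A}$ and the $G$-action $F(\alpha)$ induced by $\alpha$; let $\ell^\infty_\alpha(\mathbb N,A)$ be the set of bounded sequences on which $G$ acts norm-continuously, $A_{\infty,\alpha}=\eta_A(\ell^\infty_\alpha(\mathbb N,A))$, and $F_\alpha(D,A)=\kappa_{D,A}(A_{\infty,\alpha}\cap D')$. The action $\alpha$ has the Rokhlin property if for every separable $\alpha$-invariant subalgebra $D\subseteq A$ there is a unital equivariant homomorphism $(C(G),\mathtt{Lt})\to(F_\alpha(D,A),F(\alpha))$, where $\mathtt{Lt}_g(f)(x)=f(g^{-1}x)$. -/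

import Mathlib

open scoped ENNReal
open Filter Topology

universe u v w

namespace RokhlinFP

/-! ### Quotients of complex `*`-algebras by two-sided `*`-ideals -/

section StarIdeal

/-- A two-sided, self-adjoint ideal (and complex subspace) of a complex `*`-algebra. -/
structure StarIdeal (R : Type u) [NonUnitalRing R] [StarRing R] [Module ℂ R] extends
    Submodule ℂ R where
  mul_left_mem' : ∀ (r : R) {x : R}, x ∈ carrier → r * x ∈ carrier
  mul_right_mem' : ∀ (r : R) {x : R}, x ∈ carrier → x * r ∈ carrier
  star_mem' : ∀ {x : R}, x ∈ carrier → star x ∈ carrier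

variable {R : Type u} [NonUnitalRing R] [StarRing R] [Module ℂ R]

/-- The quotient of a complex `*`-algebra by a two-sided `*`-ideal. -/
def StarIdeal.Quotient (I : StarIdeal R) : Type u := R ⧸ I.toSubmodule

namespace StarIdeal.Quotient

variable (I : StarIdeal R)

instance : AddCommGroup I.Quotient := inferInstanceAs (AddCommGroup (R ⧸ I.toSubmodule))

instance : Module ℂ I.Quotient := inferInstanceAs (Module ℂ (R ⧸ I.toSubmodule))

/-- The linear quotient map. -/
def mkₗ : R →ₗ[ℂ] I.Quotient := I.toSubmodule.mkQ

variable {I} in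
theorem mkₗ_eq_iff {x y : R} : mkₗ I x = mkₗ I y ↔ x - y ∈ I.toSubmodule :=
  Submodule.Quotient.eq I.toSubmodule

theorem mkₗ_surjective : Function.Surjective (mkₗ I) := I.toSubmodule.mkQ_surjective

instance : Mul I.Quotient where
  mul := Quotient.map₂ (fun x y : R => x * y) (by
    intro a b hab c d hcd
    replace hab := (Submodule.quotientRel_def _).1 hab
    replace hcd := (Submodule.quotientRel_def _).1 hcd
    refine (Submodule.quotientRel_def _).2 ?_
    have h : a * c - b * d = (a - b) * c + b * (c - d) := by
      rw [sub_mul, mul_sub]; abel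
    rw [h]
    exact I.add_mem (I.mul_right_mem' _ hab) (I.mul_left_mem' _ hcd))

instance : Star I.Quotient where
  star := Quotient.map (fun x : R => star x) (by
    intro a b hab
    replace hab := (Submodule.quotientRel_def _).1 hab
    refine (Submodule.quotientRel_def _).2 ?_
    rw [← star_sub]
    exact I.star_mem' hab)

theorem mkₗ_mul (x y : R) : mkₗ I (x * y) = mkₗ I x * mkₗ I y := rfl

theorem mkₗ_star (x : R) : mkₗ I (star x) = star (mkₗ I x) := rfl

instance : NonUnitalRing I.Quotient where
  __ := (inferInstance : AddCommGroup I.Quotient)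
  left_distrib a b c := by
    obtain ⟨a, rfl⟩ := mkₗ_surjective I a
    obtain ⟨b, rfl⟩ := mkₗ_surjective I b
    obtain ⟨c, rfl⟩ := mkₗ_surjective I c
    rw [← map_add, ← mkₗ_mul, ← mkₗ_mul, ← mkₗ_mul, ← map_add, mul_add]
  right_distrib a b c := by
    obtain ⟨a, rfl⟩ := mkₗ_surjective I a
    obtain ⟨b, rfl⟩ := mkₗ_surjective I b
    obtain ⟨c, rfl⟩ := mkₗ_surjective I c
    rw [← map_add, ← mkₗ_mul, ← mkₗ_mul, ← mkₗ_mul, ← map_add, add_mul]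
  zero_mul a := by
    obtain ⟨a, rfl⟩ := mkₗ_surjective I a
    rw [← map_zero (mkₗ I), ← mkₗ_mul, zero_mul]
  mul_zero a := by
    obtain ⟨a, rfl⟩ := mkₗ_surjective I a
    rw [← map_zero (mkₗ I), ← mkₗ_mul, mul_zero]
  mul_assoc a b c := by
    obtain ⟨a, rfl⟩ := mkₗ_surjective I a
    obtain ⟨b, rfl⟩ := mkₗ_surjective I b
    obtain ⟨c, rfl⟩ := mkₗ_surjective I c
    rw [← mkₗ_mul, ← mkₗ_mul, ← mkₗ_mul, ← mkₗ_mul, mul_assoc]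

instance : StarRing I.Quotient where
  star_involutive a := by
    obtain ⟨a, rfl⟩ := mkₗ_surjective I a
    rw [← mkₗ_star, ← mkₗ_star, star_star]
  star_mul a b := by
    obtain ⟨a, rfl⟩ := mkₗ_surjective I a
    obtain ⟨b, rfl⟩ := mkₗ_surjective I b
    rw [← mkₗ_mul, ← mkₗ_star, ← mkₗ_star, ← mkₗ_star, ← mkₗ_mul, star_mul]
  star_add a b := by
    obtain ⟨a, rfl⟩ := mkₗ_surjective I a
    obtain ⟨b, rfl⟩ := mkₗ_surjective I b
    rw [← map_add, ← mkₗ_star, ← mkₗ_star, ← mkₗ_star, ← map_add, star_add]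

instance [StarModule ℂ R] : StarModule ℂ I.Quotient where
  star_smul c a := by
    obtain ⟨a, rfl⟩ := mkₗ_surjective I a
    rw [← map_smul, ← mkₗ_star, ← mkₗ_star, ← map_smul, star_smul]

instance [IsScalarTower ℂ R R] : IsScalarTower ℂ I.Quotient I.Quotient where
  smul_assoc c a b := by
    obtain ⟨a, rfl⟩ := mkₗ_surjective I a
    obtain ⟨b, rfl⟩ := mkₗ_surjective I b
    simp only [smul_eq_mul]
    rw [← map_smul, ← mkₗ_mul, ← mkₗ_mul, ← map_smul, smul_mul_assoc]

instance [SMulCommClass ℂ R R] : SMulCommClass ℂ I.Quotient I.Quotient where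
  smul_comm c a b := by
    obtain ⟨a, rfl⟩ := mkₗ_surjective I a
    obtain ⟨b, rfl⟩ := mkₗ_surjective I b
    simp only [smul_eq_mul]
    rw [← map_smul, ← mkₗ_mul, ← mkₗ_mul, ← map_smul, mul_smul_comm]

/-- The quotient `*`-homomorphism. -/
def mk : R →⋆ₙₐ[ℂ] I.Quotient where
  toFun := mkₗ I
  map_smul' := (mkₗ I).map_smul
  map_zero' := (mkₗ I).map_zero
  map_add' := (mkₗ I).map_add
  map_mul' := mkₗ_mul I
  map_star' := mkₗ_star I

variable {I} in
theorem mk_eq_iff {x y : R} : mk I x = mk I y ↔ x - y ∈ I.toSubmodule := mkₗ_eq_iff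

theorem mk_surjective : Function.Surjective (mk I) := mkₗ_surjective I

variable {I} {S : Type v} [NonUnitalRing S] [StarRing S] [Module ℂ S] {J : StarIdeal S}

/-- The `*`-homomorphism of quotients induced by a `*`-homomorphism `f` with `f(I) ⊆ J`. -/
def map (f : R →⋆ₙₐ[ℂ] S) (h : ∀ x ∈ I.toSubmodule, f x ∈ J.toSubmodule) :
    I.Quotient →⋆ₙₐ[ℂ] J.Quotient where
  toFun := I.toSubmodule.mapQ J.toSubmodule (f : R →ₗ[ℂ] S) h
  map_smul' := map_smul _
  map_zero' := map_zero _
  map_add' := map_add _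
  map_mul' a b := by
    obtain ⟨a, rfl⟩ := mk_surjective I a
    obtain ⟨b, rfl⟩ := mk_surjective I b
    change mk J (f (a * b)) = mk J (f a) * mk J (f b)
    rw [map_mul, map_mul]
  map_star' a := by
    obtain ⟨a, rfl⟩ := mk_surjective I a
    change mk J (f (star a)) = star (mk J (f a))
    rw [map_star, map_star]

theorem map_mk (f : R →⋆ₙₐ[ℂ] S) (h : ∀ x ∈ I.toSubmodule, f x ∈ J.toSubmodule) (x : R) :
    map f h (mk I x) = mk J (f x) := rfl

end StarIdeal.Quotient

end StarIdeal

/-! ### Sequence algebras -/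

section SequenceAlgebra

/-- `ℓ^∞(ℕ, A)`: bounded sequences in `A`, with pointwise operations and the supremum norm. -/
abbrev EllInf (A : Type u) [NonUnitalCStarAlgebra A] : Type u := lp (fun _ : ℕ => A) ∞

variable (A : Type u) [NonUnitalCStarAlgebra A]

/-- `c₀(ℕ, A)`, as an ideal of `ℓ^∞(ℕ, A)`. -/
def cZero : StarIdeal (EllInf A) where
  carrier := {x | Tendsto (fun n => ‖x n‖) atTop (𝓝 0)}
  zero_mem' := by simp
  add_mem' {x y} hx hy := by
    refine squeeze_zero (fun n => norm_nonneg _) (fun n => ?_) (by simpa using hx.add hy)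
    simpa using norm_add_le (x n) (y n)
  smul_mem' c x hx := by
    have h : Tendsto (fun n => ‖c‖ * ‖x n‖) atTop (𝓝 0) := by
      simpa using Tendsto.const_mul ‖c‖ hx
    simpa [norm_smul] using h
  mul_left_mem' r x hx := by
    have h : Tendsto (fun n => ‖r‖ * ‖x n‖) atTop (𝓝 0) := by
      simpa using Tendsto.const_mul ‖r‖ hx
    refine squeeze_zero (fun n => norm_nonneg _) (fun n => ?_) h
    rw [lp.infty_coeFn_mul]
    exact (norm_mul_le _ _).trans
      (mul_le_mul_of_nonneg_right (lp.norm_apply_le_norm (by simp) r n) (norm_nonneg _))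
  mul_right_mem' r x hx := by
    have h : Tendsto (fun n => ‖x n‖ * ‖r‖) atTop (𝓝 0) := by
      simpa using Tendsto.mul_const ‖r‖ hx
    refine squeeze_zero (fun n => norm_nonneg _) (fun n => ?_) h
    rw [lp.infty_coeFn_mul]
    exact (norm_mul_le _ _).trans
      (mul_le_mul_of_nonneg_left (lp.norm_apply_le_norm (by simp) r n) (norm_nonneg _))
  star_mem' {x} hx := by
    simpa [lp.star_apply] using hx

/-- The sequence algebra `A_∞ = ℓ^∞(ℕ, A) / c₀(ℕ, A)`, as a complex `*`-algebra. (A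
homomorphism between C*-algebras is just a `*`-homomorphism, so the quotient norm is not
needed below.) -/
abbrev SeqAlg : Type u := (cZero A).Quotient

/-- The quotient map `η_A : ℓ^∞(ℕ, A) → A_∞`. -/
noncomputable def eta : EllInf A →⋆ₙₐ[ℂ] SeqAlg A := StarIdeal.Quotient.mk (cZero A)

/-- The embedding of `A` into `ℓ^∞(ℕ, A)` as constant sequences. -/
noncomputable def constSeq : A →⋆ₙₐ[ℂ] EllInf A where
  toFun a := ⟨fun _ => a, memℓp_infty ⟨‖a‖, by rintro _ ⟨_, rfl⟩; exact le_rfl⟩⟩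
  map_smul' _ _ := rfl
  map_zero' := rfl
  map_add' _ _ := rfl
  map_mul' _ _ := rfl
  map_star' _ := rfl

variable {A} {B : Type v} [NonUnitalCStarAlgebra B]

/-- A `*`-homomorphism applied entrywise to bounded sequences. -/
noncomputable def EllInf.map (f : A →⋆ₙₐ[ℂ] B) : EllInf A →⋆ₙₐ[ℂ] EllInf B where
  toFun x := ⟨fun n => f (x n), memℓp_infty ⟨‖x‖, by
    rintro _ ⟨n, rfl⟩
    exact (NonUnitalStarAlgHom.norm_apply_le f (x n)).trans (lp.norm_apply_le_norm (by simp) x n)⟩⟩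
  map_smul' c x := by ext n; exact map_smul f c (x n)
  map_zero' := by ext n; exact map_zero f
  map_add' x y := by ext n; exact map_add f (x n) (y n)
  map_mul' x y := by ext n; exact map_mul f (x n) (y n)
  map_star' x := by ext n; exact map_star f (x n)

theorem EllInf.map_apply (f : A →⋆ₙₐ[ℂ] B) (x : EllInf A) (n : ℕ) : EllInf.map f x n = f (x n) :=
  rfl

/-- The `*`-homomorphism `A_∞ → B_∞` induced by a `*`-homomorphism `A → B`. -/
noncomputable def SeqAlg.map (f : A →⋆ₙₐ[ℂ] B) : SeqAlg A →⋆ₙₐ[ℂ] SeqAlg B :=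
  StarIdeal.Quotient.map (EllInf.map f) (fun x hx =>
    squeeze_zero (fun _ => norm_nonneg _)
      (fun n => NonUnitalStarAlgHom.norm_apply_le f (x n)) hx)

theorem SeqAlg.map_eta (f : A →⋆ₙₐ[ℂ] B) (x : EllInf A) :
    SeqAlg.map f (eta A x) = eta B (EllInf.map f x) := rfl

end SequenceAlgebra

/-! ### Weak semiprojectivity and sequence algebra extendibility -/

/-- `A` is weakly semiprojective: for every C*-algebra `B`, every `*`-homomorphism `A → B_∞`
lifts to a `*`-homomorphism `A → ℓ^∞(ℕ, B)`. -/
def WeaklySemiprojective (A : Type u) [NonUnitalCStarAlgebra A] : Prop :=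
  ∀ (B : Type v) [NonUnitalCStarAlgebra B] (ψ : A →⋆ₙₐ[ℂ] SeqAlg B),
    ∃ φ : A →⋆ₙₐ[ℂ] EllInf B, (eta B).comp φ = ψ

/-- `θ : A → B` is sequence algebra extendible: for every C*-algebra `E`, every
`*`-homomorphism `A → E_∞` factors as `ρ ∘ θ` for some `*`-homomorphism `ρ : B → E_∞`. -/
def SequenceAlgebraExtendible {A : Type u} {B : Type w} [NonUnitalCStarAlgebra A]
    [NonUnitalCStarAlgebra B] (θ : A →⋆ₙₐ[ℂ] B) : Prop :=
  ∀ (E : Type v) [NonUnitalCStarAlgebra E] (φ : A →⋆ₙₐ[ℂ] SeqAlg E),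
    ∃ ρ : B →⋆ₙₐ[ℂ] SeqAlg E, φ = ρ.comp θ

/-! ### Actions, fixed points, the central sequence algebra, the Rokhlin property -/

/-- A (point-norm) continuous action `G → Aut(A)` by `*`-automorphisms. -/
structure CStarAction (G : Type w) [Group G] [TopologicalSpace G] (A : Type u)
    [NonUnitalCStarAlgebra A] where
  toHom : G →* (A ≃⋆ₐ[ℂ] A)
  continuous_orbit : ∀ a : A, Continuous fun g => toHom g a

namespace CStarAction

variable {G : Type w} [Group G] [TopologicalSpace G] {A : Type u} [NonUnitalCStarAlgebra A]
  (α : CStarAction G A)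

/-- The automorphism `α_g`, as a `*`-homomorphism. -/
def act (g : G) : A →⋆ₙₐ[ℂ] A := (α.toHom g : A →⋆ₙₐ[ℂ] A)

theorem act_one (a : A) : α.act 1 a = a := by
  change α.toHom 1 a = a
  rw [map_one]; rfl

theorem act_mul (g h : G) (a : A) : α.act (g * h) a = α.act g (α.act h a) := by
  change α.toHom (g * h) a = α.toHom g (α.toHom h a)
  rw [map_mul]; rfl

theorem act_inv_act (g : G) (a : A) : α.act g⁻¹ (α.act g a) = a := by
  rw [← act_mul, inv_mul_cancel, act_one]

theorem act_act_inv (g : G) (a : A) : α.act g (α.act g⁻¹ a) = a := by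
  rw [← act_mul, mul_inv_cancel, act_one]

/-- The fixed point algebra `A^α`. -/
def fixedPoints : NonUnitalStarSubalgebra ℂ A where
  carrier := {a | ∀ g, α.act g a = a}
  add_mem' ha hb g := by rw [map_add, ha g, hb g]
  zero_mem' g := map_zero _
  mul_mem' ha hb g := by rw [map_mul, ha g, hb g]
  smul_mem' c a ha g := by rw [map_smul, ha g]
  star_mem' ha g := by rw [map_star, ha g]

instance isClosed_fixedPoints : IsClosed (α.fixedPoints : Set A) := by
  have h : (α.fixedPoints : Set A) = ⋂ g, {a | α.act g a = a} := by
    ext a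
    simp only [Set.mem_iInter]
    rfl
  rw [h]
  exact isClosed_iInter fun g =>
    isClosed_eq (NonUnitalStarAlgHom.instContinuousLinearMapClassComplex.map_continuous (α.act g))
      continuous_id

/-- The canonical inclusion `A^α → A`. -/
def inclusion : α.fixedPoints →⋆ₙₐ[ℂ] A := NonUnitalStarSubalgebraClass.subtype α.fixedPoints

/-- `ℓ^∞_α(ℕ, A)`: the bounded sequences on which `G` acts norm-continuously. -/
noncomputable def ellInfCont : NonUnitalStarSubalgebra ℂ (EllInf A) where
  carrier := {x | Continuous fun g => EllInf.map (α.act g) x}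
  add_mem' ha hb := by
    simp only [Set.mem_ofPred_eq, map_add] at *; exact ha.add hb
  zero_mem' := by
    simp only [Set.mem_ofPred_eq, map_zero]; exact continuous_const
  mul_mem' ha hb := by
    simp only [Set.mem_ofPred_eq, map_mul] at *; exact ha.mul hb
  smul_mem' c a ha := by
    simp only [Set.mem_ofPred_eq, map_smul] at *; exact ha.const_smul c
  star_mem' ha := by
    simp only [Set.mem_ofPred_eq, map_star] at *; exact ha.star

/-- `A_{∞,α} = η_A(ℓ^∞_α(ℕ, A))`. -/
noncomputable def seqAlgCont : NonUnitalStarSubalgebra ℂ (SeqAlg A) :=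
  α.ellInfCont.map (eta A)

end CStarAction

section CentralSequence

variable {A : Type u} [NonUnitalCStarAlgebra A] (D : NonUnitalStarSubalgebra ℂ A)

/-- The relative commutant `A_∞ ∩ D'`. -/
def relCommutant : NonUnitalStarSubalgebra ℂ (SeqAlg A) where
  carrier := {x | ∀ d ∈ D, eta A (constSeq A d) * x = x * eta A (constSeq A d)}
  add_mem' hx hy d hd := by rw [mul_add, add_mul, hx d hd, hy d hd]
  zero_mem' d _ := by rw [mul_zero, zero_mul]
  mul_mem' {x y} hx hy d hd := by rw [← mul_assoc, hx d hd, mul_assoc, hy d hd, mul_assoc]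
  smul_mem' c x hx d hd := by rw [mul_smul_comm, smul_mul_assoc, hx d hd]
  star_mem' {x} hx d hd := by
    have h := congrArg star (hx (star d) (star_mem hd))
    simp only [star_mul, map_star, star_star] at h
    exact h.symm

/-- `Ann(D, A_∞)`, as an ideal of `A_∞ ∩ D'`. -/
def annihilator : StarIdeal (relCommutant D) where
  carrier := {x | ∀ d ∈ D, (x : SeqAlg A) * eta A (constSeq A d) = 0 ∧
    eta A (constSeq A d) * (x : SeqAlg A) = 0}
  add_mem' {x y} hx hy d hd := by
    constructor
    · rw [NonUnitalStarSubalgebra.coe_add, add_mul, (hx d hd).1, (hy d hd).1, add_zero]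
    · rw [NonUnitalStarSubalgebra.coe_add, mul_add, (hx d hd).2, (hy d hd).2, add_zero]
  zero_mem' d _ := by
    constructor
    · rw [NonUnitalStarSubalgebra.coe_zero, zero_mul]
    · rw [NonUnitalStarSubalgebra.coe_zero, mul_zero]
  smul_mem' c x hx d hd := by
    constructor
    · rw [NonUnitalStarSubalgebra.coe_smul, smul_mul_assoc, (hx d hd).1, smul_zero]
    · rw [NonUnitalStarSubalgebra.coe_smul, mul_smul_comm, (hx d hd).2, smul_zero]
  mul_left_mem' r x hx d hd := by
    constructor
    · rw [NonUnitalStarSubalgebra.coe_mul, mul_assoc, (hx d hd).1, mul_zero]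
    · rw [NonUnitalStarSubalgebra.coe_mul, ← mul_assoc, r.2 d hd, mul_assoc, (hx d hd).2, mul_zero]
  mul_right_mem' r x hx d hd := by
    constructor
    · rw [NonUnitalStarSubalgebra.coe_mul, mul_assoc, ← r.2 d hd, ← mul_assoc, (hx d hd).1,
        zero_mul]
    · rw [NonUnitalStarSubalgebra.coe_mul, ← mul_assoc, (hx d hd).2, zero_mul]
  star_mem' {x} hx d hd := by
    have h := hx (star d) (star_mem hd)
    have h1 := congrArg star h.1
    have h2 := congrArg star h.2
    simp only [star_mul, map_star, star_star, star_zero] at h1 h2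
    exact ⟨h2, h1⟩

/-- Kirchberg's central sequence algebra `F(D, A) = (A_∞ ∩ D') / Ann(D, A_∞)`. -/
abbrev CentralSeqAlg : Type u := (annihilator D).Quotient

/-- The quotient map `κ_{D,A} : A_∞ ∩ D' → F(D, A)`. -/
noncomputable def kappa : relCommutant D →⋆ₙₐ[ℂ] CentralSeqAlg D := StarIdeal.Quotient.mk (annihilator D)

end CentralSequence

namespace CStarAction

variable {G : Type w} [Group G] [TopologicalSpace G] {A : Type u} [NonUnitalCStarAlgebra A]
  (α : CStarAction G A)

/-- `D` is an `α`-invariant subalgebra. -/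
def IsInvariant (D : NonUnitalStarSubalgebra ℂ A) : Prop := ∀ g, ∀ d ∈ D, α.act g d ∈ D

/-- The automorphism `(α_∞)_g` of `A_∞`. -/
noncomputable def seqAct (g : G) : SeqAlg A →⋆ₙₐ[ℂ] SeqAlg A := SeqAlg.map (α.act g)

theorem seqAct_const (g : G) (d : A) :
    α.seqAct g (eta A (constSeq A (α.act g⁻¹ d))) = eta A (constSeq A d) := by
  have h : EllInf.map (α.act g) (constSeq A (α.act g⁻¹ d)) = constSeq A d := by
    ext n
    exact α.act_act_inv g d
  exact congrArg (eta A) h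

section RelativeCommutant

variable {D : NonUnitalStarSubalgebra ℂ A}

/-- The restriction of `(α_∞)_g` to `A_∞ ∩ D'`, for an invariant subalgebra `D`. -/
noncomputable def relCommutantAct (hD : α.IsInvariant D) (g : G) :
    relCommutant D →⋆ₙₐ[ℂ] relCommutant D :=
  NonUnitalStarAlgHom.codRestrict
    ((α.seqAct g).comp (NonUnitalStarSubalgebraClass.subtype (relCommutant D)))
    (relCommutant D) (fun x d hd => by
      have h := congrArg (α.seqAct g) (x.2 (α.act g⁻¹ d) (hD g⁻¹ d hd))
      rw [map_mul, map_mul, α.seqAct_const] at h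
      exact h)

theorem coe_relCommutantAct (hD : α.IsInvariant D) (g : G) (x : relCommutant D) :
    (α.relCommutantAct hD g x : SeqAlg A) = α.seqAct g x := rfl

/-- The action `F(α)` of `G` on `F(D, A)` induced by `α_∞`. -/
noncomputable def centralAct (hD : α.IsInvariant D) (g : G) :
    CentralSeqAlg D →⋆ₙₐ[ℂ] CentralSeqAlg D :=
  StarIdeal.Quotient.map (α.relCommutantAct hD g) (fun x hx d hd => by
    have h := hx (α.act g⁻¹ d) (hD g⁻¹ d hd)
    have h1 := congrArg (α.seqAct g) h.1
    have h2 := congrArg (α.seqAct g) h.2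
    rw [map_mul, map_zero, α.seqAct_const] at h1 h2
    exact ⟨h1, h2⟩)

end RelativeCommutant

/-- `F_α(D, A) = κ_{D,A}(A_{∞,α} ∩ D')`. -/
noncomputable def centralCont (D : NonUnitalStarSubalgebra ℂ A) :
    NonUnitalStarSubalgebra ℂ (CentralSeqAlg D) :=
  (α.seqAlgCont.comap (NonUnitalStarSubalgebraClass.subtype (relCommutant D))).map (kappa D)

/-- Left translation on `C(G)`: `Lt_g(f)(x) = f(g⁻¹x)`. -/
noncomputable def leftTranslate [ContinuousMul G] (g : G) (f : C(G, ℂ)) : C(G, ℂ) :=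
  f.comp ⟨fun x => g⁻¹ * x, continuous_const.mul continuous_id⟩

/-- The Rokhlin property: for every separable `α`-invariant C*-subalgebra `D` of `A` there is a
unital equivariant `*`-homomorphism `(C(G), Lt) → (F_α(D, A), F(α))`. -/
def HasRokhlinProperty [ContinuousMul G] : Prop :=
  ∀ (D : NonUnitalStarSubalgebra ℂ A), IsClosed (D : Set A) →
    TopologicalSpace.IsSeparable (D : Set A) → ∀ hD : α.IsInvariant D,
    ∃ φ : C(G, ℂ) →⋆ₙₐ[ℂ] α.centralCont D,
      (∀ x : α.centralCont D, φ 1 * x = x ∧ x * φ 1 = x) ∧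
      ∀ (g : G) (f : C(G, ℂ)),
        (φ (leftTranslate g f) : CentralSeqAlg D) = α.centralAct hD g (φ f : CentralSeqAlg D)

/-! ### Crossed products by finite groups -/

/-- The crossed product `A ⋊_α G` of a finite group `G`. Its elements are the functions `G → A`,
where `f` stands for the formal sum `∑ g, f(g) u_g` subject to `u_g a u_g* = α_g(a)`; its
product is twisted convolution, and its norm is the one given by the regular representation
(for a finite group the algebra of functions is already complete, and the full and reduced
crossed products agree). -/
structure CrossedProduct {G : Type w} [Group G] [TopologicalSpace G] {A : Type u}
    [NonUnitalCStarAlgebra A] (α : CStarAction G A) : Type (max u w) where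
  coeff : G → A

namespace CrossedProduct

@[ext] theorem ext' {α : CStarAction G A} {x y : CrossedProduct α}
    (h : ∀ g, x.coeff g = y.coeff g) : x = y := by
  cases x; cases y; congr; exact funext h

variable {α}

instance : Zero (CrossedProduct α) := ⟨⟨fun _ => 0⟩⟩
instance : Add (CrossedProduct α) := ⟨fun x y => ⟨fun g => x.coeff g + y.coeff g⟩⟩
instance : Neg (CrossedProduct α) := ⟨fun x => ⟨fun g => -x.coeff g⟩⟩
instance : Sub (CrossedProduct α) := ⟨fun x y => ⟨fun g => x.coeff g - y.coeff g⟩⟩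
instance : SMul ℕ (CrossedProduct α) := ⟨fun n x => ⟨fun g => n • x.coeff g⟩⟩
instance : SMul ℤ (CrossedProduct α) := ⟨fun n x => ⟨fun g => n • x.coeff g⟩⟩
instance : SMul ℂ (CrossedProduct α) := ⟨fun c x => ⟨fun g => c • x.coeff g⟩⟩

/-- `(x * y)(g) = ∑ h, x(h) α_h(y(h⁻¹g))`. -/
instance [Fintype G] : Mul (CrossedProduct α) :=
  ⟨fun x y => ⟨fun g => ∑ h, x.coeff h * α.act h (y.coeff (h⁻¹ * g))⟩⟩

/-- `x*(g) = α_g(x(g⁻¹)*)`. -/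
instance : Star (CrossedProduct α) := ⟨fun x => ⟨fun g => α.act g (star (x.coeff g⁻¹))⟩⟩

/-- The regular representation of `A ⋊_α G` on the Hilbert module `ℓ²(G, A)`, in matrix form:
`a u_g` maps `ξ` to `s ↦ α_s⁻¹(a) ξ(g⁻¹s)`. -/
def regularRep (x : CrossedProduct α) : CStarMatrix G G A :=
  CStarMatrix.ofMatrix (Matrix.of fun s t => α.act s⁻¹ (x.coeff (s * t⁻¹)))

theorem regularRep_apply (x : CrossedProduct α) (s t : G) :
    regularRep x s t = α.act s⁻¹ (x.coeff (s * t⁻¹)) := rfl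

theorem coeff_eq (x : CrossedProduct α) (g : G) : x.coeff g = regularRep x 1 g⁻¹ := by
  rw [regularRep_apply, inv_one, act_one, one_mul, inv_inv]

theorem regularRep_injective :
    Function.Injective (regularRep : CrossedProduct α → CStarMatrix G G A) := by
  intro x y h
  ext g
  rw [coeff_eq, coeff_eq, h]

theorem regularRep_zero : regularRep (0 : CrossedProduct α) = 0 := by
  ext s t; exact map_zero (α.act s⁻¹)

theorem regularRep_add (x y : CrossedProduct α) :
    regularRep (x + y) = regularRep x + regularRep y := by
  ext s t; exact map_add (α.act s⁻¹) _ _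

theorem regularRep_neg (x : CrossedProduct α) : regularRep (-x) = -regularRep x := by
  ext s t; exact map_neg (α.act s⁻¹) _

theorem regularRep_sub (x y : CrossedProduct α) :
    regularRep (x - y) = regularRep x - regularRep y := by
  ext s t; exact map_sub (α.act s⁻¹) _ _

theorem regularRep_nsmul (x : CrossedProduct α) (n : ℕ) :
    regularRep (n • x) = n • regularRep x := by
  ext s t; exact map_nsmul (α.act s⁻¹) n _

theorem regularRep_zsmul (x : CrossedProduct α) (n : ℤ) :
    regularRep (n • x) = n • regularRep x := by
  ext s t; exact map_zsmul (α.act s⁻¹) n _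

theorem regularRep_smul (c : ℂ) (x : CrossedProduct α) :
    regularRep (c • x) = c • regularRep x := by
  ext s t; exact map_smul (α.act s⁻¹) c _

theorem regularRep_star (x : CrossedProduct α) : regularRep (star x) = star (regularRep x) := by
  ext s t
  change α.act s⁻¹ (α.act (s * t⁻¹) (star (x.coeff (s * t⁻¹)⁻¹))) =
    star (α.act t⁻¹ (x.coeff (t * s⁻¹)))
  rw [← act_mul, ← map_star, inv_mul_cancel_left, mul_inv_rev, inv_inv]

theorem regularRep_mul [Fintype G] (x y : CrossedProduct α) :
    regularRep (x * y) = regularRep x * regularRep y := by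
  ext s t
  rw [CStarMatrix.mul_apply]
  change α.act s⁻¹ (∑ h, x.coeff h * α.act h (y.coeff (h⁻¹ * (s * t⁻¹)))) = _
  rw [map_sum]
  refine Fintype.sum_equiv ((Equiv.inv G).trans (Equiv.mulRight s)) _ _ (fun h => ?_)
  simp only [Equiv.trans_apply, Equiv.inv_apply, Equiv.coe_mulRight, regularRep_apply, map_mul,
    ← act_mul, mul_inv_rev, inv_inv, mul_inv_cancel_left, mul_assoc]

instance [Fintype G] : NonUnitalRing (CrossedProduct α) :=
  regularRep_injective.nonUnitalRing regularRep regularRep_zero regularRep_add regularRep_mul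
    regularRep_neg regularRep_sub (fun n x => regularRep_nsmul x n)
    (fun n x => regularRep_zsmul x n)

/-- The regular representation as an additive map. -/
def regularRepAdd [Fintype G] : CrossedProduct α →+ CStarMatrix G G A where
  toFun := regularRep
  map_zero' := regularRep_zero
  map_add' := regularRep_add

instance [Fintype G] : Module ℂ (CrossedProduct α) :=
  regularRep_injective.module ℂ regularRepAdd regularRep_smul

instance [Fintype G] : StarRing (CrossedProduct α) where
  star_involutive x := regularRep_injective (by
    rw [regularRep_star, regularRep_star, star_star])
  star_mul x y := regularRep_injective (by
    rw [regularRep_star, regularRep_mul, regularRep_mul, regularRep_star, regularRep_star,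
      star_mul])
  star_add x y := regularRep_injective (by
    rw [regularRep_star, regularRep_add, regularRep_add, regularRep_star, regularRep_star,
      star_add])

/-- The regular representation as a `*`-homomorphism. -/
def regularRepHom [Fintype G] : CrossedProduct α →⋆ₙₐ[ℂ] CStarMatrix G G A where
  toFun := regularRep
  map_smul' := regularRep_smul
  map_zero' := regularRep_zero
  map_add' := regularRep_add
  map_mul' := regularRep_mul
  map_star' := regularRep_star

theorem range_regularRep :
    Set.range (regularRep : CrossedProduct α → CStarMatrix G G A) =
      ⋂ (s : G) (t : G), {m | m s t = α.act s⁻¹ (m 1 (s * t⁻¹)⁻¹)} := by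
  ext m
  simp only [Set.mem_range, Set.mem_iInter, Set.mem_ofPred_eq]
  constructor
  · rintro ⟨x, rfl⟩ s t
    rw [← coeff_eq, regularRep_apply]
  · intro h
    refine ⟨⟨fun g => m 1 g⁻¹⟩, ?_⟩
    ext s t
    rw [h s t, regularRep_apply]

section Norm

variable [Fintype G]

/-- The norm of the regular representation; `CStarMatrix G G A` carries its C*-norm, the operator
norm on the Hilbert module `A^G`. -/
noncomputable instance : NonUnitalNormedRing (CrossedProduct α) :=
  letI := CStarAlgebra.spectralOrder A
  letI := CStarAlgebra.spectralOrderedRing A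
  NonUnitalNormedRing.induced (CrossedProduct α) (CStarMatrix G G A)
    (regularRepHom : CrossedProduct α →⋆ₙₐ[ℂ] CStarMatrix G G A) regularRep_injective

theorem isometry_regularRep :
    letI := CStarAlgebra.spectralOrder A
    letI := CStarAlgebra.spectralOrderedRing A
    Isometry (regularRep : CrossedProduct α → CStarMatrix G G A) := by
  let := CStarAlgebra.spectralOrder A
  let := CStarAlgebra.spectralOrderedRing A
  exact Isometry.of_dist_eq fun _ _ => rfl

theorem norm_eq (x : CrossedProduct α) :
    letI := CStarAlgebra.spectralOrder A
    letI := CStarAlgebra.spectralOrderedRing A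
    ‖x‖ = ‖regularRep x‖ := rfl

instance : CompleteSpace (CrossedProduct α) := by
  let := CStarAlgebra.spectralOrder A
  let := CStarAlgebra.spectralOrderedRing A
  refine (completeSpace_iff_isComplete_range
    (isometry_regularRep (α := α)).isUniformInducing).2 (IsClosed.isComplete ?_)
  rw [range_regularRep]
  have hc : ∀ s t : G, Continuous fun m : CStarMatrix G G A => m s t := fun s t =>
    (continuous_apply_apply s t : Continuous fun m : G → G → A => m s t)
  exact isClosed_iInter fun s => isClosed_iInter fun t => isClosed_eq (hc s t)
    ((NonUnitalStarAlgHom.instContinuousLinearMapClassComplex.map_continuous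
      (α.act s⁻¹)).comp (hc 1 _))

noncomputable instance : NonUnitalCStarAlgebra (CrossedProduct α) where
  norm_mul_self_le x := by
    let := CStarAlgebra.spectralOrder A
    let := CStarAlgebra.spectralOrderedRing A
    rw [norm_eq, norm_eq, regularRep_mul, regularRep_star]
    exact CStarRing.norm_mul_self_le _
  norm_smul_le c x := by
    let := CStarAlgebra.spectralOrder A
    let := CStarAlgebra.spectralOrderedRing A
    rw [norm_eq, norm_eq, regularRep_smul]
    exact norm_smul_le _ _
  smul_assoc c x y := regularRep_injective (by
    let := CStarAlgebra.spectralOrder A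
    let := CStarAlgebra.spectralOrderedRing A
    simp only [smul_eq_mul]
    rw [regularRep_mul, regularRep_smul, regularRep_smul, regularRep_mul, smul_mul_assoc])
  smul_comm c x y := regularRep_injective (by
    let := CStarAlgebra.spectralOrder A
    let := CStarAlgebra.spectralOrderedRing A
    simp only [smul_eq_mul]
    rw [regularRep_mul, regularRep_smul, regularRep_smul, regularRep_mul, mul_smul_comm])
  star_smul c x := regularRep_injective (by
    rw [regularRep_star, regularRep_smul, regularRep_smul, regularRep_star, star_smul])

end Norm

end CrossedProduct

end CStarAction

end RokhlinFP

set_option linter.unusedSectionVars false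

/-! The Rokhlin property makes the inclusion `A^α → A` sequentially split. Applied with `D = A`, it
yields elements `F(f)` of `A_∞`, for `f ∈ C(G)`, that commute with the constant sequences and are
linear, multiplicative, `*`-preserving and equivariant once multiplied by a constant `a ∈ A`
(`nonempty_rokhlinLift`). Hence `f ⊗ a ↦ F(f) a` respects products and adjoints; it is contractive
for the supremum norm of `C(G, A)` (`norm_lift_bilin_le`) and extends to a `*`-homomorphism `C(G, A)
→ A_∞`, equivariant for the diagonal action. Orbit maps `g ↦ α_g(a)` are invariant in `C(G, A)`, so
`A` is carried into the invariants of `A_∞`, and Haar averaging shows that these come from `(A^α)_∞`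
(`exists_map_inclusion_eq`). The result is `ψ : A → (A^α)_∞` sending fixed points to constant
sequences. A homomorphism `φ : A^α → E_∞` then gives `φ_∞ ∘ ψ : A → (E_∞)_∞`, and separability of
`A` permits a diagonal reindexing to `A → E_∞` that keeps the values on `A^α`
(`exists_reindexed_hom`). Weak semiprojectivity passes to `A^α` by extending to `A`, lifting there
and restricting.

For finite `G`, work in matrices over the unitization of `A`, with the ideal `J = M_G(A)`. The
regular representation identifies the crossed product with the elements of `J` fixed by every `Ad
ρ_h ∘ α_h`, where `ρ` is the right regular representation by permutation matrices, while `M_G(A^α)`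
consists of those fixed by every `α_h`. The Rokhlin partition of unity untwists the cocycle `ρ`:
from a unitary `X` one glues the family `ρ_g α_g(X)` into a unitary almost fixed by `U ↦ ρ_g
α_g(U)`, close to `X` if `X` was already almost fixed (`exists_almost_invariant`). The partition is
only approximate and only acts well on `J`, so honest unitaries are obtained by gluing logarithms
(`liftable_exp`); this is why all unitaries are kept inside the products of exponentials, to which
permutation matrices belong. Iteration gives unitaries `X_k` such that the limit of `Ad X_k` on `J`
is the isomorphism.

For weak semiprojectivity of the crossed product it remains to lift homomorphisms `M_n(D) → B_∞`
when `D` is weakly semiprojective (`exists_matrix_lift`). Such a homomorphism is implemented by a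
column of approximate matrix units (`exists_column`). A polar decomposition makes the column exactly
orthogonal in the unitization of `ℓ^∞(ℕ, B)` (`exists_exact_column`). The corner `D → B_∞` is lifted
into the subalgebra on which the support of the column acts as a unit (`exists_lift_mem_unitFor`),
and column and corner together define the lift. -/

namespace RokhlinFP

/-! ### The C*-norm of the sequence algebra. -/

section SeqAlgNorm

variable {A : Type u} [NonUnitalCStarAlgebra A]

theorem mem_cZero_iff {x : EllInf A} :
    x ∈ (cZero A).toSubmodule ↔ Tendsto (fun n => ‖x n‖) atTop (𝓝 0) := Iff.rfl

theorem eta_eq_iff {x y : EllInf A} :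
    eta A x = eta A y ↔ Tendsto (fun n => ‖x n - y n‖) atTop (𝓝 0) :=
  StarIdeal.Quotient.mk_eq_iff

theorem eta_eq_zero_iff {x : EllInf A} :
    eta A x = 0 ↔ Tendsto (fun n => ‖x n‖) atTop (𝓝 0) := by
  rw [← map_zero (eta A), eta_eq_iff]
  simp

theorem eta_surjective : Function.Surjective (eta A) :=
  StarIdeal.Quotient.mk_surjective (cZero A)

theorem norm_apply_le (x : EllInf A) (n : ℕ) : ‖x n‖ ≤ ‖x‖ :=
  lp.norm_apply_le_norm (by simp) x n

/-- A bounded sequence, as an element of `ℓ^∞`. -/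
def EllInf.mk (x : ℕ → A) (C : ℝ) (h : ∀ n, ‖x n‖ ≤ C) : EllInf A :=
  ⟨x, memℓp_infty ⟨C, by rintro _ ⟨n, rfl⟩; exact h n⟩⟩

theorem EllInf.norm_le {x : EllInf A} {C : ℝ} (h0 : 0 ≤ C) (h : ∀ n, ‖x n‖ ≤ C) : ‖x‖ ≤ C :=
  lp.norm_le_of_forall_le h0 h

@[simp] theorem constSeq_apply (a : A) (n : ℕ) : constSeq A a n = a := rfl

/-- The tail of a bounded sequence, with the first `N` terms replaced by zero. -/
noncomputable def EllInf.tail (N : ℕ) (x : EllInf A) : EllInf A :=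
  EllInf.mk (fun n => if n < N then 0 else x n) ‖x‖ (fun n => by
    dsimp only
    split_ifs
    · simp
    · exact norm_apply_le x n)

theorem EllInf.tail_apply (N : ℕ) (x : EllInf A) (n : ℕ) :
    EllInf.tail N x n = if n < N then 0 else x n := rfl

theorem EllInf.eta_tail (N : ℕ) (x : EllInf A) : eta A (EllInf.tail N x) = eta A x := by
  rw [eta_eq_iff]
  refine tendsto_const_nhds.congr' ?_
  filter_upwards [eventually_ge_atTop N] with n hn
  rw [EllInf.tail_apply, if_neg (not_lt.2 hn), sub_self, norm_zero]

instance isClosed_cZero : IsClosed ((cZero A).toSubmodule : Set (EllInf A)) := by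
  rw [← isSeqClosed_iff_isClosed]
  intro x y hx hxy
  rw [SetLike.mem_coe, mem_cZero_iff, Metric.tendsto_atTop]
  intro ε hε
  obtain ⟨k, hk⟩ := (Metric.tendsto_atTop.1 hxy (ε / 2) (half_pos hε))
  obtain ⟨N, hN⟩ := Metric.tendsto_atTop.1 (mem_cZero_iff.1 (hx k)) (ε / 2) (half_pos hε)
  refine ⟨N, fun n hn => ?_⟩
  have h1 := hN n hn
  have h2 := hk k le_rfl
  rw [dist_eq_norm] at h2
  have h3 := (norm_apply_le (x k - y) n).trans_lt h2
  simp only [dist_zero_right, norm_norm] at h1 ⊢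
  calc ‖y n‖ = ‖x k n - (x k - y) n‖ := by simp
    _ ≤ ‖x k n‖ + ‖(x k - y) n‖ := norm_sub_le _ _
    _ < ε := by linarith

/-- With the quotient norm `A_∞` becomes a C*-algebra, so that homomorphisms into it are contractive
and the iterated sequence algebra `(A_∞)_∞` makes sense. -/
noncomputable instance : NormedAddCommGroup (SeqAlg A) :=
  inferInstanceAs (NormedAddCommGroup (EllInf A ⧸ (cZero A).toSubmodule))

instance : CompleteSpace (SeqAlg A) :=
  inferInstanceAs (CompleteSpace (EllInf A ⧸ (cZero A).toSubmodule))

theorem norm_eta_le (x : EllInf A) : ‖eta A x‖ ≤ ‖x‖ :=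
  Submodule.Quotient.norm_mk_le (cZero A).toSubmodule x

/-- Some representative has norm close to the quotient norm, and two representatives differ by a
null sequence. With `norm_eta_le_of_eventually` this says that the quotient norm is `limsup ‖x n‖`.
-/
theorem eventually_norm_lt_of_norm_eta_lt {x : EllInf A} {r : ℝ} (h : ‖eta A x‖ < r) :
    ∀ᶠ n in atTop, ‖x n‖ < r := by
  obtain ⟨y, hy, hyr⟩ := Submodule.Quotient.norm_mk_lt (S := (cZero A).toSubmodule) (eta A x)
    (half_pos (sub_pos.2 h))
  replace hyr : ‖y‖ < ‖eta A x‖ + (r - ‖eta A x‖) / 2 := hyr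
  have hxy := eta_eq_iff.1 (show eta A x = eta A y from hy.symm)
  filter_upwards [hxy.eventually_lt_const (half_pos (sub_pos.2 h))] with n hn
  have h1 := norm_apply_le y n
  have h2 : ‖x n‖ ≤ ‖x n - y n‖ + ‖y n‖ := by
    simpa using norm_add_le (x n - y n) (y n)
  linarith

theorem norm_eta_le_of_eventually {x : EllInf A} {r : ℝ} (h : ∀ᶠ n in atTop, ‖x n‖ ≤ r) :
    ‖eta A x‖ ≤ r := by
  obtain ⟨N, hN⟩ := eventually_atTop.1 h
  rw [← EllInf.eta_tail N]
  refine (norm_eta_le _).trans (EllInf.norm_le ((norm_nonneg _).trans (hN N le_rfl)) fun n => ?_)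
  rw [EllInf.tail_apply]
  split_ifs with hn
  · rw [norm_zero]; exact (norm_nonneg _).trans (hN N le_rfl)
  · exact hN n (not_lt.1 hn)

noncomputable instance : NonUnitalNormedRing (SeqAlg A) where
  __ := (inferInstance : NormedAddCommGroup (SeqAlg A))
  __ := (inferInstance : NonUnitalRing (SeqAlg A))
  norm_mul_le a b := by
    obtain ⟨x, rfl⟩ := eta_surjective a
    obtain ⟨y, rfl⟩ := eta_surjective b
    refine le_of_forall_gt_imp_ge_of_dense fun r hr => ?_
    have hc : Tendsto (fun δ : ℝ => (‖eta A x‖ + δ) * (‖eta A y‖ + δ)) (𝓝[>] 0)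
        (𝓝 (‖eta A x‖ * ‖eta A y‖)) := by
      have : Continuous fun δ : ℝ => (‖eta A x‖ + δ) * (‖eta A y‖ + δ) := by fun_prop
      simpa using (this.tendsto 0).mono_left nhdsWithin_le_nhds
    obtain ⟨δ, hδr, hδ⟩ := ((hc.eventually_lt_const hr).and self_mem_nhdsWithin).exists
    rw [← map_mul]
    refine norm_eta_le_of_eventually ?_
    filter_upwards [eventually_norm_lt_of_norm_eta_lt (lt_add_of_pos_right ‖eta A x‖ hδ),
      eventually_norm_lt_of_norm_eta_lt (lt_add_of_pos_right ‖eta A y‖ hδ)] with n h1 h2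
    rw [lp.infty_coeFn_mul]
    exact ((norm_mul_le _ _).trans
      (mul_le_mul h1.le h2.le (norm_nonneg _) ((norm_nonneg _).trans h1.le))).trans hδr.le

noncomputable instance : NonUnitalCStarAlgebra (SeqAlg A) where
  norm_mul_self_le a := by
    obtain ⟨x, rfl⟩ := eta_surjective a
    rw [← map_star, ← map_mul]
    refine le_of_forall_gt_imp_ge_of_dense fun r hr => ?_
    have h0 : 0 ≤ r := (norm_nonneg _).trans hr.le
    have h : ‖eta A x‖ ≤ √r := by
      refine norm_eta_le_of_eventually ?_
      filter_upwards [eventually_norm_lt_of_norm_eta_lt hr] with n hn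
      refine Real.le_sqrt_of_sq_le ?_
      rw [lp.infty_coeFn_mul, Pi.mul_apply, lp.star_apply, CStarRing.norm_star_mul_self] at hn
      rw [sq]; exact hn.le
    calc ‖eta A x‖ * ‖eta A x‖ ≤ √r * √r := by gcongr
      _ = r := Real.mul_self_sqrt h0
  norm_smul_le c a := by
    obtain ⟨x, rfl⟩ := eta_surjective a
    rw [← map_smul]
    refine le_of_forall_gt_imp_ge_of_dense fun r hr => ?_
    have hc : Tendsto (fun δ : ℝ => ‖c‖ * (‖eta A x‖ + δ)) (𝓝[>] 0)
        (𝓝 (‖c‖ * ‖eta A x‖)) := by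
      have : Continuous fun δ : ℝ => ‖c‖ * (‖eta A x‖ + δ) := by fun_prop
      simpa using (this.tendsto 0).mono_left nhdsWithin_le_nhds
    obtain ⟨δ, hδr, hδ⟩ := ((hc.eventually_lt_const hr).and self_mem_nhdsWithin).exists
    refine norm_eta_le_of_eventually ?_
    filter_upwards [eventually_norm_lt_of_norm_eta_lt (lt_add_of_pos_right ‖eta A x‖ hδ)] with n hn
    rw [lp.coeFn_smul, Pi.smul_apply, norm_smul]
    exact (mul_le_mul_of_nonneg_left hn.le (norm_nonneg _)).trans hδr.le

theorem norm_eta_constSeq (a : A) : ‖eta A (constSeq A a)‖ = ‖a‖ := by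
  refine le_antisymm (norm_eta_le_of_eventually (.of_forall fun _ => le_rfl)) ?_
  refine le_of_forall_gt_imp_ge_of_dense fun r hr => ?_
  obtain ⟨n, hn⟩ := (eventually_norm_lt_of_norm_eta_lt hr).exists
  exact hn.le

variable {B : Type v} [NonUnitalCStarAlgebra B]

theorem SeqAlg.map_injective {f : A →⋆ₙₐ[ℂ] B} (hf : ∀ a, ‖f a‖ = ‖a‖) :
    Function.Injective (SeqAlg.map f) := by
  rw [injective_iff_map_eq_zero]
  intro a ha
  obtain ⟨x, rfl⟩ := eta_surjective a
  rw [SeqAlg.map_eta, eta_eq_zero_iff] at ha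
  rw [eta_eq_zero_iff]
  simpa only [EllInf.map_apply, hf] using ha

end SeqAlgNorm

/-! ### Reindexing iterated sequence algebras. -/

section Reindexing

/-- A diagonal argument: countably many double sequences that are asymptotically small along
iterated limits are simultaneously small along a common reindexing. -/
theorem exists_reindexing {ι : Type*} [Countable ι] (F : ι → ℕ → ℕ → ℝ)
    (h : ∀ i, ∀ ε > 0, ∀ᶠ m in atTop, ∀ᶠ n in atTop, F i m n < ε) :
    ∃ m : ℕ → ℕ, ∀ i, ∀ ε > 0, ∀ᶠ n in atTop, F i (m n) n < ε := by
  obtain ⟨f, hf⟩ := exists_injective_nat ι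
  have hfin : ∀ k : ℕ, {i | f i ≤ k}.Finite := fun k =>
    Set.Finite.preimage hf.injOn (Set.finite_Iic k)
  have h1 : ∀ k : ℕ, ∃ M N : ℕ, ∀ n ≥ N, ∀ i, f i ≤ k → F i M n < 1 / ((k : ℝ) + 1) := by
    intro k
    have h2 : ∀ᶠ m in atTop, ∀ i ∈ {i | f i ≤ k}, ∀ᶠ n in atTop,
        F i m n < 1 / ((k : ℝ) + 1) :=
      (eventually_all_finite (hfin k)).2 fun i _ => h i _ (by positivity)
    obtain ⟨M, hM⟩ := h2.exists
    obtain ⟨N, hN⟩ := eventually_atTop.1 ((eventually_all_finite (hfin k)).2 hM)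
    exact ⟨M, N, fun n hn i hi => hN n hn i hi⟩
  choose M N hMN using h1
  -- At time `n` use the last stage `k ≤ n` whose threshold `N k` has been passed. This stage tends
  -- to infinity even though `N` need not be monotone.
  refine ⟨fun n => M (Nat.findGreatest (fun k => N k ≤ n) n), fun i ε hε => ?_⟩
  obtain ⟨k, hk⟩ := exists_nat_one_div_lt hε
  filter_upwards [eventually_ge_atTop (max (max (f i) k) (N (max (f i) k)))] with n hn
  have hn1 : max (f i) k ≤ n := (le_max_left _ _).trans hn
  have hn2 : N (max (f i) k) ≤ n := (le_max_right _ _).trans hn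
  have h3 : max (f i) k ≤ Nat.findGreatest (fun k => N k ≤ n) n := Nat.le_findGreatest hn1 hn2
  have h4 : N (Nat.findGreatest (fun k => N k ≤ n) n) ≤ n :=
    Nat.findGreatest_spec (P := fun k => N k ≤ n) hn1 hn2
  refine (hMN _ n h4 i ((le_max_left _ _).trans h3)).trans_le (le_trans ?_ hk.le)
  have h5 : (k : ℝ) ≤ (Nat.findGreatest (fun k => N k ≤ n) n : ℝ) := by
    exact_mod_cast (le_max_right _ _).trans h3
  gcongr

variable {A : Type u} [NonUnitalCStarAlgebra A] {E : Type v} [NonUnitalCStarAlgebra E]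

/-- The explicit bound keeps sequences picked diagonally from many lifts bounded. -/
theorem exists_lift_norm_le (a : SeqAlg E) : ∃ x : EllInf E, eta E x = a ∧ ‖x‖ ≤ ‖a‖ + 1 := by
  obtain ⟨y, hy, hyr⟩ := Submodule.Quotient.norm_mk_lt (S := (cZero E).toSubmodule) a one_pos
  exact ⟨y, hy, hyr.le⟩

/-- A map between C*-algebras is a `*`-homomorphism as soon as it respects all `*`-polynomial
expressions up to the norm of the source. -/
theorem exists_starHom_of_norm_le {F : Type*} [NonUnitalCStarAlgebra F] (ρ : A → F)
    (h : ∀ (l : ℂ) (a b d f c : A),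
      ‖ρ a * ρ b + l • ρ d + star (ρ f) - ρ c‖ ≤ ‖a * b + l • d + star f - c‖) :
    ∃ ρ' : A →⋆ₙₐ[ℂ] F, ∀ a, ρ' a = ρ a := by
  have h' : ∀ (l : ℂ) (a b d f c : A), a * b + l • d + star f = c →
      ρ a * ρ b + l • ρ d + star (ρ f) = ρ c := by
    intro l a b d f c hc
    have := h l a b d f c
    rw [hc, sub_self, norm_zero] at this
    exact sub_eq_zero.1 (norm_le_zero_iff.1 this)
  -- Evaluating at zero with `l = 0` and with `l = 1` gives two relations that differ by `ρ 0`.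
  have h0 : ρ 0 = 0 := by
    have h1 := h' 0 0 0 0 0 0 (by simp)
    have h2 := h' 1 0 0 0 0 0 (by simp)
    rw [zero_smul, add_zero] at h1
    rw [one_smul, add_right_comm, h1] at h2
    simpa using h2
  have hstar : ∀ a, ρ (star a) = star (ρ a) := fun a => by
    simpa [h0] using (h' 0 0 0 0 a (star a) (by simp)).symm
  exact ⟨{ toFun := ρ
           map_smul' := fun l a => by simpa [h0] using (h' l 0 0 a 0 (l • a) (by simp)).symm
           map_zero' := h0
           -- The second summand enters through the adjoint slot, as the adjoint of `star b`.
           map_add' := fun a b => by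
             simpa [h0, hstar] using (h' 1 0 0 a (star b) (a + b) (by simp)).symm
           map_mul' := fun a b => by simpa [h0] using (h' 0 a b 0 0 (a * b) (by simp)).symm
           map_star' := hstar }, fun a => rfl⟩

/-- A `*`-homomorphism into an iterated sequence algebra of a separable C*-algebra can be
reindexed to one into the sequence algebra, keeping its values wherever they are constant. -/
theorem exists_reindexed_hom [TopologicalSpace.SeparableSpace A]
    (σ : A →⋆ₙₐ[ℂ] SeqAlg (SeqAlg E)) (S : Set A) (e : A → SeqAlg E)
    (hS : ∀ s ∈ S, σ s = eta _ (constSeq _ (e s))) :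
    ∃ ρ : A →⋆ₙₐ[ℂ] SeqAlg E, ∀ s ∈ S, ρ s = e s := by
  have : SecondCountableTopology A := UniformSpace.secondCountable_of_separable A
  obtain ⟨QS, hQS, hQSc, hQSd⟩ :=
    (TopologicalSpace.IsSeparable.of_separableSpace S).exists_countable_dense_subset
  obtain ⟨Q0, hQ0c, hQ0d⟩ := TopologicalSpace.exists_countable_dense A
  -- A countable set of test elements: dense in `A`, containing a dense part of `S` so that the
  -- values there survive, and containing zero so that slots can be left empty.
  set Q := QS ∪ (insert 0 Q0) with hQ
  have hzQ : (0 : A) ∈ Q := Or.inr (Set.mem_insert _ _)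
  have hQd : Dense Q := hQ0d.mono ((Set.subset_insert _ _).trans Set.subset_union_right)
  have : Countable Q := (hQSc.union (hQ0c.insert 0)).to_subtype
  have : Countable QS := hQSc.to_subtype
  choose x hx using fun a : A => eta_surjective (σ a)
  choose y hy hyn using fun (a : A) (m : ℕ) => exists_lift_norm_le (x a m)
  choose e' he' using fun a : A => eta_surjective (e a)
  -- The double sequence `y a m n` represents `σ a` in `(E_∞)_∞`. The first family measures the
  -- excess of a `*`-polynomial over its norm in `A`, the second the distance to the prescribed
  -- value.
  let F : (ℕ × Q × Q × Q × Q × Q) ⊕ QS → ℕ → ℕ → ℝ := fun i m n => match i with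
    | .inl (l, a, b, d, f, c) =>
      ‖y a m n * y b m n + (TopologicalSpace.denseSeq ℂ l) • y d m n + star (y f m n) - y c m n‖ -
      ‖(a : A) * b + (TopologicalSpace.denseSeq ℂ l) • (d : A) + star (f : A) - c‖
    | .inr a => ‖y a m n - e' a n‖
  have hF : ∀ i, ∀ ε > 0, ∀ᶠ m in atTop, ∀ᶠ n in atTop, F i m n < ε := by
    rintro (⟨l, a, b, d, f, c⟩ | a) ε hε
    · set z := TopologicalSpace.denseSeq ℂ l
      have h1 : ‖eta _ (x a * x b + z • x d + star (x f) - x c)‖ <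
          ‖(a : A) * b + z • (d : A) + star (f : A) - c‖ + ε := by
        rw [map_sub, map_add, map_add, map_smul, map_mul, map_star, hx, hx, hx, hx, hx, ← map_mul,
          ← map_smul, ← map_star, ← map_add, ← map_add, ← map_sub]
        exact (NonUnitalStarAlgHom.norm_apply_le σ _).trans_lt (lt_add_of_pos_right _ hε)
      filter_upwards [eventually_norm_lt_of_norm_eta_lt h1] with m hm
      have h2 : ‖eta _ (y a m * y b m + z • y d m + star (y f m) - y c m)‖ <
          ‖(a : A) * b + z • (d : A) + star (f : A) - c‖ + ε := by
        rw [map_sub, map_add, map_add, map_smul, map_mul, map_star, hy, hy, hy, hy, hy]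
        exact hm
      filter_upwards [eventually_norm_lt_of_norm_eta_lt h2] with n hn
      exact sub_lt_iff_lt_add'.2 hn
    · have h1 : ‖eta _ (x a - constSeq _ (e a))‖ < ε := by
        rw [map_sub, hx, hS a (hQS a.2), sub_self, norm_zero]; exact hε
      filter_upwards [eventually_norm_lt_of_norm_eta_lt h1] with m hm
      have h2 : ‖eta _ (y a m - e' a)‖ < ε := by
        rw [map_sub, hy, he']; exact hm
      exact eventually_norm_lt_of_norm_eta_lt h2
  obtain ⟨m, hm⟩ := exists_reindexing F hF
  let ρ₀ : A → SeqAlg E := fun a => eta E (EllInf.mk (fun n => y a (m n) n) (‖x a‖ + 1) fun n =>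
    (norm_apply_le _ n).trans ((hyn a (m n)).trans
      (add_le_add_left (norm_apply_le (x a) (m n)) 1)))
  have hρ1 : ∀ (l : ℂ) (a b d f c : Q), ‖ρ₀ a * ρ₀ b + l • ρ₀ d + star (ρ₀ f) - ρ₀ c‖ ≤
      ‖(a : A) * b + l • (d : A) + star (f : A) - c‖ := by
    intro l a b d f c
    refine (TopologicalSpace.denseRange_denseSeq ℂ).induction_on (p := fun l =>
      ‖ρ₀ a * ρ₀ b + l • ρ₀ d + star (ρ₀ f) - ρ₀ c‖ ≤
        ‖(a : A) * b + l • (d : A) + star (f : A) - c‖) l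
      (isClosed_le (by fun_prop) (by fun_prop)) fun i => ?_
    refine le_of_forall_pos_le_add fun ε hε => ?_
    have h1 := hm (.inl (i, a, b, d, f, c)) ε hε
    have h2 : ∀ᶠ n in atTop, ‖y a (m n) n * y b (m n) n +
        (TopologicalSpace.denseSeq ℂ i) • y d (m n) n + star (y f (m n) n) - y c (m n) n‖ ≤
        ‖(a : A) * b + (TopologicalSpace.denseSeq ℂ i) • (d : A) + star (f : A) - c‖ + ε := by
      filter_upwards [h1] with n hn
      exact (sub_lt_iff_lt_add'.1 hn).le
    simp only [ρ₀]
    rw [← map_mul, ← map_smul, ← map_star, ← map_add, ← map_add, ← map_sub]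
    exact norm_eta_le_of_eventually h2
  -- The polynomial estimate with the other slots zero is a Lipschitz bound, which is what allows
  -- extension from `Q` to `A`.
  have h0 : ∀ a ∈ Q, ∀ c ∈ Q, ‖ρ₀ a - ρ₀ c‖ ≤ ‖a - c‖ := by
    have hz : ∀ l : ℂ, ρ₀ 0 * ρ₀ 0 + l • ρ₀ 0 + star (ρ₀ 0) - ρ₀ 0 = 0 := fun l =>
      norm_le_zero_iff.1 (by simpa using hρ1 l ⟨0, hzQ⟩ ⟨0, hzQ⟩ ⟨0, hzQ⟩ ⟨0, hzQ⟩ ⟨0, hzQ⟩)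
    have hzρ : ρ₀ 0 = 0 := by
      have h1 := hz 0
      have h2 := hz 1
      rw [zero_smul, add_zero] at h1
      rw [one_smul, add_right_comm, add_sub_right_comm, h1, zero_add] at h2
      exact h2
    intro a ha c hc
    simpa [hzρ] using hρ1 1 ⟨0, hzQ⟩ ⟨0, hzQ⟩ ⟨a, ha⟩ ⟨0, hzQ⟩ ⟨c, hc⟩
  let r : Q → SeqAlg E := fun a => ρ₀ a
  have hr : LipschitzWith 1 r := LipschitzWith.of_dist_le_mul fun a c => by
    rw [NNReal.coe_one, one_mul, dist_eq_norm, Subtype.dist_eq, dist_eq_norm]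
    exact h0 a a.2 c c.2
  have hi : IsUniformInducing ((↑) : Q → A) := isUniformEmbedding_subtype_val.isUniformInducing
  have hd : DenseRange ((↑) : Q → A) := hQd.denseRange_val
  let ρ₁ : A → SeqAlg E := (hi.isDenseInducing hd).extend r
  have hρc : Continuous ρ₁ :=
    (uniformContinuous_uniformly_extend hi hd hr.uniformContinuous).continuous
  have hρe : ∀ a : Q, ρ₁ a = ρ₀ a := fun a =>
    uniformly_extend_of_ind hi hd hr.uniformContinuous a
  obtain ⟨ρ, hρ⟩ := exists_starHom_of_norm_le ρ₁ fun l a b d f c => by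
    have hd5 : DenseRange (Prod.map ((↑) : Q → A) (Prod.map ((↑) : Q → A)
      (Prod.map ((↑) : Q → A) (Prod.map ((↑) : Q → A) ((↑) : Q → A))))) :=
      hd.prodMap (hd.prodMap (hd.prodMap (hd.prodMap hd)))
    refine hd5.induction_on (p := fun p : A × A × A × A × A =>
      ‖ρ₁ p.1 * ρ₁ p.2.1 + l • ρ₁ p.2.2.1 + star (ρ₁ p.2.2.2.1) - ρ₁ p.2.2.2.2‖ ≤
      ‖p.1 * p.2.1 + l • p.2.2.1 + star p.2.2.2.1 - p.2.2.2.2‖) (a, b, d, f, c)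
      (isClosed_le (by fun_prop) (by fun_prop)) ?_
    rintro ⟨a, b, d, f, c⟩
    simp only [Prod.map_apply, hρe]
    exact hρ1 l a b d f c
  have hρS : ∀ s ∈ QS, ρ s = e s := by
    intro s hs
    rw [hρ, hρe ⟨s, Or.inl hs⟩, ← he', eta_eq_iff, Metric.tendsto_atTop]
    intro ε hε
    obtain ⟨N, hN⟩ := eventually_atTop.1 (hm (.inr ⟨s, hs⟩) ε hε)
    refine ⟨N, fun n hn => ?_⟩
    rw [dist_zero_right, norm_norm]
    exact hN n hn
  refine ⟨ρ, fun s hs => ?_⟩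
  refine eq_of_norm_sub_le_zero (le_of_forall_pos_le_add fun ε hε => ?_)
  obtain ⟨t, ht, hst⟩ := Metric.mem_closure_iff.1 (hQSd hs) (ε / 2) (half_pos hε)
  rw [dist_eq_norm] at hst
  have h1 : ‖ρ s - ρ t‖ ≤ ‖s - t‖ := by
    rw [← map_sub]; exact NonUnitalStarAlgHom.norm_apply_le ρ _
  -- On `S` the prescribed values are contractive because `σ` is and constants embed isometrically.
  have h2 : ‖e t - e s‖ ≤ ‖s - t‖ := by
    rw [← norm_eta_constSeq, map_sub, map_sub, ← hS s hs, ← hS t (hQS ht), ← map_sub, norm_sub_rev s]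
    exact NonUnitalStarAlgHom.norm_apply_le σ _
  calc ‖ρ s - e s‖ = ‖(ρ s - ρ t) + (e t - e s)‖ := by rw [hρS t ht]; simp
    _ ≤ ‖ρ s - ρ t‖ + ‖e t - e s‖ := norm_add_le _ _
    _ ≤ 0 + ε := by linarith

end Reindexing

/-! ### Sequential approximate units. -/

section ApproximateUnit

variable (A : Type u) [NonUnitalCStarAlgebra A] [TopologicalSpace.SeparableSpace A]

/-- A separable C*-algebra has a sequential approximate unit. -/
theorem exists_seq_approximateUnit : ∃ h : ℕ → A, (∀ n, ‖h n‖ ≤ 1) ∧ (∀ n, star (h n) = h n) ∧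
    ∀ a, Tendsto (fun n => h n * a) atTop (𝓝 a) ∧ Tendsto (fun n => a * h n) atTop (𝓝 a) := by
  let := CStarAlgebra.spectralOrder A
  have := CStarAlgebra.spectralOrderedRing A
  have hu := CStarAlgebra.increasingApproximateUnit A
  have h1 : ∀ n : ℕ, ∃ h : A, ‖h‖ ≤ 1 ∧ star h = h ∧ ∀ k ∈ Finset.range (n + 1),
      ‖h * TopologicalSpace.denseSeq A k - TopologicalSpace.denseSeq A k‖ < 1 / ((n : ℝ) + 1) ∧
      ‖TopologicalSpace.denseSeq A k * h - TopologicalSpace.denseSeq A k‖ < 1 / ((n : ℝ) + 1) := by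
    intro n
    have h2 : ∀ k ∈ Finset.range (n + 1), ∀ᶠ h in CStarAlgebra.approximateUnit A,
        ‖h * TopologicalSpace.denseSeq A k - TopologicalSpace.denseSeq A k‖ < 1 / ((n : ℝ) + 1) ∧
        ‖TopologicalSpace.denseSeq A k * h - TopologicalSpace.denseSeq A k‖ <
          1 / ((n : ℝ) + 1) := by
      intro k _
      refine Eventually.and ?_ ?_
      · exact (tendsto_iff_norm_sub_tendsto_zero.1
          (hu.tendsto_mul_right (TopologicalSpace.denseSeq A k))).eventually_lt_const
          (by positivity)
      · exact (tendsto_iff_norm_sub_tendsto_zero.1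
          (hu.tendsto_mul_left (TopologicalSpace.denseSeq A k))).eventually_lt_const
          (by positivity)
    obtain ⟨h, h3, h4, h5⟩ := (hu.eventually_norm.and (hu.eventually_star_eq.and
      ((Finset.eventually_all _).2 h2))).exists
    exact ⟨h, h3, h4, h5⟩
  choose h hn hs hk using h1
  have key : ∀ a, Tendsto (fun n => h n * a) atTop (𝓝 a) := by
    intro a
    rw [Metric.tendsto_atTop]
    intro ε hε
    obtain ⟨k, hkε⟩ := (TopologicalSpace.denseRange_denseSeq A).exists_dist_lt a
      (show (0 : ℝ) < ε / 3 by positivity)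
    obtain ⟨N, hN⟩ := exists_nat_one_div_lt (show (0 : ℝ) < ε / 3 by positivity)
    refine ⟨max N k, fun n hn' => ?_⟩
    set d := TopologicalSpace.denseSeq A k
    have h1 := ((hk n) k (Finset.mem_range.2
      (Nat.lt_succ_of_le ((le_max_right _ _).trans hn')))).1
    have h2 : 1 / ((n : ℝ) + 1) ≤ 1 / ((N : ℝ) + 1) := by
      have : (N : ℝ) ≤ n := by exact_mod_cast (le_max_left _ _).trans hn'
      gcongr
    have h3 : ‖h n * (a - d)‖ ≤ ‖a - d‖ :=
      (norm_mul_le _ _).trans (mul_le_of_le_one_left (norm_nonneg _) (hn n))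
    rw [dist_eq_norm] at hkε ⊢
    calc ‖h n * a - a‖ = ‖h n * (a - d) + (h n * d - d) - (a - d)‖ := by
          congr 1; rw [mul_sub]; abel
      _ ≤ ‖h n * (a - d)‖ + ‖h n * d - d‖ + ‖a - d‖ :=
        (norm_sub_le _ _).trans (add_le_add_left (norm_add_le _ _) _)
      _ < ε := by linarith
  refine ⟨h, hn, hs, fun a => ⟨key a, ?_⟩⟩
  have h1 := (key (star a)).star
  simpa only [star_mul, star_star, hs] using h1

end ApproximateUnit

/-! ### Averaging over the group. -/

namespace CStarAction

section Basic

variable {G : Type w} [Group G] [TopologicalSpace G] {A : Type u} [NonUnitalCStarAlgebra A]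
  (α : CStarAction G A)

theorem norm_act_le (g : G) (a : A) : ‖α.act g a‖ ≤ ‖a‖ :=
  NonUnitalStarAlgHom.norm_apply_le (α.act g) a

theorem continuous_act_apply (a : A) : Continuous fun g => α.act g a := α.continuous_orbit a

theorem continuous_act (g : G) : Continuous (α.act g) :=
  NonUnitalStarAlgHom.instContinuousLinearMapClassComplex.map_continuous (α.act g)

theorem norm_inclusion (a : α.fixedPoints) : ‖α.inclusion a‖ = ‖a‖ := rfl

end Basic

section Averaging

variable {G : Type w} [Group G] [TopologicalSpace G] [IsTopologicalGroup G]
    [CompactSpace G] [T2Space G] [SecondCountableTopology G]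
    {A : Type u} [NonUnitalCStarAlgebra A] (α : CStarAction G A)

/-- Normalized Haar measure, on the Borel `σ`-algebra. -/
noncomputable def normalizedHaar (G : Type w) [Group G] [TopologicalSpace G]
    [IsTopologicalGroup G] [CompactSpace G] :
    letI : MeasurableSpace G := borel G
    MeasureTheory.Measure G :=
  letI : MeasurableSpace G := borel G
  haveI : BorelSpace G := ⟨rfl⟩
  MeasureTheory.Measure.haarMeasure (⊤ : TopologicalSpace.PositiveCompacts G)

/-- The average of an element over the action. -/
noncomputable def avg (a : A) : A :=
  letI : MeasurableSpace G := borel G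
  ∫ g, α.act g a ∂(normalizedHaar G)

theorem isProbabilityMeasure_normalizedHaar :
    letI : MeasurableSpace G := borel G
    MeasureTheory.IsProbabilityMeasure (normalizedHaar G) := by
  let : MeasurableSpace G := borel G
  have : BorelSpace G := ⟨rfl⟩
  exact ⟨MeasureTheory.Measure.haarMeasure_self⟩

/-- The bounded linear map `α_h` passes through the integral, where left invariance of Haar measure
absorbs `h`. -/
theorem act_avg (h : G) (a : A) : α.act h (α.avg a) = α.avg a := by
  let : MeasurableSpace G := borel G
  have : BorelSpace G := ⟨rfl⟩
  have := isProbabilityMeasure_normalizedHaar (G := G)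
  have : (normalizedHaar G).IsMulLeftInvariant := by
    unfold normalizedHaar; infer_instance
  let T : A →L[ℂ] A := ⟨(α.act h : A →ₗ[ℂ] A), α.continuous_act h⟩
  have hint : MeasureTheory.Integrable (fun g => α.act g a) (normalizedHaar G) :=
    MeasureTheory.Integrable.of_bound (α.continuous_act_apply a).aestronglyMeasurable ‖a‖
      (.of_forall fun g => α.norm_act_le g a)
  calc α.act h (α.avg a) = T (∫ g, α.act g a ∂(normalizedHaar G)) := rfl
    _ = ∫ g, T (α.act g a) ∂(normalizedHaar G) := (T.integral_comp_comm hint).symm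
    _ = ∫ g, α.act (h * g) a ∂(normalizedHaar G) := by
        congr 1; ext g; exact (α.act_mul h g a).symm
    _ = ∫ g, α.act g a ∂(normalizedHaar G) :=
        MeasureTheory.integral_mul_left_eq_self (fun g => α.act g a) h

theorem norm_avg_le (a : A) : ‖α.avg a‖ ≤ ‖a‖ := by
  let : MeasurableSpace G := borel G
  have := isProbabilityMeasure_normalizedHaar (G := G)
  have h := MeasureTheory.norm_integral_le_of_norm_le_const (μ := normalizedHaar G)
    (.of_forall fun g => α.norm_act_le g a)
  simp only [MeasureTheory.probReal_univ, mul_one] at h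
  exact h

/-- If `T_n (α_g x_n)` converges to `b` for every `g`, then so do the averages. -/
theorem tendsto_avg {x : ℕ → A} {C : ℝ} (hx : ∀ n, ‖x n‖ ≤ C) (T : A →L[ℂ] A) (y : ℕ → A)
    {D : ℝ} (hy : ∀ n, ‖y n‖ ≤ D)
    (h : ∀ g, Tendsto (fun n => T (α.act g (x n)) - y n) atTop (𝓝 0)) :
    Tendsto (fun n => T (α.avg (x n)) - y n) atTop (𝓝 0) := by
  let : MeasurableSpace G := borel G
  have : BorelSpace G := ⟨rfl⟩
  have := isProbabilityMeasure_normalizedHaar (G := G)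
  have hint : ∀ a, MeasureTheory.Integrable (fun g => α.act g a) (normalizedHaar G) := fun a =>
    MeasureTheory.Integrable.of_bound (α.continuous_act_apply a).aestronglyMeasurable ‖a‖
      (.of_forall fun g => α.norm_act_le g a)
  have h1 : ∀ n, ∫ g, (T (α.act g (x n)) - y n) ∂(normalizedHaar G) =
      T (α.avg (x n)) - y n := by
    intro n
    rw [MeasureTheory.integral_sub (T.integrable_comp (hint _))
      (MeasureTheory.integrable_const _), T.integral_comp_comm (hint _)]
    simp [avg]
  -- The measure is finite and the integrands are uniformly bounded, so convergence at each group
  -- element suffices; no uniformity in `g` is needed.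
  have h2 := MeasureTheory.tendsto_integral_of_dominated_convergence (μ := normalizedHaar G)
    (F := fun n g => T (α.act g (x n)) - y n) (f := fun _ => 0) (fun _ => ‖T‖ * C + D)
    (fun n => ((T.continuous.comp (α.continuous_act_apply (x n))).sub
      continuous_const).aestronglyMeasurable)
    (MeasureTheory.integrable_const _)
    (fun n => .of_forall fun g => (norm_sub_le _ _).trans (add_le_add
      ((T.le_opNorm _).trans (mul_le_mul_of_nonneg_left ((α.norm_act_le g _).trans (hx n))
        (norm_nonneg _))) (hy n)))
    (.of_forall h)
  simpa only [h1, MeasureTheory.integral_zero] using h2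

/-- An approximate unit of fixed points. -/
theorem exists_fixed_approximateUnit [TopologicalSpace.SeparableSpace A] :
    ∃ u : ℕ → A, (∀ n, ‖u n‖ ≤ 1) ∧ (∀ n, u n ∈ α.fixedPoints) ∧
      ∀ a, Tendsto (fun n => u n * a) atTop (𝓝 a) ∧ Tendsto (fun n => a * u n) atTop (𝓝 a) := by
  obtain ⟨h, hn, -, hu⟩ := exists_seq_approximateUnit A
  refine ⟨fun n => α.avg (h n), fun n => (α.norm_avg_le _).trans (hn n),
    fun n g => α.act_avg g _, fun a => ⟨?_, ?_⟩⟩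
  · have := α.tendsto_avg hn ((ContinuousLinearMap.mul ℂ A).flip a) (fun _ => a) (fun _ => le_rfl)
      (fun g => by
        -- Each translate is again an approximate unit: `α_g(h_n) a = α_g(h_n α_g⁻¹(a))`.
        have h1 := (α.continuous_act g).tendsto _ |>.comp (hu (α.act g⁻¹ a)).1
        simp only [Function.comp_def, map_mul, α.act_act_inv] at h1
        simpa using h1.sub_const a)
    simpa using this.add_const a
  · have := α.tendsto_avg hn (ContinuousLinearMap.mul ℂ A a) (fun _ => a) (fun _ => le_rfl)
      (fun g => by
        have h1 := (α.continuous_act g).tendsto _ |>.comp (hu (α.act g⁻¹ a)).2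
        simp only [Function.comp_def, map_mul, α.act_act_inv] at h1
        simpa using h1.sub_const a)
    simpa using this.add_const a

/-- An invariant element of the sequence algebra comes from a sequence of fixed points. -/
theorem exists_map_inclusion_eq {y : SeqAlg A} (hy : ∀ g, α.seqAct g y = y) :
    ∃ z : SeqAlg α.fixedPoints, SeqAlg.map α.inclusion z = y := by
  obtain ⟨x, rfl⟩ := eta_surjective y
  refine ⟨eta _ (EllInf.mk (fun n => ⟨α.avg (x n), fun g => α.act_avg g _⟩) ‖x‖ fun n =>
    (α.norm_avg_le _).trans (norm_apply_le x n)), ?_⟩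
  rw [SeqAlg.map_eta, eta_eq_iff]
  -- Invariance in `A_∞` says `α_g(x_n) - x_n → 0` for each `g`; hence the averages have the same
  -- class as `x`.
  have := α.tendsto_avg (norm_apply_le x) (ContinuousLinearMap.id ℂ A) (fun n => x n)
    (norm_apply_le x) (fun g => by
      have h := eta_eq_iff.1 (hy g)
      rw [tendsto_zero_iff_norm_tendsto_zero]
      exact h)
  rw [tendsto_zero_iff_norm_tendsto_zero] at this
  exact this

/-- A `*`-homomorphism whose values lie in the range of an injective `*`-homomorphism factors. -/
theorem _root_.RokhlinFP.exists_factorization {R S T : Type*} [NonUnitalRing R] [StarRing R]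
    [Module ℂ R] [NonUnitalRing S] [StarRing S] [Module ℂ S] [NonUnitalRing T] [StarRing T]
    [Module ℂ T] (f : R →⋆ₙₐ[ℂ] T) (i : S →⋆ₙₐ[ℂ] T) (hi : Function.Injective i)
    (h : ∀ r, ∃ s, i s = f r) : ∃ f' : R →⋆ₙₐ[ℂ] S, ∀ r, i (f' r) = f r := by
  choose F hF using h
  exact ⟨{ toFun := F
           map_smul' := fun c r => hi (by simp [hF])
           map_zero' := hi (by simp [hF])
           map_add' := fun r s => hi (by simp [hF])
           map_mul' := fun r s => hi (by simp [hF])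
           map_star' := fun r => hi (by simp [hF, map_star]) }, hF⟩

end Averaging

end CStarAction

/-! ### Lifting the Rokhlin homomorphism to the sequence algebra. -/

/-- The embedding of `A` into its sequence algebra as constant sequences. -/
noncomputable def constHom (A : Type u) [NonUnitalCStarAlgebra A] : A →⋆ₙₐ[ℂ] SeqAlg A :=
  (eta A).comp (constSeq A)

section

variable {A : Type u} [NonUnitalCStarAlgebra A]

theorem constHom_apply (a : A) : constHom A a = eta A (constSeq A a) := rfl

theorem norm_constHom (a : A) : ‖constHom A a‖ = ‖a‖ := norm_eta_constSeq a

theorem kappa_star {D : NonUnitalStarSubalgebra ℂ A} (x : relCommutant D) :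
    kappa D (star x) = star (kappa D x) := rfl

theorem kappa_mul {D : NonUnitalStarSubalgebra ℂ A} (x y : relCommutant D) :
    kappa D (x * y) = kappa D x * kappa D y := rfl

/-- Only annihilators of `D` are divided out, so an identity in `F(D, A)` holds in `A_∞` after
multiplication by elements of `D`. -/
theorem mul_constHom_eq_of_kappa_eq {D : NonUnitalStarSubalgebra ℂ A} {x y : relCommutant D}
    (h : kappa D x = kappa D y) {d : A} (hd : d ∈ D) :
    (x : SeqAlg A) * constHom A d = y * constHom A d := by
  have h1 := (StarIdeal.Quotient.mk_eq_iff.1 h) d hd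
  rw [← sub_eq_zero, ← sub_mul]
  exact h1.1

end

namespace CStarAction

variable {G : Type w} [Group G] [TopologicalSpace G] [IsTopologicalGroup G]
    [CompactSpace G] [T2Space G] [SecondCountableTopology G]
    {A : Type u} [NonUnitalCStarAlgebra A] (α : CStarAction G A)

theorem seqAct_constHom (g : G) (a : A) : α.seqAct g (constHom A a) = constHom A (α.act g a) := rfl

/-- A lift to `A_∞` of a unital equivariant `*`-homomorphism from `C(G)` to the central sequence
algebra: it is one up to elements annihilating the constant sequences. -/
structure RokhlinLift where
  toFun : C(G, ℂ) → SeqAlg A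
  comm : ∀ f a, constHom A a * toFun f = toFun f * constHom A a
  toFun_add : ∀ f g a, toFun (f + g) * constHom A a = toFun f * constHom A a + toFun g * constHom A a
  toFun_smul : ∀ (l : ℂ) f a, toFun (l • f) * constHom A a = l • (toFun f * constHom A a)
  toFun_mul : ∀ f g a, toFun (f * g) * constHom A a = toFun f * (toFun g * constHom A a)
  toFun_star : ∀ f a, toFun (star f) * constHom A a = star (toFun f) * constHom A a
  toFun_one : ∀ a, toFun 1 * constHom A a = constHom A a
  toFun_leftTranslate : ∀ g f a, toFun (leftTranslate g f) * constHom A a =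
    α.seqAct g (toFun f) * constHom A a

variable {α}

/-- Choose arbitrary lifts for `D = A`. The delicate point is the unit, since `φ 1` is only known to
act as one on `F_α(A, A)`: an approximate unit of fixed points gives a class in that algebra which
multiplies constants trivially, and comparing `φ 1` with it shows that the lift of `1` fixes
constants. -/
theorem HasRokhlinProperty.nonempty_rokhlinLift [TopologicalSpace.SeparableSpace A]
    (hα : α.HasRokhlinProperty) : Nonempty α.RokhlinLift := by
  obtain ⟨φ, h1, hG⟩ := hα ⊤ (by simp)
    (TopologicalSpace.IsSeparable.of_separableSpace _) (fun _ _ _ => trivial)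
  choose x hx using fun f => (StarIdeal.Quotient.mk_surjective (annihilator ⊤)
    (φ f : CentralSeqAlg (⊤ : NonUnitalStarSubalgebra ℂ A)))
  replace hx : ∀ f, kappa ⊤ (x f) = φ f := hx
  have key : ∀ {p q : relCommutant (⊤ : NonUnitalStarSubalgebra ℂ A)}, kappa ⊤ p = kappa ⊤ q →
      ∀ a, (p : SeqAlg A) * constHom A a = q * constHom A a :=
    fun h a => mul_constHom_eq_of_kappa_eq h trivial
  obtain ⟨u, hu1, hu2, hu3⟩ := α.exists_fixed_approximateUnit
  set U : EllInf A := EllInf.mk u 1 hu1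
  have hUl : ∀ a, eta A U * constHom A a = constHom A a := fun a => by
    rw [constHom_apply, ← map_mul, eta_eq_iff]
    exact tendsto_iff_norm_sub_tendsto_zero.1 (hu3 a).1
  have hUr : ∀ a, constHom A a * eta A U = constHom A a := fun a => by
    rw [constHom_apply, ← map_mul, eta_eq_iff]
    exact tendsto_iff_norm_sub_tendsto_zero.1 (hu3 a).2
  let U' : relCommutant (⊤ : NonUnitalStarSubalgebra ℂ A) :=
    ⟨eta A U, fun a _ => (hUr a).trans (hUl a).symm⟩
  -- All terms of `U` are fixed points, so `G` acts trivially, hence norm-continuously, on it.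
  have hU' : kappa ⊤ U' ∈ α.centralCont (⊤ : NonUnitalStarSubalgebra ℂ A) := by
    refine ⟨U', ?_, rfl⟩
    refine ⟨U, ?_, rfl⟩
    change Continuous fun g => EllInf.map (α.act g) U
    have : ∀ g, EllInf.map (α.act g) U = U := fun g => by
      ext n; exact hu2 n g
    simp only [this]
    exact continuous_const
  refine ⟨⟨fun f => x f, fun f a => (x f).2 a trivial, fun f g a => ?_, fun l f a => ?_,
    fun f g a => ?_, fun f a => ?_, fun a => ?_, fun g f a => ?_⟩⟩
  · have h2 : kappa ⊤ (x (f + g)) = kappa ⊤ (x f + x g) := by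
      rw [map_add (kappa ⊤), hx, hx, hx]; exact congrArg Subtype.val (map_add φ f g)
    exact (key h2 a).trans (add_mul _ _ _)
  · have h2 : kappa ⊤ (x (l • f)) = kappa ⊤ (l • x f) := by
      rw [map_smul (kappa ⊤), hx, hx]; exact congrArg Subtype.val (map_smul φ l f)
    exact (key h2 a).trans (smul_mul_assoc _ _ _)
  · have h2 : kappa ⊤ (x (f * g)) = kappa ⊤ (x f * x g) := by
      have h3 := congrArg₂ (· * ·) (hx f) (hx g)
      exact (hx (f * g)).trans ((congrArg Subtype.val (map_mul φ f g)).trans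
        (h3.symm.trans (kappa_mul (x f) (x g)).symm))
    exact (key h2 a).trans (mul_assoc _ _ _)
  · have h2 : kappa ⊤ (x (star f)) = kappa ⊤ (star (x f)) := by
      have h3 := congrArg star (hx f)
      exact (hx (star f)).trans ((congrArg Subtype.val (map_star φ f)).trans
        (h3.symm.trans (kappa_star (x f)).symm))
    exact key h2 a
  · have h2 : kappa ⊤ (x 1 * U') = kappa ⊤ U' := by
      exact (kappa_mul (x 1) U').trans ((congrArg (· * kappa ⊤ U') (hx 1)).trans
        (congrArg Subtype.val (h1 ⟨_, hU'⟩).1))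
    have h3 := key h2 a
    rw [NonUnitalStarSubalgebra.coe_mul, mul_assoc] at h3
    rwa [show (U' : SeqAlg A) = eta A U from rfl, hUl] at h3
  · have h2 : kappa ⊤ (x (leftTranslate g f)) =
        kappa ⊤ (α.relCommutantAct (D := ⊤) (fun _ _ _ => trivial) g (x f)) := by
      rw [hx, hG, ← hx]
      rfl
    exact key h2 a

namespace RokhlinLift

variable (F : α.RokhlinLift)

/-- The bilinear map `(f, a) ↦ F(f) a`. -/
noncomputable def bilin : C(G, ℂ) →ₗ[ℂ] A →ₗ[ℂ] SeqAlg A :=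
  LinearMap.mk₂ ℂ (fun f a => F.toFun f * constHom A a)
    (fun f g a => F.toFun_add f g a) (fun l f a => F.toFun_smul l f a)
    (fun f a b => by rw [map_add, mul_add])
    (fun l f a => by rw [map_smul, mul_smul_comm])

theorem bilin_apply (f : C(G, ℂ)) (a : A) : F.bilin f a = F.toFun f * constHom A a := rfl

theorem bilin_mul (f g : C(G, ℂ)) (a b : A) :
    F.bilin f a * F.bilin g b = F.bilin (f * g) (a * b) := by
  simp only [bilin_apply]
  rw [map_mul, ← mul_assoc (F.toFun (f * g)), F.toFun_mul, mul_assoc, mul_assoc, mul_assoc,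
    ← mul_assoc (constHom A a), F.comm, mul_assoc]

theorem bilin_star (f : C(G, ℂ)) (a : A) :
    star (F.bilin f a) = F.bilin (star f) (star a) := by
  simp only [bilin_apply]
  rw [F.toFun_star, star_mul, ← map_star, ← star_star (constHom A (star a)), ← star_mul,
    ← map_star, star_star, ← F.comm, star_mul, ← map_star]

theorem bilin_one (a : A) : F.bilin 1 a = constHom A a := F.toFun_one a

theorem seqAct_bilin (g : G) (f : C(G, ℂ)) (a : A) :
    α.seqAct g (F.bilin f a) = F.bilin (leftTranslate g f) (α.act g a) := by
  simp only [bilin_apply]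
  rw [map_mul, F.toFun_leftTranslate, seqAct_constHom]

/-- With `g = √(1 - |f|²)` one has `f* f + g* g = 1`, so the squares of `F(f) a` and `F(g) a` add up
to `a* a`, and each is dominated by it. -/
theorem norm_bilin_le_of_norm_le_one (f : C(G, ℂ)) (hf : ‖f‖ ≤ 1) (a : A) :
    ‖F.bilin f a‖ ≤ ‖a‖ := by
  let := CStarAlgebra.spectralOrder (SeqAlg A)
  have := CStarAlgebra.spectralOrderedRing (SeqAlg A)
  let g : C(G, ℂ) := ⟨fun x => (√(1 - ‖f x‖ ^ 2) : ℝ), by fun_prop⟩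
  have hfg : star f * f + star g * g = 1 := by
    ext x
    have h1 : ‖f x‖ ^ 2 ≤ 1 := by
      have := (f.norm_coe_le_norm x).trans hf
      exact pow_le_one₀ (norm_nonneg _) this
    simp only [ContinuousMap.add_apply, ContinuousMap.mul_apply, ContinuousMap.star_apply,
      ContinuousMap.one_apply, RCLike.star_def, ContinuousMap.coe_mk, g, Complex.conj_ofReal]
    rw [← Complex.ofReal_mul, Real.mul_self_sqrt (by linarith), mul_comm, Complex.mul_conj,
      Complex.normSq_eq_norm_sq, ← Complex.ofReal_add]
    simp
  have h1 : star (F.bilin f a) * F.bilin f a + star (F.bilin g a) * F.bilin g a =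
      star (constHom A a) * constHom A a := by
    rw [bilin_star, bilin_star, bilin_mul, bilin_mul, ← LinearMap.add_apply, ← map_add, hfg,
      bilin_one, map_mul, map_star]
  have h2 : star (F.bilin f a) * F.bilin f a ≤ star (constHom A a) * constHom A a := by
    rw [← h1]; exact le_add_of_nonneg_right (star_mul_self_nonneg _)
  have h3 := CStarAlgebra.norm_le_norm_of_nonneg_of_le (star_mul_self_nonneg _) h2
  rw [CStarRing.norm_star_mul_self, CStarRing.norm_star_mul_self, norm_constHom] at h3
  exact (mul_self_le_mul_self_iff (norm_nonneg _) (norm_nonneg _)).2 h3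

theorem norm_bilin_le (f : C(G, ℂ)) (a : A) : ‖F.bilin f a‖ ≤ ‖f‖ * ‖a‖ := by
  by_cases hf : f = 0
  · simp [hf]
  have h0 : (‖f‖ : ℂ) ≠ 0 := by simpa using hf
  have h := F.norm_bilin_le_of_norm_le_one ((‖f‖ : ℂ)⁻¹ • f) (by
    rw [norm_smul, norm_inv, Complex.norm_real, norm_norm, inv_mul_cancel₀ (by simpa using hf)]) a
  rw [map_smul, LinearMap.smul_apply, norm_smul, norm_inv, Complex.norm_real, norm_norm] at h
  rwa [inv_mul_le_iff₀ (by simpa using hf)] at h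

end RokhlinLift

end CStarAction

open scoped TensorProduct

/-! ### Contractivity of `C(G) ⊗ A → A_∞` for the supremum norm. -/

section CauchySchwarz

theorem norm_sum_mul_sq_le {ι : Type*} [Fintype ι] {B : Type*} [NonUnitalCStarAlgebra B]
    (x y : ι → B) :
    ‖∑ j, x j * y j‖ ^ 2 ≤ ‖∑ j, x j * star (x j)‖ * ‖∑ j, star (y j) * y j‖ := by
  let := CStarAlgebra.spectralOrder B
  have := CStarAlgebra.spectralOrderedRing B
  have h := CStarModule.norm_inner_le (A := B) (WithCStarModule B (ι → B))
    (x := (WithCStarModule.equiv B (ι → B)).symm fun j => star (y j))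
    (y := (WithCStarModule.equiv B (ι → B)).symm x)
  have h1 := pow_le_pow_left₀ (norm_nonneg _) h 2
  rw [mul_pow, WithCStarModule.pi_norm_sq, WithCStarModule.pi_norm_sq, mul_comm] at h1
  simpa [WithCStarModule.pi_inner, WithCStarModule.inner_def] using h1

/-- A multiplicative constant disappears on taking roots of order `2 ^ k`. -/
theorem le_of_forall_pow_two_pow_le {x C K : ℝ} (hK : 0 ≤ K)
    (h : ∀ k : ℕ, x ^ (2 ^ k) ≤ C * K ^ (2 ^ k)) : x ≤ K := by
  by_contra! hx
  have hx0 : 0 < x := hK.trans_lt hx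
  have h1 : Tendsto (fun k : ℕ => C * (K / x) ^ (2 ^ k)) atTop (𝓝 (C * 0)) :=
    ((tendsto_pow_atTop_nhds_zero_of_lt_one (by positivity) ((div_lt_one hx0).2 hx)).comp
      (tendsto_pow_atTop_atTop_of_one_lt one_lt_two)).const_mul C
  have h2 : (1 : ℝ) ≤ C * 0 := ge_of_tendsto' h1 fun k => by
    rw [div_pow, ← mul_div_assoc, one_le_div (by positivity)]
    exact h k
  norm_num at h2

end CauchySchwarz

section PartitionOfUnity

variable {G : Type w} [TopologicalSpace G] [CompactSpace G] [T2Space G]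

/-- A finite partition of unity on which a given continuous map is almost constant. -/
theorem exists_partition {V : Type*} [PseudoMetricSpace V] {F : G → V} (hF : Continuous F)
    {ε : ℝ} (hε : 0 < ε) : ∃ (t : Finset G) (r : t → C(G, ℝ)), (∀ j x, 0 ≤ r j x) ∧
      (∀ x, ∑ j, r j x = 1) ∧ ∀ j x, r j x ≠ 0 → dist (F x) (F j) < ε := by
  have hU : ∀ g : G, IsOpen {x | dist (F x) (F g) < ε} := fun g =>
    isOpen_lt (by fun_prop) continuous_const
  obtain ⟨t, ht⟩ := isCompact_univ.elim_finite_subcover (fun g : G => {x | dist (F x) (F g) < ε})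
    hU (fun x _ => Set.mem_iUnion.2 ⟨x, by simpa using hε⟩)
  obtain ⟨f, hf⟩ := PartitionOfUnity.exists_isSubordinate (isClosed_univ (X := G))
    (fun j : t => {x | dist (F x) (F j) < ε}) (fun j => hU j) (by
      intro x hx
      obtain ⟨g, hg⟩ := Set.mem_iUnion.1 (ht hx)
      obtain ⟨hgt, hg⟩ := Set.mem_iUnion.1 hg
      exact Set.mem_iUnion.2 ⟨⟨g, hgt⟩, hg⟩)
  refine ⟨t, fun j => f j, fun j x => f.nonneg j x, fun x => ?_, fun j x hx => ?_⟩
  · rw [← f.sum_eq_one (Set.mem_univ x), finsum_eq_sum_of_fintype]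
  · exact hf j (subset_closure hx)

/-- A real continuous function as a complex one. -/
def complexify (r : C(G, ℝ)) : C(G, ℂ) := ⟨fun x => (r x : ℂ), by fun_prop⟩

theorem complexify_apply (r : C(G, ℝ)) (x : G) : complexify r x = (r x : ℂ) := rfl

/-- A partition of unity averages values almost equal to `v` to a value almost equal to `v`. -/
theorem norm_sub_sum_le {ι : Type*} [Fintype ι] {V : Type*} [NormedAddCommGroup V]
    [NormedSpace ℂ V] {r : ι → ℝ} (h0 : ∀ j, 0 ≤ r j) (h1 : ∑ j, r j = 1) {v : V} {b : ι → V}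
    {ε : ℝ} (h : ∀ j, r j ≠ 0 → ‖v - b j‖ ≤ ε) : ‖v - ∑ j, (r j : ℂ) • b j‖ ≤ ε := by
  have h2 : v = ∑ j, (r j : ℂ) • v := by
    rw [← Finset.sum_smul, ← Complex.ofReal_sum, h1, Complex.ofReal_one, one_smul]
  nth_rw 1 [h2]
  rw [← Finset.sum_sub_distrib]
  calc ‖∑ j, ((r j : ℂ) • v - (r j : ℂ) • b j)‖ ≤ ∑ j, r j * ε := by
        refine norm_sum_le_of_le _ fun j _ => ?_
        rw [← smul_sub, norm_smul, Complex.norm_real, Real.norm_of_nonneg (h0 j)]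
        by_cases hj : r j = 0
        · simp [hj]
        · exact mul_le_mul_of_nonneg_left (h j hj) (h0 j)
    _ = ε := by rw [← Finset.sum_mul, h1, one_mul]

end PartitionOfUnity

namespace CStarAction.RokhlinLift

variable {G : Type w} [Group G] [TopologicalSpace G] [IsTopologicalGroup G]
    [CompactSpace G] [T2Space G] [SecondCountableTopology G]
    {A : Type u} [NonUnitalCStarAlgebra A] [TopologicalSpace.SeparableSpace A]
    {α : CStarAction G A} (F : α.RokhlinLift)

/-- Split `r_j = √r_j √r_j` and use Cauchy–Schwarz. An approximate unit `c_n` is inserted beside the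
first root, because only products `F(f) a` are controlled; the first factor becomes `c_n c_n*`, of
norm at most one. -/
theorem norm_sum_bilin_sq_le {ι : Type*} [Fintype ι] {r : ι → C(G, ℝ)} (h0 : ∀ j x, 0 ≤ r j x)
    (h1 : ∀ x, ∑ j, r j x = 1) (b : ι → A) :
    ‖∑ j, F.bilin (complexify (r j)) (b j)‖ ^ 2 ≤
      ‖∑ j, F.bilin (complexify (r j)) (star (b j) * b j)‖ := by
  let s : ι → C(G, ℂ) := fun j => ⟨fun x => (√(r j x) : ℝ), by fun_prop⟩
  have hs : ∀ j, s j * s j = complexify (r j) := fun j => by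
    ext x
    simp only [s, ContinuousMap.mul_apply, ContinuousMap.coe_mk, complexify_apply]
    rw [← Complex.ofReal_mul, Real.mul_self_sqrt (h0 j x)]
  have hs' : ∀ j, star (s j) = s j := fun j => by
    ext x
    simp [s]
  have hsum : ∑ j, complexify (r j) = 1 := by
    ext x
    simp only [ContinuousMap.coe_sum, Finset.sum_apply, complexify_apply, ContinuousMap.one_apply]
    rw [← Complex.ofReal_sum, h1, Complex.ofReal_one]
  obtain ⟨c, hc, hc', hc1⟩ := exists_seq_approximateUnit A
  have h2 : ∀ n, ‖∑ j, F.bilin (complexify (r j)) (c n * b j)‖ ^ 2 ≤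
      ‖∑ j, F.bilin (complexify (r j)) (star (b j) * b j)‖ := by
    intro n
    have h3 := norm_sum_mul_sq_le (fun j => F.bilin (s j) (c n)) (fun j => F.bilin (s j) (b j))
    simp only [bilin_star, bilin_mul, hs, hs'] at h3
    refine h3.trans (mul_le_of_le_one_left (norm_nonneg _) ?_)
    rw [← LinearMap.sum_apply, ← map_sum, hsum, bilin_one, norm_constHom, CStarRing.norm_self_mul_star]
    exact mul_le_one₀ (hc n) (norm_nonneg _) (hc n)
  have h3 : Tendsto (fun n => ‖∑ j, F.bilin (complexify (r j)) (c n * b j)‖ ^ 2) atTop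
      (𝓝 (‖∑ j, F.bilin (complexify (r j)) (b j)‖ ^ 2)) := by
    refine ((tendsto_finsetSum _ fun j _ => ?_).norm).pow 2
    have : Continuous (F.bilin (complexify (r j))) :=
      AddMonoidHomClass.continuous_of_bound _ _ (F.norm_bilin_le (complexify (r j)))
    exact (this.tendsto _).comp (hc1 (b j)).1
  exact le_of_tendsto' h3 h2

/-- Iterate the previous inequality: each step replaces `b_j` by `b_j* b_j` and `K` by `K²`. The
triangle inequality used at the end costs only the constant `∑ ‖r_j‖`, which the power trick
removes. -/
theorem norm_sum_bilin_le {ι : Type*} [Fintype ι] {r : ι → C(G, ℝ)} (h0 : ∀ j x, 0 ≤ r j x)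
    (h1 : ∀ x, ∑ j, r j x = 1) {b : ι → A} {K : ℝ} (hK : 0 ≤ K) (hb : ∀ j, ‖b j‖ ≤ K) :
    ‖∑ j, F.bilin (complexify (r j)) (b j)‖ ≤ K := by
  refine le_of_forall_pow_two_pow_le (C := ∑ j, ‖complexify (r j)‖) hK fun k => ?_
  induction k generalizing b K with
  | zero =>
    rw [pow_zero, pow_one, pow_one, Finset.sum_mul]
    exact norm_sum_le_of_le _ fun j _ => (F.norm_bilin_le _ _).trans
      (mul_le_mul_of_nonneg_left (hb j) (norm_nonneg _))
  | succ k ih =>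
    rw [pow_succ', pow_mul, pow_mul]
    refine (pow_le_pow_left₀ (by positivity) (F.norm_sum_bilin_sq_le h0 h1 b) _).trans
      (ih (by positivity) fun j => ?_)
    rw [CStarRing.norm_star_mul_self, ← sq]
    exact pow_le_pow_left₀ (norm_nonneg _) (hb j) 2

/-- The map `C(G) ⊗ A → C(G, A)`. -/
noncomputable def tensorToMap (G : Type w) [TopologicalSpace G] [CompactSpace G] (A : Type u)
    [NonUnitalCStarAlgebra A] : C(G, ℂ) ⊗[ℂ] A →ₗ[ℂ] C(G, A) :=
  TensorProduct.lift (LinearMap.mk₂ ℂ (fun f a => ⟨fun x => f x • a, by fun_prop⟩)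
    (fun f g a => by ext x; exact add_smul _ _ _) (fun l f a => by ext x; exact smul_assoc l (f x) a)
    (fun f a b => by ext x; exact smul_add _ _ _)
    (fun l f a => by ext x; exact smul_comm (f x) l a))

theorem tensorToMap_tmul_apply (f : C(G, ℂ)) (a : A) (x : G) :
    tensorToMap G A (f ⊗ₜ a) x = f x • a := rfl

theorem denseRange_tensorToMap : DenseRange (tensorToMap G A) := by
  intro P
  rw [Metric.mem_closure_iff]
  intro ε hε
  obtain ⟨t, r, h0, h1, h2⟩ := exists_partition P.continuous (half_pos hε)
  refine ⟨_, ⟨∑ j, complexify (r j) ⊗ₜ P j, rfl⟩, ?_⟩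
  rw [dist_eq_norm]
  refine lt_of_le_of_lt ((ContinuousMap.norm_le _ (half_pos hε).le).2 fun x => ?_) (half_lt_self hε)
  simp only [map_sum, ContinuousMap.sub_apply, ContinuousMap.coe_sum, Finset.sum_apply,
    tensorToMap_tmul_apply, complexify_apply]
  exact norm_sub_sum_le (fun j => h0 j x) (h1 x) fun j hj => by
    rw [← dist_eq_norm]; exact (h2 j x hj).le

/-- Up to a small error the tensor may be replaced by `∑ r_j ⊗ P(j)` for a partition of unity `r`
and the function `P` it represents; the values `P(j)` are bounded by `‖P‖`, so the bound for
partitions of unity applies. -/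
theorem norm_lift_bilin_le (t : C(G, ℂ) ⊗[ℂ] A) :
    ‖TensorProduct.lift F.bilin t‖ ≤ ‖tensorToMap G A t‖ := by
  obtain ⟨S, rfl⟩ := TensorProduct.exists_finset t
  set P := tensorToMap G A (∑ i ∈ S, i.1 ⊗ₜ[ℂ] i.2) with hP
  have hPx : ∀ x, P x = ∑ i ∈ S, i.1 x • i.2 := fun x => by
    simp only [hP, map_sum, ContinuousMap.coe_sum, Finset.sum_apply, tensorToMap_tmul_apply]
  have key : ∀ ε > 0, ‖TensorProduct.lift F.bilin (∑ i ∈ S, i.1 ⊗ₜ[ℂ] i.2)‖ ≤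
      ‖P‖ + ε * ∑ i ∈ S, ‖i.2‖ := by
    intro ε hε
    -- The partition is adapted to all coefficient functions of the tensor simultaneously.
    obtain ⟨t, r, h0, h1, h2⟩ := exists_partition (F := fun x => fun i : S => i.1.1 x)
      (by fun_prop) hε
    have h3 := F.norm_sum_bilin_le h0 h1 (b := fun j => P j) (norm_nonneg P)
      (fun j => P.norm_coe_le_norm j)
    have h4 : TensorProduct.lift F.bilin (∑ i ∈ S, i.1 ⊗ₜ[ℂ] i.2) -
        ∑ j, F.bilin (complexify (r j)) (P j) =
        ∑ i ∈ S, F.bilin (i.1 - ∑ j : t, i.1 (j : G) • complexify (r j)) i.2 := by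
      simp only [map_sum, TensorProduct.lift.tmul, hPx, map_sub, LinearMap.sub_apply,
        Finset.sum_sub_distrib, LinearMap.sum_apply, map_smul, LinearMap.smul_apply]
      rw [Finset.sum_comm]
    have h5 : ‖TensorProduct.lift F.bilin (∑ i ∈ S, i.1 ⊗ₜ[ℂ] i.2) -
        ∑ j, F.bilin (complexify (r j)) (P j)‖ ≤ ε * ∑ i ∈ S, ‖i.2‖ := by
      rw [h4, Finset.mul_sum]
      refine norm_sum_le_of_le _ fun i hi => (F.norm_bilin_le _ _).trans ?_
      refine mul_le_mul_of_nonneg_right ?_ (norm_nonneg _)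
      refine (ContinuousMap.norm_le _ hε.le).2 fun x => ?_
      have h6 := norm_sub_sum_le (fun j => h0 j x) (h1 x) (v := i.1 x) (b := fun j => i.1 j)
        (ε := ε) fun j hj => by
          rw [← dist_eq_norm]
          exact (dist_le_pi_dist (fun i : S => i.1.1 x) (fun i : S => i.1.1 j) ⟨i, hi⟩).trans
            (h2 j x hj).le
      simpa [complexify_apply, mul_comm] using h6
    calc _ = ‖(TensorProduct.lift F.bilin (∑ i ∈ S, i.1 ⊗ₜ[ℂ] i.2) -
        ∑ j, F.bilin (complexify (r j)) (P j)) + ∑ j, F.bilin (complexify (r j)) (P j)‖ := by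
          rw [sub_add_cancel]
      _ ≤ _ := (norm_add_le _ _).trans (by linarith)
  have hc : Tendsto (fun ε : ℝ => ‖P‖ + ε * ∑ i ∈ S, ‖i.2‖) (𝓝[>] 0) (𝓝 ‖P‖) := by
    have : Continuous fun ε : ℝ => ‖P‖ + ε * ∑ i ∈ S, ‖i.2‖ := by fun_prop
    simpa using (this.tendsto 0).mono_left nhdsWithin_le_nhds
  exact ge_of_tendsto hc (eventually_nhdsWithin_of_forall key)

end CStarAction.RokhlinLift
-- The homomorphism on `C(G, A)` and the sequential splitting.
namespace CStarAction

variable {G : Type w} [Group G] [TopologicalSpace G] [IsTopologicalGroup G]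
    [CompactSpace G] [T2Space G] [SecondCountableTopology G]
    {A : Type u} [NonUnitalCStarAlgebra A] [TopologicalSpace.SeparableSpace A]
    {α : CStarAction G A}

namespace RokhlinLift

variable (F : α.RokhlinLift)

/-- The `*`-homomorphism `C(G, A) → A_∞`, as a continuous linear map. -/
noncomputable def extend : C(G, A) →L[ℂ] SeqAlg A :=
  (TensorProduct.lift F.bilin).extendOfNorm (tensorToMap G A)

theorem extend_tensorToMap (t : C(G, ℂ) ⊗[ℂ] A) :
    F.extend (tensorToMap G A t) = TensorProduct.lift F.bilin t :=
  LinearMap.extendOfNorm_eq (f := TensorProduct.lift F.bilin) (e := tensorToMap G A)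
    denseRange_tensorToMap ⟨1, fun x => by rw [one_mul]; exact F.norm_lift_bilin_le x⟩ t

theorem extend_mul (P Q : C(G, A)) : F.extend (P * Q) = F.extend P * F.extend Q := by
  refine denseRange_tensorToMap.induction_on₂
    (p := fun P Q => F.extend (P * Q) = F.extend P * F.extend Q)
    (isClosed_eq (by fun_prop) (by fun_prop)) (fun s t => ?_) P Q
  induction s using TensorProduct.induction_on with
  | zero => simp
  | add s s' h h' => rw [map_add, add_mul, map_add, map_add, add_mul, h, h']
  | tmul f a =>
    induction t using TensorProduct.induction_on with
    | zero => simp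
    | add s s' h h' => rw [map_add, mul_add, map_add, map_add, mul_add, h, h']
    | tmul g b =>
      have h : tensorToMap G A (f ⊗ₜ a) * tensorToMap G A (g ⊗ₜ b) =
          tensorToMap G A ((f * g) ⊗ₜ (a * b)) := by
        ext x
        simp only [ContinuousMap.mul_apply, tensorToMap_tmul_apply]
        rw [smul_mul_smul_comm]
      rw [h, extend_tensorToMap, extend_tensorToMap, extend_tensorToMap, TensorProduct.lift.tmul,
        TensorProduct.lift.tmul, TensorProduct.lift.tmul, bilin_mul]

theorem extend_star (P : C(G, A)) : F.extend (star P) = star (F.extend P) := by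
  refine denseRange_tensorToMap.induction_on
    (p := fun P => F.extend (star P) = star (F.extend P)) P
    (isClosed_eq (by fun_prop) (by fun_prop)) (fun t => ?_)
  induction t using TensorProduct.induction_on with
  | zero => simp
  | add s s' h h' => rw [map_add, star_add, map_add, map_add, star_add, h, h']
  | tmul f a =>
    have h : star (tensorToMap G A (f ⊗ₜ a)) = tensorToMap G A (star f ⊗ₜ star a) := by
      ext x
      simp only [ContinuousMap.star_apply, tensorToMap_tmul_apply, star_smul]
    rw [h, extend_tensorToMap, extend_tensorToMap, TensorProduct.lift.tmul,
      TensorProduct.lift.tmul, bilin_star]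

/-- By density and linearity it suffices to treat elementary tensors, where this is `seqAct_bilin`.
The action on `C(G, A)` is the diagonal one, `(g · P)(x) = α_g(P(g⁻¹ x))`. -/
theorem seqAct_extend (g : G) (P : C(G, A)) :
    α.seqAct g (F.extend P) = F.extend ((⟨α.act g, α.continuous_act g⟩ : C(A, A)).comp
      (P.comp ⟨fun x => g⁻¹ * x, by fun_prop⟩)) := by
  have hc : Continuous (α.seqAct g) :=
    NonUnitalStarAlgHom.instContinuousLinearMapClassComplex.map_continuous (α.seqAct g)
  refine denseRange_tensorToMap.induction_on
    (p := fun P => α.seqAct g (F.extend P) = F.extend ((⟨α.act g, α.continuous_act g⟩ :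
      C(A, A)).comp (P.comp ⟨fun x => g⁻¹ * x, by fun_prop⟩))) P
    (isClosed_eq (by fun_prop) (F.extend.continuous.comp ((ContinuousMap.continuous_postcomp _).comp
      (ContinuousMap.continuous_precomp _)))) (fun t => ?_)
  let T : C(G, A) → C(G, A) := fun P => (⟨α.act g, α.continuous_act g⟩ :
      C(A, A)).comp (P.comp ⟨fun x => g⁻¹ * x, by fun_prop⟩)
  change α.seqAct g (F.extend (tensorToMap G A t)) = F.extend (T (tensorToMap G A t))
  induction t using TensorProduct.induction_on with
  | zero =>
    have h : T 0 = 0 := by ext x; exact map_zero (α.act g)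
    rw [map_zero, h, map_zero, map_zero]
  | add s s' h h' =>
    have h2 : ∀ P Q, T (P + Q) = T P + T Q := fun P Q => by ext x; exact map_add (α.act g) _ _
    rw [map_add, h2, map_add, map_add, map_add, h, h']
  | tmul f a =>
    have h : T (tensorToMap G A (f ⊗ₜ a)) = tensorToMap G A (leftTranslate g f ⊗ₜ α.act g a) := by
      ext x
      exact map_smul (α.act g) _ _
    rw [h, extend_tensorToMap, extend_tensorToMap, TensorProduct.lift.tmul,
      TensorProduct.lift.tmul, seqAct_bilin]

/-- The orbit map of an element of `A`. -/
def _root_.RokhlinFP.CStarAction.orbitMap (α : CStarAction G A) (a : A) : C(G, A) :=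
  ⟨fun g => α.act g a, α.continuous_act_apply a⟩

/-- The `*`-homomorphism from `A` to the invariant part of `A_∞` that evaluates orbit maps. -/
noncomputable def orbitHom : A →⋆ₙₐ[ℂ] SeqAlg A where
  toFun a := F.extend (α.orbitMap a)
  map_smul' l a := by
    rw [MonoidHom.id_apply, ← map_smul]; congr 1; ext g; exact map_smul (α.act g) l a
  map_zero' := by
    rw [← map_zero F.extend]; congr 1; ext g; exact map_zero (α.act g)
  map_add' a b := by
    rw [← map_add]; congr 1; ext g; exact map_add (α.act g) a b
  map_mul' a b := by
    rw [← extend_mul]; congr 1; ext g; exact map_mul (α.act g) a b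
  map_star' a := by
    rw [← extend_star]; congr 1; ext g; exact map_star (α.act g) a

theorem orbitHom_apply (a : A) : F.orbitHom a = F.extend (α.orbitMap a) := rfl

/-- Orbit maps are invariant under the diagonal action, as `α_g α_{g⁻¹x} = α_x`. -/
theorem seqAct_orbitHom (g : G) (a : A) : α.seqAct g (F.orbitHom a) = F.orbitHom a := by
  rw [orbitHom_apply, seqAct_extend]
  congr 1
  ext x
  change α.act g (α.act (g⁻¹ * x) a) = α.act x a
  rw [← act_mul, mul_inv_cancel_left]

theorem orbitHom_of_mem {a : A} (ha : a ∈ α.fixedPoints) : F.orbitHom a = constHom A a := by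
  have h : α.orbitMap a = tensorToMap G A (1 ⊗ₜ a) := by
    ext g
    rw [tensorToMap_tmul_apply, ContinuousMap.one_apply, one_smul]
    exact ha g
  rw [orbitHom_apply, h, extend_tensorToMap, TensorProduct.lift.tmul, bilin_one]

end RokhlinLift

/-- The inclusion of the fixed point algebra is sequentially split. -/
theorem HasRokhlinProperty.exists_sequentialSplitting (hα : α.HasRokhlinProperty) :
    ∃ ψ : A →⋆ₙₐ[ℂ] SeqAlg α.fixedPoints, ∀ b : α.fixedPoints, ψ b = constHom _ b := by
  obtain ⟨F⟩ := hα.nonempty_rokhlinLift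
  have hi : Function.Injective (SeqAlg.map α.inclusion) := SeqAlg.map_injective α.norm_inclusion
  obtain ⟨ψ, hψ⟩ := exists_factorization F.orbitHom (SeqAlg.map α.inclusion) hi
    fun a => α.exists_map_inclusion_eq fun g => F.seqAct_orbitHom g a
  refine ⟨ψ, fun b => hi ?_⟩
  rw [hψ, F.orbitHom_of_mem b.2]
  rfl

/-- Applying `φ` entrywise after the splitting maps `A` to `(E_∞)_∞` and sends a fixed point `b` to
the constant sequence `φ b`. Reindexing therefore returns an extension of `φ`. -/
theorem HasRokhlinProperty.sequenceAlgebraExtendible (hα : α.HasRokhlinProperty) :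
    SequenceAlgebraExtendible.{u, v} α.inclusion := by
  intro E _ φ
  obtain ⟨ψ, hψ⟩ := hα.exists_sequentialSplitting
  classical
  obtain ⟨ρ, hρ⟩ := exists_reindexed_hom ((SeqAlg.map φ).comp ψ) (α.fixedPoints : Set A)
    (fun a => if h : a ∈ α.fixedPoints then φ ⟨a, h⟩ else 0) (fun a ha => by
      rw [dif_pos (show a ∈ α.fixedPoints from ha)]
      exact congrArg (SeqAlg.map φ) (hψ ⟨a, ha⟩))
  refine ⟨ρ, ?_⟩
  ext b
  have h := hρ b b.2
  rw [dif_pos (show (b : A) ∈ α.fixedPoints from b.2)] at h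
  exact h.symm

end CStarAction

theorem SequenceAlgebraExtendible.weaklySemiprojective {A : Type u} {B : Type w}
    [NonUnitalCStarAlgebra A] [NonUnitalCStarAlgebra B] {θ : A →⋆ₙₐ[ℂ] B}
    (hθ : SequenceAlgebraExtendible.{u, v, w} θ) (hB : WeaklySemiprojective.{w, v} B) :
    WeaklySemiprojective.{u, v} A := by
  intro E _ ψ
  obtain ⟨ρ, rfl⟩ := hθ E ψ
  obtain ⟨φ, rfl⟩ := hB E ρ
  exact ⟨φ.comp θ, rfl⟩

/-! ### Gluing unitaries along a Rokhlin partition. -/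

section Exponentials

variable {M : Type u} [CStarAlgebra M]

theorem tendsto_mul_of_norm_le {x y : ℕ → M} {C : ℝ} (hx : ∀ n, ‖x n‖ ≤ C)
    (hy : Tendsto y atTop (𝓝 0)) : Tendsto (fun n => x n * y n) atTop (𝓝 0) := by
  refine squeeze_zero_norm (a := fun n => C * ‖y n‖) (fun n => (norm_mul_le _ _).trans
    (mul_le_mul_of_nonneg_right (hx n) (norm_nonneg _))) ?_
  simpa using hy.norm.const_mul C

/-- If `H_n` asymptotically acts on `e_n J` as `k` does, then `exp H_n` acts as `exp k` does. -/
theorem tendsto_exp_mul_sub {J : Set M} (hJ : ∀ m : M, ∀ x ∈ J, m * x ∈ J) {H e : ℕ → M} {k : M}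
    {C D : ℝ} (hH : ∀ n, ‖H n‖ ≤ C) (he : ∀ n, ‖e n‖ ≤ D)
    (h : ∀ x ∈ J, Tendsto (fun n => H n * (e n * x) - e n * (k * x)) atTop (𝓝 0))
    {x : M} (hx : x ∈ J) :
    Tendsto (fun n => NormedSpace.exp (H n) * (e n * x) - e n * (NormedSpace.exp k * x))
      atTop (𝓝 0) := by
  have hC : 0 ≤ C := (norm_nonneg _).trans (hH 0)
  have hD : 0 ≤ D := (norm_nonneg _).trans (he 0)
  -- Powers first: the hypothesis is applied at `k ^ m * x`, which stays in `J`. Dominated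
  -- convergence of the exponential series then gives the claim.
  have hm : ∀ m : ℕ, Tendsto (fun n => H n ^ m * (e n * x) - e n * (k ^ m * x)) atTop (𝓝 0) := by
    intro m
    induction m with
    | zero => simp
    | succ m ih =>
      have h1 := (tendsto_mul_of_norm_le hH ih).add (h (k ^ m * x) (hJ _ _ hx))
      rw [add_zero] at h1
      refine h1.congr fun n => ?_
      simp only [mul_sub, pow_succ', mul_assoc]
      abel
  have hsum : ∀ a : M, HasSum (fun m : ℕ => ((m.factorial : ℂ)⁻¹) • a ^ m) (NormedSpace.exp a) :=
    fun a => NormedSpace.exp_series_hasSum_exp' (𝕂 := ℂ) a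
  have hs : ∀ n, HasSum (fun m : ℕ => ((m.factorial : ℂ)⁻¹) •
      (H n ^ m * (e n * x) - e n * (k ^ m * x)))
      (NormedSpace.exp (H n) * (e n * x) - e n * (NormedSpace.exp k * x)) := by
    intro n
    have h1 := ((hsum (H n)).mul_right (e n * x)).sub (((hsum k).mul_right x).mul_left (e n))
    simpa only [smul_sub, smul_mul_assoc, mul_smul_comm] using h1
  simp_rw [← fun n => (hs n).tsum_eq]
  have h0 : Tendsto (fun n => ∑' m : ℕ, ((m.factorial : ℂ)⁻¹) •
      (H n ^ m * (e n * x) - e n * (k ^ m * x))) atTop (𝓝 (∑' m : ℕ, (0 : M))) := by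
    refine tendsto_tsum_of_dominated_convergence
      (bound := fun m : ℕ => C ^ m / m.factorial * (D * ‖x‖) + ‖k‖ ^ m / m.factorial * (D * ‖x‖))
      ?_ (fun m => ?_) (.of_forall fun n m => ?_)
    · exact ((Real.summable_pow_div_factorial C).mul_right _).add
        ((Real.summable_pow_div_factorial ‖k‖).mul_right _)
    · simpa using (hm m).const_smul ((m.factorial : ℂ)⁻¹)
    · have hp : ∀ a y : M, ‖a ^ m * y‖ ≤ ‖a‖ ^ m * ‖y‖ := by
        intro a y
        rcases Nat.eq_zero_or_pos m with rfl | h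
        · simp
        · exact (norm_mul_le _ _).trans (mul_le_mul_of_nonneg_right (norm_pow_le' a h)
            (norm_nonneg _))
      have h1 : ‖H n ^ m * (e n * x)‖ ≤ C ^ m * (D * ‖x‖) := by
        refine (hp _ _).trans (mul_le_mul (pow_le_pow_left₀ (norm_nonneg _) (hH n) m) ?_
          (norm_nonneg _) (by positivity))
        exact (norm_mul_le _ _).trans (mul_le_mul_of_nonneg_right (he n) (norm_nonneg _))
      have h2 : ‖e n * (k ^ m * x)‖ ≤ ‖k‖ ^ m * (D * ‖x‖) := by
        calc ‖e n * (k ^ m * x)‖ ≤ D * (‖k‖ ^ m * ‖x‖) := (norm_mul_le _ _).trans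
              (mul_le_mul (he n) (hp _ _) (norm_nonneg _) hD)
          _ = ‖k‖ ^ m * (D * ‖x‖) := by ring
      rw [norm_smul, norm_inv, Complex.norm_natCast, ← div_eq_inv_mul, div_mul_eq_mul_div,
        div_mul_eq_mul_div, ← add_div]
      gcongr
      exact (norm_sub_le _ _).trans (add_le_add h1 h2)
  simpa using h0

/-- The unitaries that are products of exponentials of skew-adjoint elements. -/
noncomputable def expUnitaries (M : Type u) [CStarAlgebra M] : Submonoid (unitary M) :=
  Submonoid.closure (Set.range selfAdjoint.expUnitary)

end Exponentials

section Intertwining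

variable {M : Type u} [CStarAlgebra M]

theorem norm_unitary_le_one (U : unitary M) : ‖(U : M)‖ ≤ 1 := by
  rcases subsingleton_or_nontrivial M with h | h
  · rw [Subsingleton.elim (U : M) 0, norm_zero]; exact zero_le_one
  · exact (CStarRing.norm_coe_unitary U).le

/-- A sequence of unitaries, as a bounded sequence. -/
noncomputable def unitarySeq (V : ℕ → unitary M) : EllInf M :=
  EllInf.mk (fun n => (V n : M)) 1 (fun _ => norm_unitary_le_one _)

theorem unitarySeq_mul (V W : ℕ → unitary M) :
    unitarySeq (fun n => V n * W n) = unitarySeq V * unitarySeq W := rfl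

theorem star_unitarySeq (V : ℕ → unitary M) :
    star (unitarySeq V) = unitarySeq (fun n => star (V n)) := rfl

/-- An asymptotic Rokhlin partition of unity for an action `α` of a finite group on a unital
C*-algebra, relative to an ideal `J`, together with invariant unitaries `ρ`. -/
structure RokhlinSystem (G : Type w) [Group G] [Fintype G] (M : Type u) [CStarAlgebra M] where
  act : G → (M →⋆ₐ[ℂ] M)
  act_mul : ∀ g h x, act (g * h) x = act g (act h x)
  act_one : ∀ x, act 1 x = x
  rho : G → unitary M
  rho_mul : ∀ g h, rho (g * h) = rho g * rho h
  act_rho : ∀ g h, act g (rho h : M) = rho h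
  rho_mem : ∀ g, rho g ∈ expUnitaries M
  J : AddSubmonoid M
  J_mul : ∀ m : M, ∀ x ∈ J, m * x ∈ J
  J_act : ∀ g, ∀ x ∈ J, act g x ∈ J
  e : G → EllInf M
  star_e : ∀ g, star (e g) = e g
  comm : ∀ g m, constHom M m * eta M (e g) = eta M (e g) * constHom M m
  mul_self : ∀ g, ∀ x ∈ J, eta M (e g) * (eta M (e g) * constHom M x) = eta M (e g) * constHom M x
  mul_ne : ∀ g h, g ≠ h → ∀ x ∈ J, eta M (e g) * (eta M (e h) * constHom M x) = 0
  sum_e : ∀ x ∈ J, ∑ g, eta M (e g) * constHom M x = constHom M x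
  map_e : ∀ g h, ∀ x ∈ J, SeqAlg.map (act g : M →⋆ₙₐ[ℂ] M) (eta M (e h)) * constHom M x =
    eta M (e (g * h)) * constHom M x

namespace RokhlinSystem

variable {G : Type w} [Group G] [Fintype G] (S : RokhlinSystem G M)

/-- A family of unitaries that can be glued along the Rokhlin partition to a sequence of
products of exponentials. -/
def Liftable (Y : G → unitary M) : Prop :=
  ∃ V : ℕ → unitary M, (∀ n, V n ∈ expUnitaries M) ∧ ∀ g, ∀ x ∈ S.J,
    eta M (unitarySeq V) * (eta M (S.e g) * constHom M x) =
      eta M (S.e g) * constHom M ((Y g : M) * x) ∧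
    eta M (star (unitarySeq V)) * (eta M (S.e g) * constHom M x) =
      eta M (S.e g) * constHom M (star (Y g : M) * x)

/-- Termwise products of lifts work: the lift of `Z` moves across `e_g` as `Z_g`, and `Z_g x` is
still in `J`, so the lift of `Y` can follow. -/
theorem liftable_mul {Y Z : G → unitary M} (hY : S.Liftable Y) (hZ : S.Liftable Z) :
    S.Liftable (Y * Z) := by
  obtain ⟨V, hV, hV'⟩ := hY
  obtain ⟨W, hW, hW'⟩ := hZ
  refine ⟨fun n => V n * W n, fun n => mul_mem (hV n) (hW n), fun g x hx => ⟨?_, ?_⟩⟩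
  · rw [unitarySeq_mul, map_mul, mul_assoc, (hW' g x hx).1, (hV' g _ (S.J_mul _ _ hx)).1,
      Pi.mul_apply, Submonoid.coe_mul, mul_assoc]
  · rw [unitarySeq_mul, star_mul, map_mul, mul_assoc, (hV' g x hx).2,
      (hW' g _ (S.J_mul _ _ hx)).2, Pi.mul_apply, Submonoid.coe_mul, star_mul, mul_assoc]

/-- The naive gluing `∑ e_g exp(i k_g)` need not be unitary. The sum `H = ∑ e_h k_h e_h` is
self-adjoint term by term, so `exp(i H_n)` is a unitary; as the `e_h` are orthogonal projections on
`J` modulo null sequences, `H` acts on `e_g x` as `k_g`, and exponentials follow suit. -/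
theorem liftable_exp (k : G → selfAdjoint M) :
    S.Liftable fun g => selfAdjoint.expUnitary (k g) := by
  classical
  let H : EllInf M := ∑ h, S.e h * constSeq M (k h : M) * S.e h
  have hHs : ∀ n, IsSelfAdjoint (H n) := by
    intro n
    have : star H = H := by
      simp only [H, star_sum, star_mul, S.star_e, mul_assoc]
      refine Finset.sum_congr rfl fun h _ => ?_
      rw [← map_star, (k h).2.star_eq]
    have h2 := congrArg (fun z : EllInf M => z n) this
    exact h2
  have hH : ∀ g, ∀ x ∈ S.J, eta M H * (eta M (S.e g) * constHom M x) =
      eta M (S.e g) * constHom M ((k g : M) * x) := by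
    intro g x hx
    have h1 : eta M H = ∑ h, eta M (S.e h) * constHom M (k h : M) * eta M (S.e h) := by
      rw [map_sum]
      simp only [map_mul]
      rfl
    rw [h1, Finset.sum_mul, Finset.sum_eq_single g]
    · rw [mul_assoc, S.mul_self g x hx, mul_assoc, ← mul_assoc (constHom M _), S.comm, mul_assoc,
        ← map_mul, S.mul_self g _ (S.J_mul _ _ hx)]
    · intro h _ hne
      rw [mul_assoc, S.mul_ne h g hne x hx, mul_zero]
    · intro h; exact absurd (Finset.mem_univ g) h
  -- The scalar `c` will be `i` for the unitaries and `-i` for their adjoints.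
  have key : ∀ (c : ℂ) (g : G), ∀ x ∈ S.J,
      Tendsto (fun n => NormedSpace.exp (c • H n) * (S.e g n * x) -
        S.e g n * (NormedSpace.exp (c • (k g : M)) * x)) atTop (𝓝 0) := by
    intro c g x hx
    refine tendsto_exp_mul_sub (J := S.J) S.J_mul (C := ‖c • H‖) (D := ‖S.e g‖)
      (fun n => norm_apply_le (c • H) n) (fun n => norm_apply_le _ n) (fun y hy => ?_) hx
    have h1 := eta_eq_iff.1 (show eta M (H * (S.e g * constSeq M y)) =
      eta M (S.e g * constSeq M ((k g : M) * y)) from hH g y hy)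
    rw [← tendsto_zero_iff_norm_tendsto_zero] at h1
    have h2 := h1.const_smul c
    rw [smul_zero] at h2
    refine h2.congr fun n => ?_
    change c • (H n * (S.e g n * y) - S.e g n * ((k g : M) * y)) =
      (c • H n) * (S.e g n * y) - S.e g n * ((c • (k g : M)) * y)
    rw [smul_mul_assoc, smul_mul_assoc, mul_smul_comm, ← smul_sub]
  refine ⟨fun n => selfAdjoint.expUnitary ⟨H n, hHs n⟩,
    fun n => Submonoid.subset_closure ⟨_, rfl⟩, fun g x hx => ⟨?_, ?_⟩⟩
  · have h1 := (key Complex.I g x hx).norm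
    rw [norm_zero] at h1
    exact eta_eq_iff.2 h1
  · have h1 := (key (-Complex.I) g x hx).norm
    rw [norm_zero] at h1
    refine eta_eq_iff.2 (h1.congr fun n => ?_)
    have h2 : ∀ a : selfAdjoint M, star (selfAdjoint.expUnitary a : M) =
        NormedSpace.exp (-Complex.I • (a : M)) := by
      intro a
      rw [selfAdjoint.expUnitary_coe, NormedSpace.star_exp, star_smul, a.2.star_eq]
      simp
    rw [h2]
    have h3 := h2 ⟨H n, hHs n⟩
    rw [star_unitarySeq]
    change _ = ‖star (selfAdjoint.expUnitary ⟨H n, hHs n⟩ : M) * (S.e g n * x) - _‖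
    rw [h3]
    rfl

/-- The factorizations of the `Y g` may have different lengths; since `1 = exp 0` is an exponential,
the closure of a product of sets is the product of the closures, so the family itself is a product
of families of exponentials. -/
theorem liftable_of_mem {Y : G → unitary M} (hY : ∀ g, Y g ∈ expUnitaries M) : S.Liftable Y := by
  have h1 : (1 : unitary M) ∈ Set.range (selfAdjoint.expUnitary (A := M)) :=
    ⟨0, selfAdjoint.expUnitary_zero⟩
  have h2 : Y ∈ Submonoid.closure
      (Set.univ.pi fun _ : G => Set.range (selfAdjoint.expUnitary (A := M))) := by
    rw [Submonoid.closure_pi fun _ => h1]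
    exact fun g _ => hY g
  clear hY
  induction h2 using Submonoid.closure_induction with
  | mem Z hZ =>
    choose k hk using fun g => hZ g (Set.mem_univ g)
    rw [← funext hk]
    exact S.liftable_exp k
  | one =>
    have := S.liftable_exp (fun _ => 0)
    rwa [selfAdjoint.expUnitary_zero] at this
  | mul Z W _ _ hZ hW => exact S.liftable_mul hZ hW

end RokhlinSystem

end Intertwining

/-! ### Almost invariant unitaries. -/

namespace RokhlinSystem

variable {M : Type u} [CStarAlgebra M] {G : Type w} [Group G] [Fintype G] (S : RokhlinSystem G M)

/-- The automorphism `α_g`, on unitaries. -/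
noncomputable def unitaryAct (g : G) : unitary M →* unitary M :=
  Unitary.map { (S.act g : M →* M) with map_star' := map_star (S.act g) }

/-- The action `U ↦ ρ_g α_g(U)` of `G` on unitaries. -/
noncomputable def shift (g : G) (U : unitary M) : unitary M :=
  S.rho g * S.unitaryAct g U

theorem coe_shift (g : G) (U : unitary M) :
    (S.shift g U : M) = (S.rho g : M) * S.act g (U : M) := rfl

/-- Since `ρ` is a representation by `α`-fixed unitaries, it is an `α`-cocycle and `U ↦ ρ_g α_g(U)`
is an action. -/
theorem shift_shift (g h : G) (U : unitary M) : S.shift g (S.shift h U) = S.shift (g * h) U := by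
  refine Subtype.ext ?_
  rw [coe_shift, coe_shift, coe_shift, map_mul, S.act_rho, S.rho_mul, S.act_mul, Submonoid.coe_mul,
    mul_assoc]

theorem act_expUnitary (g : G) (k : selfAdjoint M) :
    S.unitaryAct g (selfAdjoint.expUnitary k) =
      selfAdjoint.expUnitary ⟨S.act g k, k.2.map (S.act g)⟩ := by
  refine Subtype.ext ?_
  change S.act g (selfAdjoint.expUnitary k : M) = _
  let : NormedAlgebra ℚ M := NormedAlgebra.restrictScalars ℚ ℂ M
  rw [selfAdjoint.expUnitary_coe, selfAdjoint.expUnitary_coe, NormedSpace.map_exp (S.act g)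
    (NonUnitalStarAlgHom.instContinuousLinearMapClassComplex.map_continuous (S.act g)), map_smul]

theorem shift_mem (g : G) {U : unitary M} (hU : U ∈ expUnitaries M) :
    S.shift g U ∈ expUnitaries M := by
  refine Submonoid.mul_mem _ (S.rho_mem g) ?_
  induction hU using Submonoid.closure_induction with
  | mem U hU =>
    obtain ⟨k, rfl⟩ := hU
    rw [act_expUnitary]
    exact Submonoid.subset_closure ⟨_, rfl⟩
  | one => rw [map_one]; exact Submonoid.one_mem _
  | mul U V _ _ hU hV => rw [map_mul]; exact Submonoid.mul_mem _ hU hV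

variable {S}

theorem mul_const_eq_sum {W : EllInf M} {Y : G → M} (hW : ∀ g, ∀ x ∈ S.J,
      eta M W * (eta M (S.e g) * constHom M x) = eta M (S.e g) * constHom M (Y g * x))
    {x : M} (hx : x ∈ S.J) :
    eta M W * constHom M x = ∑ g, eta M (S.e g) * constHom M (Y g * x) := by
  rw [← congrArg (eta M W * ·) (S.sum_e x hx), Finset.mul_sum]
  exact Finset.sum_congr rfl fun g _ => hW g x hx

/-- On `J` the sequence `W` is `∑ e_g Y_g`. The automorphism `α_h` takes `e_g` to `e_{hg}` there,
and `a`, `b` turn `α_h(Y_g)` into `Y_{hg}`, so the sum is merely permuted. The two-sided form serves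
both the unitaries, with `a = ρ_h`, and their adjoints, with `b = ρ_h*`. -/
theorem conj_mul_const_eq {W : EllInf M} {Y : G → M} (hW : ∀ g, ∀ x ∈ S.J,
      eta M W * (eta M (S.e g) * constHom M x) = eta M (S.e g) * constHom M (Y g * x))
    {a b : M} {h : G} (hab : ∀ g, a * S.act h (Y g) * b = Y (h * g)) {x : M} (hx : x ∈ S.J) :
    constHom M a * (SeqAlg.map (S.act h : M →⋆ₙₐ[ℂ] M) (eta M W) * constHom M (b * x)) =
      eta M W * constHom M x := by
  have hb : S.act h (S.act h⁻¹ (b * x)) = b * x := by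
    rw [← S.act_mul, mul_inv_cancel, S.act_one]
  have hc : ∀ y : M, SeqAlg.map (S.act h : M →⋆ₙₐ[ℂ] M) (constHom M y) = constHom M (S.act h y) :=
    fun y => rfl
  -- The expansion is taken at `α_h⁻¹(b x)`, which `α_h` turns into `b x`.
  have h1 := congrArg (SeqAlg.map (S.act h : M →⋆ₙₐ[ℂ] M))
    (mul_const_eq_sum hW (S.J_act h⁻¹ _ (S.J_mul b x hx)))
  rw [map_mul, hc, hb, map_sum] at h1
  rw [h1, mul_const_eq_sum hW hx, Finset.mul_sum]
  refine Fintype.sum_equiv (Equiv.mulLeft h) _ _ fun g => ?_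
  rw [map_mul, hc, map_mul, hb, S.map_e h g _ (S.J_mul _ _ (S.J_mul _ _ hx)), ← mul_assoc, S.comm,
    mul_assoc, ← map_mul, Equiv.coe_mulLeft, ← hab, mul_assoc, mul_assoc]

theorem tendsto_conj_sub {W : EllInf M} {Y : G → M} (hW : ∀ g, ∀ x ∈ S.J,
      eta M W * (eta M (S.e g) * constHom M x) = eta M (S.e g) * constHom M (Y g * x))
    {a b : M} {h : G} (hab : ∀ g, a * S.act h (Y g) * b = Y (h * g)) {x : M} (hx : x ∈ S.J) :
    Tendsto (fun n => ‖(a * S.act h (W n) * b - W n) * x‖) atTop (𝓝 0) := by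
  have h1 := eta_eq_iff.1 (show eta M (constSeq M a * (EllInf.map (S.act h : M →⋆ₙₐ[ℂ] M) W *
    constSeq M (b * x))) = eta M (W * constSeq M x) from conj_mul_const_eq hW hab hx)
  refine h1.congr fun n => ?_
  change ‖a * (S.act h (W n) * (b * x)) - W n * x‖ = _
  rw [sub_mul, mul_assoc, mul_assoc]

/-- As `∑ e_g` acts as one on `J`, both `W x` and `X x` can be expanded along the partition, with
difference `∑ e_g (Y_g - X) x`. -/
theorem eventually_norm_sub_mul_lt {W : EllInf M} {Y : G → M} (hW : ∀ g, ∀ x ∈ S.J,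
      eta M W * (eta M (S.e g) * constHom M x) = eta M (S.e g) * constHom M (Y g * x))
    (X : M) {x : M} (hx : x ∈ S.J) {ε : ℝ} (hε : 0 < ε) :
    ∀ᶠ n in atTop, ‖(W n - X) * x‖ < ∑ g, ‖S.e g‖ * ‖(Y g - X) * x‖ + ε := by
  have h1 : eta M (W * constSeq M x - constSeq M (X * x)) =
      eta M (∑ g, S.e g * constSeq M ((Y g - X) * x)) := by
    change eta M W * constHom M x - constHom M (X * x) = _
    rw [← S.sum_e (X * x) (S.J_mul X x hx), mul_const_eq_sum hW hx, ← Finset.sum_sub_distrib,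
      map_sum]
    refine Finset.sum_congr rfl fun g _ => ?_
    rw [← mul_sub, ← map_sub (constHom M), ← sub_mul]
    rfl
  filter_upwards [(tendsto_order.1 (eta_eq_iff.1 h1)).2 ε hε] with n hn
  have h2 : ‖(∑ g, S.e g * constSeq M ((Y g - X) * x) : EllInf M) n‖ ≤
      ∑ g, ‖S.e g‖ * ‖(Y g - X) * x‖ := by
    refine (norm_apply_le _ n).trans ((norm_sum_le _ _).trans (Finset.sum_le_sum fun g _ => ?_))
    exact (norm_mul_le _ _).trans (mul_le_mul_of_nonneg_left
      (EllInf.norm_le (norm_nonneg _) fun _ => le_rfl) (norm_nonneg _))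
  calc ‖(W n - X) * x‖ = ‖(W * constSeq M x - constSeq M (X * x) : EllInf M) n‖ := by
        rw [sub_mul]; rfl
    _ ≤ _ := norm_le_norm_add_norm_sub' _ ((∑ g, S.e g * constSeq M ((Y g - X) * x) : EllInf M) n)
    _ < _ := add_lt_add_of_le_of_lt h2 hn

/-- Glue the orbit `ρ_g α_g(X)`. The shift permutes this family, so the glued unitary is almost
invariant, and it differs from `X` only as much as `X` fails to be invariant. Adjoints are
controlled too, because conjugation needs them. -/
theorem exists_almost_invariant {X : unitary M} (hX : X ∈ expUnitaries M) (F : Finset M)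
    (hF : ∀ x ∈ F, x ∈ S.J) {ε : ℝ} (hε : 0 < ε) :
    ∃ X' ∈ expUnitaries M, ∀ x ∈ F,
      (∀ h, ‖((S.shift h X' : M) - X') * x‖ < ε ∧ ‖(star (S.shift h X' : M) - star (X' : M)) * x‖ < ε)
      ∧ ‖((X' : M) - X) * x‖ < ∑ g, ‖S.e g‖ * ‖((S.shift g X : M) - X) * x‖ + ε
      ∧ ‖(star (X' : M) - star (X : M)) * x‖ <
        ∑ g, ‖S.e g‖ * ‖(star (S.shift g X : M) - star (X : M)) * x‖ + ε := by
  obtain ⟨V, hV, hVe⟩ := S.liftable_of_mem (Y := fun g => S.shift g X) fun g => S.shift_mem g hX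
  beta_reduce at hVe
  have hV1 := fun g x hx => (hVe g x hx).1
  have hV2 := fun g x hx => (hVe g x hx).2
  have key : ∀ x ∈ F, ∀ᶠ n in atTop,
      (∀ h, ‖((S.shift h (V n) : M) - V n) * x‖ < ε ∧
        ‖(star (S.shift h (V n) : M) - star (V n : M)) * x‖ < ε)
      ∧ ‖((V n : M) - X) * x‖ < ∑ g, ‖S.e g‖ * ‖((S.shift g X : M) - X) * x‖ + ε
      ∧ ‖(star (V n : M) - star (X : M)) * x‖ <
        ∑ g, ‖S.e g‖ * ‖(star (S.shift g X : M) - star (X : M)) * x‖ + ε := by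
    intro x hx
    refine (eventually_all.2 fun h => ?_).and
      ((eventually_norm_sub_mul_lt hV1 X (hF x hx) hε).and
      (eventually_norm_sub_mul_lt hV2 (star (X : M)) (hF x hx) hε))
    have h1 := tendsto_conj_sub hV1 (a := (S.rho h : M)) (b := 1) (h := h)
      (fun g => by rw [mul_one, ← shift_shift, ← coe_shift]) (hF x hx)
    have h2 := tendsto_conj_sub hV2 (a := 1) (b := star (S.rho h : M)) (h := h)
      (fun g => by rw [one_mul, map_star, ← star_mul, ← coe_shift, shift_shift]) (hF x hx)
    filter_upwards [(tendsto_order.1 h1).2 ε hε, (tendsto_order.1 h2).2 ε hε] with n h1 h2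
    rw [mul_one] at h1
    rw [one_mul] at h2
    refine ⟨h1, ?_⟩
    rw [coe_shift, star_mul, ← map_star]
    exact h2
  obtain ⟨n, hn⟩ := ((eventually_all_finset F).2 key).exists
  exact ⟨V n, hV n, hn⟩

end RokhlinSystem

/-! ### Limits of inner automorphisms. -/

section Limits

variable {M : Type u} [CStarAlgebra M]

theorem tendsto_mul_of_mem_closure {ι : Type*} {l : Filter ι} {m : ι → M} {C : ℝ}
    (hm : ∀ i, ‖m i‖ ≤ C) {s : Set M} (hs : ∀ x ∈ s, Tendsto (fun i => m i * x) l (𝓝 0))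
    {x : M} (hx : x ∈ closure s) : Tendsto (fun i => m i * x) l (𝓝 0) := by
  rw [tendsto_zero_iff_norm_tendsto_zero, tendsto_order]
  refine ⟨fun a ha => .of_forall fun i => ha.trans_le (norm_nonneg _), fun ε hε => ?_⟩
  have hC : 0 < |C| + 1 := by positivity
  obtain ⟨y, hy, hxy⟩ := Metric.mem_closure_iff.1 hx (ε / (2 * (|C| + 1))) (by positivity)
  filter_upwards [(tendsto_order.1 (hs y hy).norm).2 (ε / 2) (by rw [norm_zero]; positivity)]
    with i hi
  have h1 : ‖m i * (x - y)‖ ≤ ε / 2 := by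
    calc ‖m i * (x - y)‖ ≤ (|C| + 1) * (ε / (2 * (|C| + 1))) := by
          refine (norm_mul_le _ _).trans (mul_le_mul ?_ ?_ (norm_nonneg _) hC.le)
          · exact (hm i).trans ((le_abs_self C).trans (le_add_of_nonneg_right zero_le_one))
          · rw [← dist_eq_norm]; exact hxy.le
      _ = ε / 2 := by field_simp
  calc ‖m i * x‖ = ‖m i * (x - y) + m i * y‖ := by rw [← mul_add, sub_add_cancel]
    _ ≤ ‖m i * (x - y)‖ + ‖m i * y‖ := norm_add_le _ _
    _ < ε := by linarith

theorem exists_tendsto_of_geometric {m : ℕ → M} (hm : ∀ k, ‖m k‖ ≤ 1) {d : ℕ → M} {C : ℝ}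
    (h : ∀ i k, i < k → ‖(m (k + 1) - m k) * d i‖ ≤ C * (1 / 2) ^ k)
    {x : M} (hx : x ∈ closure (Set.range d)) :
    ∃ y, Tendsto (fun k => m k * x) atTop (𝓝 y) := by
  refine cauchySeq_tendsto_of_complete ?_
  have hdist : ∀ x, CauchySeq (fun k => m k * x) ↔
      Tendsto (fun p : ℕ × ℕ => (m p.1 - m p.2) * x) atTop (𝓝 0) := by
    intro x
    rw [cauchySeq_iff_tendsto_dist_atTop_0]
    simp only [dist_eq_norm, sub_mul]
    exact tendsto_zero_iff_norm_tendsto_zero.symm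
  rw [hdist]
  refine tendsto_mul_of_mem_closure (C := 1 + 1) (fun p => (norm_sub_le _ _).trans
    (add_le_add (hm _) (hm _))) ?_ hx
  rintro _ ⟨i, rfl⟩
  rw [← hdist, ← cauchySeq_shift (i + 1)]
  refine cauchySeq_of_le_geometric (1 / 2) (C * (1 / 2) ^ (i + 1)) (by norm_num) fun n => ?_
  rw [dist_comm, dist_eq_norm, ← sub_mul, mul_assoc, ← pow_add, add_comm (i + 1) n,
    add_right_comm n 1]
  exact h i (n + (i + 1)) (by omega)

end Limits

namespace RokhlinSystem

variable {M : Type u} [CStarAlgebra M] {G : Type w} [Group G] [Fintype G] (S : RokhlinSystem G M)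

/-- A sequence of unitaries which converges on `J` and is asymptotically fixed by the action
`U ↦ ρ_g α_g(U)`. -/
theorem exists_asymptotically_invariant {d : ℕ → M} (hd : ∀ i, d i ∈ S.J)
    (hJ : (S.J : Set M) ⊆ closure (Set.range d)) :
    ∃ X : ℕ → unitary M, ∀ x ∈ S.J,
      (∃ y, Tendsto (fun k => (X k : M) * x) atTop (𝓝 y)) ∧
      (∃ y, Tendsto (fun k => star (X k : M) * x) atTop (𝓝 y)) ∧
      ∀ h, Tendsto (fun k => ((S.shift h (X k) : M) - X k) * x) atTop (𝓝 0) ∧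
        Tendsto (fun k => (star (S.shift h (X k) : M) - star (X k : M)) * x) atTop (𝓝 0) := by
  classical
  have step : ∀ (k : ℕ) (X : expUnitaries M), ∃ X' : expUnitaries M, ∀ i ≤ k,
      (∀ h, ‖((S.shift h X' : M) - (X' : unitary M)) * d i‖ < (1 / 2) ^ k ∧
        ‖(star (S.shift h X' : M) - star ((X' : unitary M) : M)) * d i‖ < (1 / 2) ^ k)
      ∧ ‖(((X' : unitary M) : M) - (X : unitary M)) * d i‖ <
        ∑ g, ‖S.e g‖ * ‖((S.shift g X : M) - (X : unitary M)) * d i‖ + (1 / 2) ^ k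
      ∧ ‖(star ((X' : unitary M) : M) - star ((X : unitary M) : M)) * d i‖ <
        ∑ g, ‖S.e g‖ * ‖(star (S.shift g X : M) - star ((X : unitary M) : M)) * d i‖ +
          (1 / 2) ^ k := by
    intro k X
    obtain ⟨X', hX', h⟩ := S.exists_almost_invariant X.2 ((Finset.range (k + 1)).image d)
      (fun x hx => by
        obtain ⟨i, _, rfl⟩ := Finset.mem_image.1 hx
        exact hd i) (ε := (1 / 2) ^ k) (by positivity)
    exact ⟨⟨X', hX'⟩, fun i hi => h _ (Finset.mem_image_of_mem d
      (Finset.mem_range.2 (Nat.lt_succ_of_le hi)))⟩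
  choose next hnext using step
  let Z : ℕ → expUnitaries M := fun k => Nat.rec 1 next k
  have hZ : ∀ k, Z (k + 1) = next k (Z k) := fun k => rfl
  let X : ℕ → unitary M := fun k => (Z k).1
  have h1 : ∀ i k, i ≤ k → ∀ h, ‖((S.shift h (X (k + 1)) : M) - X (k + 1)) * d i‖ < (1 / 2) ^ k ∧
      ‖(star (S.shift h (X (k + 1)) : M) - star (X (k + 1) : M)) * d i‖ < (1 / 2) ^ k := by
    intro i k hi
    exact (hnext k (Z k) i hi).1
  set K : ℝ := ∑ g, ‖S.e g‖ with hK
  have h2 : ∀ i k, i < k → ‖((X (k + 1) : M) - X k) * d i‖ ≤ (K * 2 + 1) * (1 / 2) ^ k ∧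
      ‖(star (X (k + 1) : M) - star (X k : M)) * d i‖ ≤ (K * 2 + 1) * (1 / 2) ^ k := by
    intro i k hi
    -- The shift defect of the unitary at stage `k + 1` is below `(1 / 2) ^ k`, one power behind the
    -- step from it; this explains the factor `2` after `K` and the strict inequality `i < k`.
    obtain ⟨k, rfl⟩ := Nat.exists_eq_succ_of_ne_zero (Nat.ne_zero_of_lt hi)
    have hi' := Nat.le_of_lt_succ hi
    have hn := (hnext (k + 1) (Z (k + 1)) i hi.le).2
    have hsum : ∀ f : G → ℝ, (∀ g, f g ≤ (1 / 2) ^ k) →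
        ∑ g, ‖S.e g‖ * f g + (1 / 2) ^ (k + 1) ≤ (K * 2 + 1) * (1 / 2) ^ (k + 1) := by
      intro f hf
      have : ∑ g, ‖S.e g‖ * f g ≤ K * (1 / 2) ^ k := by
        rw [hK, Finset.sum_mul]
        exact Finset.sum_le_sum fun g _ => mul_le_mul_of_nonneg_left (hf g) (norm_nonneg _)
      rw [pow_succ]
      linarith
    exact ⟨hn.1.le.trans (hsum _ fun g => (h1 i k hi' g).1.le),
      hn.2.le.trans (hsum _ fun g => (h1 i k hi' g).2.le)⟩
  have hn1 : ∀ U : unitary M, ‖star (U : M)‖ ≤ 1 := fun U => by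
    rw [norm_star]; exact norm_unitary_le_one U
  have hz : ∀ m : ℕ → M, (∀ i k, i ≤ k → ‖m (k + 1) * d i‖ < (1 / 2) ^ k) → (∀ k, ‖m k‖ ≤ 1 + 1) →
      ∀ x ∈ S.J, Tendsto (fun k => m k * x) atTop (𝓝 0) := by
    intro m hm hm' x hx
    refine tendsto_mul_of_mem_closure hm' ?_ (hJ hx)
    rintro _ ⟨i, rfl⟩
    rw [← tendsto_add_atTop_iff_nat 1]
    refine squeeze_zero_norm' ?_ (tendsto_pow_atTop_nhds_zero_of_lt_one (r := (1 / 2 : ℝ))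
      (by norm_num) (by norm_num))
    filter_upwards [eventually_ge_atTop i] with k hk using (hm i k hk).le
  refine ⟨X, fun x hx => ⟨?_, ?_, fun h => ⟨?_, ?_⟩⟩⟩
  · exact exists_tendsto_of_geometric (fun k => norm_unitary_le_one _)
      (fun i k hi => (h2 i k hi).1) (hJ hx)
  · exact exists_tendsto_of_geometric (fun k => hn1 _) (fun i k hi => (h2 i k hi).2) (hJ hx)
  · exact hz (fun k => (S.shift h (X k) : M) - X k) (fun i k hi => (h1 i k hi h).1)
      (fun k => (norm_sub_le _ _).trans
        (add_le_add (norm_unitary_le_one _) (norm_unitary_le_one _))) x hx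
  · exact hz (fun k => star (S.shift h (X k) : M) - star (X k : M))
      (fun i k hi => (h1 i k hi h).2)
      (fun k => (norm_sub_le _ _).trans (add_le_add (hn1 _) (hn1 _))) x hx

end RokhlinSystem

section Intertwine

variable {M : Type u} [CStarAlgebra M] {C : Type v} {D : Type w}
  [NonUnitalRing C] [StarRing C] [Module ℂ C] [NonUnitalRing D] [StarRing D] [Module ℂ D]

theorem tendsto_conj_star_of_tendsto_conj {X : ℕ → unitary M} {x y : M}
    (h : Tendsto (fun k => (X k : M) * x * star (X k : M)) atTop (𝓝 y)) :
    Tendsto (fun k => star (X k : M) * y * (X k : M)) atTop (𝓝 x) := by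
  rw [tendsto_iff_norm_sub_tendsto_zero] at h ⊢
  refine squeeze_zero (fun _ => norm_nonneg _) (fun k => ?_) h
  have h1 : star (X k : M) * y * X k - x = star (X k : M) * -(X k * x * star (X k : M) - y) * X k := by
    have h2 : star (X k : M) * (X k * x * star (X k : M)) * X k = x := by
      simp only [mul_assoc, Unitary.coe_star_mul_self, mul_one]
      rw [← mul_assoc, Unitary.coe_star_mul_self, one_mul]
    rw [mul_neg, neg_mul, mul_sub, sub_mul, h2, neg_sub]
  rw [h1]
  refine (norm_mul_le _ _).trans ((mul_le_mul_of_nonneg_left (norm_unitary_le_one _)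
    (norm_nonneg _)).trans ?_)
  rw [mul_one]
  refine (norm_mul_le _ _).trans ((mul_le_mul_of_nonneg_right (c := 1) ?_ (norm_nonneg _)).trans ?_)
  · rw [norm_star]; exact norm_unitary_le_one _
  · rw [norm_neg, one_mul]

/-- If a sequence of inner automorphisms converges pointwise on the image of `Q` to elements of
the image of `P`, and conversely, then the domains of `P` and `Q` are isomorphic. -/
theorem nonempty_starAlgEquiv_of_conj {P : C →⋆ₙₐ[ℂ] M} {Q : D →⋆ₙₐ[ℂ] M}
    (hP : Function.Injective P) (hQ : Function.Injective Q) (X : ℕ → unitary M)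
    (h1 : ∀ d, ∃ c, Tendsto (fun k => (X k : M) * Q d * star (X k : M)) atTop (𝓝 (P c)))
    (h2 : ∀ c, ∃ d, Tendsto (fun k => star (X k : M) * P c * (X k : M)) atTop (𝓝 (Q d))) :
    Nonempty (C ≃⋆ₐ[ℂ] D) := by
  choose f hf using h2
  choose g hg using h1
  have hconj : ∀ k (x y : M), star (X k : M) * (x * y) * X k =
      (star (X k : M) * x * X k) * (star (X k : M) * y * X k) := by
    intro k x y
    simp only [mul_assoc]
    rw [← mul_assoc (X k : M) (star (X k : M)), Unitary.mul_star_self_of_mem (X k).2, one_mul]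
  have hu : ∀ {c : C} {d : D},
      Tendsto (fun k => star (X k : M) * P c * (X k : M)) atTop (𝓝 (Q d)) → f c = d :=
    fun h => hQ (tendsto_nhds_unique (hf _) h)
  exact ⟨{
    toFun := f
    invFun := g
    left_inv := fun c => by
      refine hP (tendsto_nhds_unique (hg (f c)) ?_)
      have := tendsto_conj_star_of_tendsto_conj (X := fun k => star (X k)) (x := P c) (y := Q (f c))
        (by simpa using hf c)
      simpa using this
    right_inv := fun d => hu (tendsto_conj_star_of_tendsto_conj (hg d))
    map_mul' := fun a b => hu (by
      simpa only [map_mul, hconj] using (hf a).mul (hf b))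
    map_add' := fun a b => hu (by
      simpa only [map_add, mul_add, add_mul] using (hf a).add (hf b))
    map_star' := fun a => hu (by
      simpa only [map_star, star_mul, star_star, mul_assoc] using (hf a).star)
    map_smul' := fun c a => hu (by
      simpa only [map_smul, mul_smul_comm, smul_mul_assoc] using (hf a).const_smul c) }⟩

end Intertwine

namespace RokhlinSystem

variable {M : Type u} [CStarAlgebra M] {G : Type w} [Group G] [Fintype G] (S : RokhlinSystem G M)

theorem mul_mem_of_star_mem (hstar : ∀ x ∈ S.J, star x ∈ S.J) {x : M} (hx : x ∈ S.J) (m : M) :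
    x * m ∈ S.J := by
  have h := hstar _ (S.J_mul (star m) _ (hstar x hx))
  rwa [star_mul, star_star, star_star] at h

variable {S}

/-- Only left multiplication is known to converge. Taking adjoints, `x m_k*` converges to an element
of `J`; left multiplication by `m_k` converges on that element, and boundedness absorbs the
difference. -/
theorem exists_tendsto_conj (hstar : ∀ x ∈ S.J, star x ∈ S.J) (hclosed : IsClosed (S.J : Set M))
    {m : ℕ → M} {C : ℝ} (hC : ∀ k, ‖m k‖ ≤ C)
    (hm : ∀ x ∈ S.J, ∃ y, Tendsto (fun k => m k * x) atTop (𝓝 y)) {x : M} (hx : x ∈ S.J) :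
    ∃ y ∈ S.J, Tendsto (fun k => m k * x * star (m k)) atTop (𝓝 y) := by
  obtain ⟨y, hy⟩ := hm _ (hstar x hx)
  have hy' : Tendsto (fun k => x * star (m k)) atTop (𝓝 (star y)) := by
    simpa only [star_mul, star_star] using hy.star
  have hyJ : star y ∈ S.J := hclosed.mem_of_tendsto hy'
    (.of_forall fun k => S.mul_mem_of_star_mem hstar hx _)
  obtain ⟨z, hz⟩ := hm _ hyJ
  have h0 : Tendsto (fun k => x * star (m k) - star y) atTop (𝓝 0) := by
    simpa using hy'.sub_const (star y)
  have h1 : Tendsto (fun k => m k * x * star (m k)) atTop (𝓝 z) := by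
    have h2 := (tendsto_mul_of_norm_le hC h0).add hz
    rw [zero_add] at h2
    refine h2.congr fun k => ?_
    rw [mul_sub, sub_add_cancel, mul_assoc]
  exact ⟨z, hclosed.mem_of_tendsto h1
    (.of_forall fun k => S.mul_mem_of_star_mem hstar (S.J_mul _ _ hx) _), h1⟩

theorem tendsto_conj_sub_conj (hstar : ∀ x ∈ S.J, star x ∈ S.J) {m m' : ℕ → M} {C : ℝ}
    (hC : ∀ k, ‖m k‖ ≤ C) (hC' : ∀ k, ‖m' k‖ ≤ C)
    (hm : ∀ x ∈ S.J, Tendsto (fun k => (m' k - m k) * x) atTop (𝓝 0)) {x : M} (hx : x ∈ S.J) :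
    Tendsto (fun k => m' k * x * star (m' k) - m k * x * star (m k)) atTop (𝓝 0) := by
  have h1 : Tendsto (fun k => m' k * (x * star (m' k - m k))) atTop (𝓝 0) := by
    refine tendsto_mul_of_norm_le hC' ?_
    have := (hm _ (hstar x hx)).star
    simpa only [star_mul, star_star, star_zero] using this
  have h2 : Tendsto (fun k => star (m k * star ((m' k - m k) * x))) atTop (𝓝 0) := by
    have := (tendsto_mul_of_norm_le hC (by simpa only [star_zero] using (hm x hx).star)).star
    simpa only [star_zero] using this
  have h3 := h1.add h2
  rw [add_zero] at h3
  refine h3.congr fun k => ?_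
  simp only [star_mul, star_sub, star_star, mul_sub, sub_mul, mul_assoc]
  abel

/-- For `α`-fixed `x ∈ J`, applying `Ad ρ_h ∘ α_h` to `X_k x X_k*` replaces `X_k` by its shift,
which makes no difference in the limit; so the limit of `Ad X_k` takes `α`-fixed elements to
elements fixed by `Ad ρ_h ∘ α_h`. The adjoints `X_k*` give the inverse in the same way. -/
theorem nonempty_starAlgEquiv {C D : Type*} [NonUnitalRing C] [StarRing C] [Module ℂ C]
    [NonUnitalRing D] [StarRing D] [Module ℂ D] (S : RokhlinSystem G M)
    (hstar : ∀ x ∈ S.J, star x ∈ S.J) (hclosed : IsClosed (S.J : Set M))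
    {d : ℕ → M} (hd : ∀ i, d i ∈ S.J) (hJ : (S.J : Set M) ⊆ closure (Set.range d))
    {P : C →⋆ₙₐ[ℂ] M} {Q : D →⋆ₙₐ[ℂ] M} (hP : Function.Injective P) (hQ : Function.Injective Q)
    (hPr : ∀ x, x ∈ Set.range P ↔
      x ∈ S.J ∧ ∀ h, (S.rho h : M) * S.act h x * star (S.rho h : M) = x)
    (hQr : ∀ x, x ∈ Set.range Q ↔ x ∈ S.J ∧ ∀ h, S.act h x = x) :
    Nonempty (C ≃⋆ₐ[ℂ] D) := by
  obtain ⟨X, hX⟩ := S.exists_asymptotically_invariant hd hJ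
  have hn : ∀ U : unitary M, ‖star (U : M)‖ ≤ 1 := fun U => by
    rw [norm_star]; exact norm_unitary_le_one U
  refine nonempty_starAlgEquiv_of_conj hP hQ X (fun a => ?_) (fun c => ?_)
  · obtain ⟨hx, hfix⟩ := (hQr _).1 ⟨a, rfl⟩
    obtain ⟨y, hy, hlim⟩ := exists_tendsto_conj hstar hclosed (m := fun k => (X k : M))
      (fun k => norm_unitary_le_one _) (fun x hx => (hX x hx).1) hx
    suffices y ∈ Set.range P by
      obtain ⟨c, rfl⟩ := this
      exact ⟨c, hlim⟩
    refine (hPr y).2 ⟨hy, fun h => ?_⟩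
    have hc := NonUnitalStarAlgHom.instContinuousLinearMapClassComplex.map_continuous (S.act h)
    have h1 := (((hc.tendsto y).comp hlim).const_mul (S.rho h : M)).mul_const (star (S.rho h : M))
    have h2 := tendsto_conj_sub_conj hstar (m := fun k => (X k : M))
      (m' := fun k => (S.shift h (X k) : M)) (fun k => norm_unitary_le_one _)
      (fun k => norm_unitary_le_one _) (fun x hx => ((hX x hx).2.2 h).1) hx
    have h3 := h2.add hlim
    rw [zero_add] at h3
    refine tendsto_nhds_unique h1 (h3.congr fun k => ?_)
    simp only [Function.comp_apply, sub_add_cancel, coe_shift, map_mul, map_star, hfix, star_mul,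
      mul_assoc]
  · obtain ⟨hx, hfix⟩ := (hPr _).1 ⟨c, rfl⟩
    obtain ⟨y, hy, hlim⟩ := exists_tendsto_conj hstar hclosed (m := fun k => star (X k : M))
      (fun k => hn _) (fun x hx => (hX x hx).2.1) hx
    simp only [star_star] at hlim
    suffices y ∈ Set.range Q by
      obtain ⟨c, rfl⟩ := this
      exact ⟨c, hlim⟩
    refine (hQr y).2 ⟨hy, fun h => ?_⟩
    have hc := NonUnitalStarAlgHom.instContinuousLinearMapClassComplex.map_continuous (S.act h)
    have h1 := (hc.tendsto y).comp hlim
    have h2 := tendsto_conj_sub_conj hstar (m := fun k => star (X k : M))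
      (m' := fun k => star (S.shift h (X k) : M)) (fun k => hn _)
      (fun k => hn _) (fun x hx => ((hX x hx).2.2 h).2) hx
    simp only [star_star] at h2
    have h3 := h2.add hlim
    rw [zero_add] at h3
    refine tendsto_nhds_unique h1 (h3.congr fun k => ?_)
    -- Invariance under `Ad ρ_h ∘ α_h`, solved for `α_h(P c)`.
    have h4 : star (S.rho h : M) * (P c * (S.rho h : M)) = S.act h (P c) := by
      conv_lhs => rw [← hfix h]
      simp only [mul_assoc, Unitary.star_mul_self_of_mem (S.rho h).2, mul_one]
      rw [← mul_assoc, Unitary.star_mul_self_of_mem (S.rho h).2, one_mul]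
    simp only [Function.comp_apply, sub_add_cancel, coe_shift, map_mul, map_star, star_mul,
      mul_assoc, ← h4]

end RokhlinSystem

/-! ### Unitaries that are products of exponentials. -/

section SelfAdjointUnitary

variable {M : Type u} [CStarAlgebra M]

/-- For a skew-adjoint unitary `(U - 1)* (U - 1) = 2`, so `‖U - 1‖ < 2` and `U` has a logarithm. -/
theorem mem_expUnitaries_of_star_eq_neg {U : unitary M} (h : star (U : M) = -U) :
    U ∈ expUnitaries M := by
  refine Submonoid.subset_closure ⟨Unitary.argSelfAdjoint U, expUnitary_argSelfAdjoint ?_⟩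
  have h1 : star ((U : M) - 1) * (U - 1) = (2 : ℂ) • 1 := by
    have := Unitary.star_mul_self_of_mem U.2
    rw [star_sub, star_one, sub_mul, mul_sub, mul_sub, this, mul_one, one_mul, one_mul, h, two_smul]
    abel
  have h2 : ‖(U : M) - 1‖ * ‖(U : M) - 1‖ ≤ 2 := by
    rw [← CStarRing.norm_star_mul_self, h1, norm_smul]
    rcases subsingleton_or_nontrivial M with h | h
    · rw [Subsingleton.elim (1 : M) 0, norm_zero, mul_zero]; norm_num
    · simp
  nlinarith [norm_nonneg ((U : M) - 1)]

/-- Write `U = (-i)(i U)`, a product of two skew-adjoint unitaries. -/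
theorem mem_expUnitaries_of_star_eq {U : unitary M} (h : star (U : M) = U) :
    U ∈ expUnitaries M := by
  let T : unitary M := ⟨-Complex.I • 1, by
    rw [Unitary.mem_iff]
    constructor <;> simp [smul_smul]⟩
  let W : unitary M := ⟨Complex.I • U, by
    have h1 := Unitary.star_mul_self_of_mem U.2
    have h2 := Unitary.mul_star_self_of_mem U.2
    rw [Unitary.mem_iff]
    constructor <;> simp [smul_smul, h1, h2]⟩
  have hU : U = T * W := by
    refine Subtype.ext ?_
    change (U : M) = (-Complex.I • 1) * (Complex.I • (U : M))
    simp [smul_smul]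
  rw [hU]
  refine Submonoid.mul_mem _ (mem_expUnitaries_of_star_eq_neg ?_)
    (mem_expUnitaries_of_star_eq_neg ?_)
  · change star (-Complex.I • (1 : M)) = -(-Complex.I • (1 : M))
    simp
  · change star (Complex.I • (U : M)) = -(Complex.I • (U : M))
    simp [h]

end SelfAdjointUnitary

/-! ### Matrix amplification of a Rokhlin system. -/

section Matrices

variable {ι : Type w} [Fintype ι] [DecidableEq ι] {B : Type u} [CStarAlgebra B]

/-- The permutation matrix of `σ`. -/
def permMatrix (B : Type u) [CStarAlgebra B] (σ : Equiv.Perm ι) : CStarMatrix ι ι B :=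
  CStarMatrix.ofMatrix (Matrix.of fun s t => if s = σ t then 1 else 0)

theorem permMatrix_apply (σ : Equiv.Perm ι) (s t : ι) :
    permMatrix B σ s t = if s = σ t then 1 else 0 := rfl

theorem permMatrix_mul_apply (σ : Equiv.Perm ι) (x : CStarMatrix ι ι B) (s t : ι) :
    (permMatrix B σ * x) s t = x (σ.symm s) t := by
  rw [CStarMatrix.mul_apply, Finset.sum_eq_single (σ.symm s)]
  · rw [permMatrix_apply, if_pos (σ.apply_symm_apply s).symm, one_mul]
  · intro u _ hu
    rw [permMatrix_apply, if_neg (fun h => hu (by rw [h, σ.symm_apply_apply])), zero_mul]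
  · intro h; exact absurd (Finset.mem_univ _) h

theorem star_permMatrix (σ : Equiv.Perm ι) : star (permMatrix B σ) = permMatrix B σ⁻¹ := by
  refine CStarMatrix.ext fun s t => ?_
  rw [CStarMatrix.star_apply, permMatrix_apply, permMatrix_apply]
  have : t = σ s ↔ s = σ⁻¹ t := by
    rw [Equiv.Perm.eq_inv_iff_eq, eq_comm]
  by_cases h : t = σ s
  · rw [if_pos h, if_pos (this.1 h), star_one]
  · rw [if_neg h, if_neg (fun h' => h (this.2 h')), star_zero]

theorem permMatrix_mul (σ τ : Equiv.Perm ι) :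
    permMatrix B (σ * τ) = permMatrix B σ * permMatrix B τ := by
  refine CStarMatrix.ext fun s t => ?_
  rw [permMatrix_mul_apply, permMatrix_apply, permMatrix_apply, Equiv.Perm.mul_apply]
  simp only [Equiv.symm_apply_eq]

theorem permMatrix_one : permMatrix B (1 : Equiv.Perm ι) = 1 := by
  refine CStarMatrix.ext fun s t => ?_
  rw [permMatrix_apply, CStarMatrix.one_apply, Equiv.Perm.one_apply]

theorem mul_star_permMatrix_apply (σ : Equiv.Perm ι) (x : CStarMatrix ι ι B) (s t : ι) :
    (x * star (permMatrix B σ)) s t = x s (σ.symm t) := by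
  have h : x * star (permMatrix B σ) = star (permMatrix B σ * star x) := by
    rw [star_mul, star_star]
  rw [h, CStarMatrix.star_apply, permMatrix_mul_apply, CStarMatrix.star_apply, star_star]

variable [PartialOrder B] [StarOrderedRing B]

/-- Permutation matrices, as unitaries. -/
noncomputable def permUnitary (B : Type u) [CStarAlgebra B] [PartialOrder B] [StarOrderedRing B] :
    Equiv.Perm ι →* unitary (CStarMatrix ι ι B) where
  toFun σ := ⟨permMatrix B σ, by
    rw [Unitary.mem_iff, star_permMatrix, ← permMatrix_mul, ← permMatrix_mul, inv_mul_cancel,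
      mul_inv_cancel, permMatrix_one]
    exact ⟨rfl, rfl⟩⟩
  map_one' := Subtype.ext permMatrix_one
  map_mul' σ τ := Subtype.ext (permMatrix_mul σ τ)

theorem coe_permUnitary (σ : Equiv.Perm ι) :
    (permUnitary B σ : CStarMatrix ι ι B) = permMatrix B σ := rfl

/-- Permutations are products of transpositions, whose matrices are self-adjoint. -/
theorem permUnitary_mem (σ : Equiv.Perm ι) :
    permUnitary B σ ∈ expUnitaries (CStarMatrix ι ι B) := by
  induction σ using Equiv.Perm.swap_induction_on with
  | one => rw [map_one]; exact Submonoid.one_mem _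
  | swap_mul f x y _ hf =>
    rw [map_mul]
    refine Submonoid.mul_mem _ (mem_expUnitaries_of_star_eq ?_) hf
    rw [coe_permUnitary, star_permMatrix, Equiv.swap_inv]

/-- A unital `*`-homomorphism applied entrywise to matrices. -/
noncomputable def entrywise {C : Type v} [CStarAlgebra C] [PartialOrder C]
    [StarOrderedRing C] (f : B →⋆ₐ[ℂ] C) : CStarMatrix ι ι B →⋆ₐ[ℂ] CStarMatrix ι ι C where
  toFun x := x.map f
  map_one' := by
    refine CStarMatrix.ext fun s t => ?_
    change f ((1 : CStarMatrix ι ι B) s t) = (1 : CStarMatrix ι ι C) s t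
    rw [CStarMatrix.one_apply, CStarMatrix.one_apply]
    split_ifs <;> simp
  map_zero' := by
    refine CStarMatrix.ext fun s t => map_zero f
  map_add' x y := by
    refine CStarMatrix.ext fun s t => map_add f _ _
  map_mul' x y := by
    refine CStarMatrix.ext fun s t => ?_
    simp only [CStarMatrix.map_apply, CStarMatrix.mul_apply, map_sum, map_mul]
  commutes' c := by
    refine CStarMatrix.ext fun s t => ?_
    change f (algebraMap ℂ (CStarMatrix ι ι B) c s t) = algebraMap ℂ (CStarMatrix ι ι C) c s t
    rw [CStarMatrix.algebraMap_apply, CStarMatrix.algebraMap_apply]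
    split_ifs
    · exact AlgHomClass.commutes f c
    · exact map_zero f
  map_star' x := by
    refine CStarMatrix.ext fun s t => map_star f _

theorem entrywise_apply {C : Type v} [CStarAlgebra C] [PartialOrder C]
    [StarOrderedRing C] (f : B →⋆ₐ[ℂ] C) (x : CStarMatrix ι ι B) (s t : ι) :
    entrywise f x s t = f (x s t) := rfl

/-- Constant diagonal matrices. -/
noncomputable def scalarMatrix (ι : Type w) [Fintype ι] [DecidableEq ι] (B : Type u)
    [CStarAlgebra B] : B →⋆ₙₐ[ℂ] CStarMatrix ι ι B where
  toFun b := CStarMatrix.ofMatrix (Matrix.diagonal fun _ => b)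
  map_smul' c b := by
    refine CStarMatrix.ext fun s t => ?_
    by_cases h : s = t <;> simp [h]
  map_zero' := Matrix.diagonal_zero
  map_add' a b := (Matrix.diagonal_add _ _).symm
  map_mul' a b := (Matrix.diagonal_mul_diagonal _ _).symm
  map_star' b := by
    refine CStarMatrix.ext fun s t => ?_
    by_cases h : s = t
    · simp [h, CStarMatrix.star_apply]
    · simp [h, Ne.symm h, CStarMatrix.star_apply]

theorem scalarMatrix_apply (b : B) (s t : ι) :
    scalarMatrix ι B b s t = if s = t then b else 0 := rfl

theorem scalarMatrix_mul_apply (b : B) (x : CStarMatrix ι ι B) (s t : ι) :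
    (scalarMatrix ι B b * x) s t = b * x s t :=
  Matrix.diagonal_mul (fun _ => b) (CStarMatrix.ofMatrix.symm x) s t

theorem mul_scalarMatrix_apply (b : B) (x : CStarMatrix ι ι B) (s t : ι) :
    (x * scalarMatrix ι B b) s t = x s t * b :=
  Matrix.mul_diagonal (fun _ => b) (CStarMatrix.ofMatrix.symm x) s t

theorem scalarMatrix_one : scalarMatrix ι B 1 = 1 := rfl

theorem entrywise_scalarMatrix {C : Type v} [CStarAlgebra C] [PartialOrder C]
    [StarOrderedRing C] (f : B →⋆ₐ[ℂ] C) (b : B) :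
    entrywise f (scalarMatrix ι B b) = scalarMatrix ι C (f b) := by
  refine CStarMatrix.ext fun s t => ?_
  rw [entrywise_apply, scalarMatrix_apply, scalarMatrix_apply]
  split_ifs
  · rfl
  · exact map_zero f

theorem eta_eq_of_entries {x y : EllInf (CStarMatrix ι ι B)}
    (h : ∀ s t, Tendsto (fun n => x n s t - y n s t) atTop (𝓝 0)) :
    eta (CStarMatrix ι ι B) x = eta (CStarMatrix ι ι B) y := by
  refine eta_eq_iff.2 (tendsto_zero_iff_norm_tendsto_zero.1 ?_)
  exact tendsto_pi_nhds.2 fun s => tendsto_pi_nhds.2 fun t => h s t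

theorem tendsto_of_eta_eq {A : Type u} [NonUnitalCStarAlgebra A] {x y : EllInf A}
    (h : eta A x = eta A y) : Tendsto (fun n => x n - y n) atTop (𝓝 0) :=
  tendsto_zero_iff_norm_tendsto_zero.2 (eta_eq_iff.1 h)

theorem eta_scalarMatrix_mul_eq {z w : EllInf B} {x : CStarMatrix ι ι B}
    (h : ∀ s t, eta B z * constHom B (x s t) = eta B w * constHom B (x s t)) :
    eta (CStarMatrix ι ι B) (EllInf.map (scalarMatrix ι B) z) * constHom (CStarMatrix ι ι B) x =
      eta (CStarMatrix ι ι B) (EllInf.map (scalarMatrix ι B) w) *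
        constHom (CStarMatrix ι ι B) x := by
  refine eta_eq_of_entries (x := EllInf.map (scalarMatrix ι B) z * constSeq _ x)
    (y := EllInf.map (scalarMatrix ι B) w * constSeq _ x) fun s t => ?_
  refine (tendsto_of_eta_eq (x := z * constSeq B (x s t)) (y := w * constSeq B (x s t))
    (h s t)).congr fun n => ?_
  exact congrArg₂ (· - ·) (scalarMatrix_mul_apply _ _ _ _).symm
    (scalarMatrix_mul_apply _ _ _ _).symm

theorem eta_scalarMatrix_comm {z : EllInf B} (h : ∀ b, constHom B b * eta B z = eta B z * constHom B b)
    (x : CStarMatrix ι ι B) :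
    constHom (CStarMatrix ι ι B) x * eta (CStarMatrix ι ι B) (EllInf.map (scalarMatrix ι B) z) =
      eta (CStarMatrix ι ι B) (EllInf.map (scalarMatrix ι B) z) *
        constHom (CStarMatrix ι ι B) x := by
  refine eta_eq_of_entries (x := constSeq _ x * EllInf.map (scalarMatrix ι B) z)
    (y := EllInf.map (scalarMatrix ι B) z * constSeq _ x) fun s t => ?_
  refine (tendsto_of_eta_eq (x := constSeq B (x s t) * z) (y := z * constSeq B (x s t))
    (h (x s t))).congr fun n => ?_
  exact congrArg₂ (· - ·) (mul_scalarMatrix_apply _ _ _ _).symm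
    (scalarMatrix_mul_apply _ _ _ _).symm

end Matrices

namespace RokhlinSystem

variable {G : Type w} [Group G] [Fintype G] [DecidableEq G] {B : Type u} [CStarAlgebra B]
  [PartialOrder B] [StarOrderedRing B] (S : RokhlinSystem G B)

/-- The amplification of a Rokhlin system to `G × G` matrices, with `ρ` the right regular
representation. -/
noncomputable def amplify : RokhlinSystem G (CStarMatrix G G B) where
  act g := entrywise (S.act g)
  act_mul g h x := CStarMatrix.ext fun _ _ => S.act_mul g h _
  act_one x := CStarMatrix.ext fun _ _ => S.act_one _
  -- The inverse is needed because right multiplication reverses products.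
  rho g := permUnitary B (Equiv.mulRight g⁻¹)
  rho_mul g h := by
    rw [← map_mul, ← Equiv.mulRight_mul, mul_inv_rev]
  act_rho g h := by
    refine CStarMatrix.ext fun s t => ?_
    rw [entrywise_apply, coe_permUnitary, permMatrix_apply]
    split_ifs <;> simp
  rho_mem g := permUnitary_mem _
  J := {
    carrier := {x | ∀ s t, x s t ∈ S.J}
    zero_mem' := fun _ _ => S.J.zero_mem
    add_mem' := fun hx hy s t => S.J.add_mem (hx s t) (hy s t) }
  J_mul m x hx s t := by
    rw [CStarMatrix.mul_apply]
    exact S.J.sum_mem fun u _ => S.J_mul _ _ (hx u t)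
  J_act g x hx s t := S.J_act g _ (hx s t)
  e g := EllInf.map (scalarMatrix G B) (S.e g)
  star_e g := by rw [← map_star, S.star_e]
  comm g m := eta_scalarMatrix_comm (S.comm g) m
  mul_self g x hx := by
    rw [← mul_assoc, ← map_mul (eta _), ← map_mul (EllInf.map _)]
    refine eta_scalarMatrix_mul_eq fun s t => ?_
    rw [map_mul, mul_assoc, S.mul_self g _ (hx s t)]
  mul_ne g h hne x hx := by
    rw [← mul_assoc, ← map_mul (eta _), ← map_mul (EllInf.map _)]
    refine (eta_scalarMatrix_mul_eq (w := 0) fun s t => ?_).trans ?_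
    · rw [map_mul, mul_assoc, S.mul_ne g h hne _ (hx s t), map_zero, zero_mul]
    · rw [map_zero, map_zero, zero_mul]
  sum_e x hx := by
    rw [← Finset.sum_mul, ← map_sum (eta _), ← map_sum (EllInf.map _)]
    refine (eta_scalarMatrix_mul_eq (w := constSeq B 1) fun s t => ?_).trans ?_
    · rw [map_sum, Finset.sum_mul, S.sum_e _ (hx s t)]
      change _ = constHom B 1 * constHom B (x s t)
      rw [← map_mul, one_mul]
    · change constHom _ (scalarMatrix G B 1) * constHom _ x = _
      rw [← map_mul, scalarMatrix_one, one_mul]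
  map_e g h x hx := by
    let f : CStarMatrix G G B →⋆ₐ[ℂ] CStarMatrix G G B := entrywise (S.act g)
    have h1 : EllInf.map (f : CStarMatrix G G B →⋆ₙₐ[ℂ] CStarMatrix G G B)
        (EllInf.map (scalarMatrix G B) (S.e h)) =
        EllInf.map (scalarMatrix G B) (EllInf.map (S.act g : B →⋆ₙₐ[ℂ] B) (S.e h)) := by
      ext n : 2
      exact entrywise_scalarMatrix (S.act g) (S.e h n)
    rw [SeqAlg.map_eta, h1]
    exact eta_scalarMatrix_mul_eq fun s t => S.map_e g h _ (hx s t)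

theorem amplify_act_apply (g : G) (x : CStarMatrix G G B) (s t : G) :
    S.amplify.act g x s t = S.act g (x s t) := rfl

/-- Conjugation by `ρ_h` translates both indices on the right. Thus invariance under `Ad ρ_h ∘ α_h`
reads `α_h(x(sh, th)) = x(s, t)`, the relation that describes the image of the regular
representation. -/
theorem amplify_conj_apply (h : G) (x : CStarMatrix G G B) (s t : G) :
    ((S.amplify.rho h : CStarMatrix G G B) * x * star (S.amplify.rho h : CStarMatrix G G B)) s t =
      x (s * h) (t * h) := by
  change (permMatrix B (Equiv.mulRight h⁻¹) * x * star (permMatrix B (Equiv.mulRight h⁻¹))) s t = _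
  rw [mul_star_permMatrix_apply, permMatrix_mul_apply, Equiv.mulRight_symm, inv_inv,
    Equiv.coe_mulRight]

end RokhlinSystem

/-! ### The Rokhlin system of a finite group action. -/

section Unitization

variable {A : Type u} [NonUnitalCStarAlgebra A]

/-- The embedding of `A` into its unitization. -/
noncomputable def inr (A : Type u) [NonUnitalCStarAlgebra A] : A →⋆ₙₐ[ℂ] Unitization ℂ A :=
  Unitization.inrNonUnitalStarAlgHom ℂ A

theorem inr_injective : Function.Injective (inr A) := Unitization.inr_injective

theorem exists_mul_inr (m : Unitization ℂ A) (a : A) : ∃ b, inr A b = m * inr A a := by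
  induction m using Unitization.ind with
  | inl_add_inr l b =>
    refine ⟨l • a + b * a, ?_⟩
    change ((l • a + b * a : A) : Unitization ℂ A) = (Unitization.inl l + (b : Unitization ℂ A)) *
      (a : Unitization ℂ A)
    rw [add_mul, Unitization.inl_mul_inr, ← Unitization.inr_mul, Unitization.inr_add]

theorem mem_range_inr {x : Unitization ℂ A} : x ∈ Set.range (inr A) ↔ x.fst = 0 := by
  constructor
  · rintro ⟨a, rfl⟩; rfl
  · intro h
    refine ⟨x.snd, ?_⟩
    conv_rhs => rw [← Unitization.inl_fst_add_inr_snd_eq x, h, Unitization.inl_zero, zero_add]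
    rfl

theorem isClosed_range_inr : IsClosed (Set.range (inr A)) := by
  have : Set.range (inr A) = {x | x.fst = 0} := Set.ext fun x => mem_range_inr
  rw [this]
  exact isClosed_eq Unitization.continuous_fst continuous_const

theorem constHom_one_mul {B : Type u} [CStarAlgebra B] (y : SeqAlg B) : constHom B 1 * y = y := by
  obtain ⟨z, rfl⟩ := eta_surjective y
  change eta B (constSeq B 1) * eta B z = _
  rw [← map_mul]
  congr 1
  ext n
  exact one_mul _

theorem mul_constHom_one {B : Type u} [CStarAlgebra B] (y : SeqAlg B) : y * constHom B 1 = y := by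
  obtain ⟨z, rfl⟩ := eta_surjective y
  change eta B z * eta B (constSeq B 1) = _
  rw [← map_mul]
  congr 1
  ext n
  exact mul_one _

theorem eta_map_inr_mul (x : EllInf A) (a : A) :
    eta (Unitization ℂ A) (EllInf.map (inr A) x) * constHom (Unitization ℂ A) (inr A a) =
      SeqAlg.map (inr A) (eta A x * constHom A a) := by
  rw [map_mul]; rfl

theorem constHom_mul_eta_map_inr (x : EllInf A) (a : A) :
    constHom (Unitization ℂ A) (inr A a) * eta (Unitization ℂ A) (EllInf.map (inr A) x) =
      SeqAlg.map (inr A) (constHom A a * eta A x) := by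
  rw [map_mul]; rfl

end Unitization

namespace CStarAction

variable {G : Type w} [Group G] [TopologicalSpace G] [IsTopologicalGroup G]
    [CompactSpace G] [T2Space G] [SecondCountableTopology G] [Fintype G] [DecidableEq G]
    {A : Type u} [NonUnitalCStarAlgebra A] {α : CStarAction G A}

/-- The characteristic function of a point of a finite group. -/
noncomputable def pointMass (g : G) : C(G, ℂ) :=
  ⟨fun x => if x = g then 1 else 0, continuous_of_discreteTopology⟩

theorem pointMass_mul_self (g : G) : pointMass g * pointMass g = pointMass g := by
  ext x; simp [pointMass]

theorem pointMass_mul_ne {g h : G} (hgh : g ≠ h) : pointMass g * pointMass h = 0 := by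
  ext x
  by_cases hx : x = g
  · simp [pointMass, hx, hgh]
  · simp [pointMass, hx]

theorem star_pointMass (g : G) : star (pointMass g) = pointMass g := by
  ext x
  by_cases hx : x = g <;> simp [pointMass, hx]

theorem sum_pointMass : ∑ g : G, pointMass g = 1 := by
  ext x; simp [pointMass, ContinuousMap.sum_apply]

theorem leftTranslate_pointMass (g h : G) : leftTranslate g (pointMass h) = pointMass (g * h) := by
  ext x
  simp [leftTranslate, pointMass, inv_mul_eq_iff_eq_mul]

namespace RokhlinLift

variable (F : α.RokhlinLift)

/-- The self-adjoint part of any representative acts on constants as `F(f)`, since `F(f)* a = F(f*)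
a`. Exact self-adjointness of the partition makes the glued logarithms self-adjoint. -/
theorem exists_selfAdjoint_lift (f : C(G, ℂ)) (hf : star f = f) : ∃ x : EllInf A, star x = x ∧
    (∀ a, eta A x * constHom A a = F.toFun f * constHom A a) ∧
    ∀ a, constHom A a * eta A x = eta A x * constHom A a := by
  obtain ⟨y, hy⟩ := eta_surjective (F.toFun f)
  have hc : ∀ a, constHom A a * star (F.toFun f) = star (F.toFun f) * constHom A a := by
    intro a
    have := congrArg star (F.comm f (star a))
    rw [star_mul, star_mul, ← map_star, star_star] at this
    exact this.symm
  refine ⟨(2⁻¹ : ℂ) • (y + star y), ?_, fun a => ?_, fun a => ?_⟩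
  · rw [star_smul, star_add, star_star, add_comm]
    simp
  · have h := F.toFun_star f a
    rw [hf] at h
    rw [map_smul, map_add, map_star, hy, smul_mul_assoc, add_mul, ← h, ← two_smul ℂ, smul_smul]
    norm_num
  · rw [map_smul, map_add, map_star, hy, smul_mul_assoc, add_mul, mul_smul_comm, mul_add, F.comm,
      hc]

/-- Self-adjoint bounded sequences representing the images of the point masses. -/
noncomputable def part (g : G) : EllInf A :=
  (F.exists_selfAdjoint_lift (pointMass g) (star_pointMass g)).choose

theorem star_part (g : G) : star (F.part g) = F.part g :=
  (F.exists_selfAdjoint_lift (pointMass g) (star_pointMass g)).choose_spec.1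

theorem part_mul (g : G) (a : A) :
    eta A (F.part g) * constHom A a = F.toFun (pointMass g) * constHom A a :=
  (F.exists_selfAdjoint_lift (pointMass g) (star_pointMass g)).choose_spec.2.1 a

theorem part_comm (g : G) (a : A) :
    constHom A a * eta A (F.part g) = eta A (F.part g) * constHom A a :=
  (F.exists_selfAdjoint_lift (pointMass g) (star_pointMass g)).choose_spec.2.2 a

theorem part_mul_part (g h : G) (a : A) : eta A (F.part g) * (eta A (F.part h) * constHom A a) =
    F.toFun (pointMass g * pointMass h) * constHom A a := by
  rw [F.part_mul h, ← F.comm, ← mul_assoc, F.part_mul, mul_assoc, F.comm, F.toFun_mul]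

theorem part_mul_self (g : G) (a : A) : eta A (F.part g) * (eta A (F.part g) * constHom A a) =
    eta A (F.part g) * constHom A a := by
  rw [part_mul_part, pointMass_mul_self, part_mul]

theorem part_mul_ne {g h : G} (hgh : g ≠ h) (a : A) :
    eta A (F.part g) * (eta A (F.part h) * constHom A a) = 0 := by
  rw [part_mul_part, pointMass_mul_ne hgh, ← bilin_apply, map_zero, LinearMap.zero_apply]

theorem sum_part_mul (a : A) : ∑ g, eta A (F.part g) * constHom A a = constHom A a := by
  simp_rw [part_mul, ← bilin_apply]
  rw [← LinearMap.sum_apply, ← map_sum, sum_pointMass, bilin_one]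

theorem seqAct_part_mul (g h : G) (a : A) : α.seqAct g (eta A (F.part h)) * constHom A a =
    eta A (F.part (g * h)) * constHom A a := by
  have h1 := congrArg (α.seqAct g) (F.part_mul h (α.act g⁻¹ a))
  rw [map_mul, map_mul, seqAct_constHom, act_act_inv] at h1
  rw [h1, part_mul, ← leftTranslate_pointMass, F.toFun_leftTranslate]

end RokhlinLift

/-- The Rokhlin system on the unitization of `A` defined by a Rokhlin lift. -/
noncomputable def RokhlinLift.system (F : α.RokhlinLift) : RokhlinSystem G (Unitization ℂ A) where
  act g := Unitization.starMap (α.act g)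
  act_mul g h x := by
    have : α.act (g * h) = (α.act g).comp (α.act h) := by
      ext a; exact α.act_mul g h a
    rw [this, Unitization.starMap_comp]
    rfl
  act_one x := by
    have : α.act 1 = NonUnitalStarAlgHom.id ℂ A := by
      ext a; exact α.act_one a
    rw [this, Unitization.starMap_id]
    rfl
  -- The cocycle is trivial here; the one that matters is introduced by the amplification.
  rho _ := 1
  rho_mul _ _ := (mul_one _).symm
  act_rho g _ := map_one _
  rho_mem _ := Submonoid.one_mem _
  J := AddMonoidHom.mrange (inr A : A →+ Unitization ℂ A)
  J_mul := by
    rintro m _ ⟨a, rfl⟩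
    exact exists_mul_inr m a
  J_act := by
    rintro g _ ⟨a, rfl⟩
    exact ⟨α.act g a, (Unitization.starMap_inr _ a).symm⟩
  e g := EllInf.map (inr A) (F.part g)
  star_e g := by rw [← map_star, F.star_part]
  comm g m := by
    induction m using Unitization.ind with
    | inl_add_inr l a =>
      have hl : (Unitization.inl l : Unitization ℂ A) = l • 1 := by
        rw [← Unitization.algebraMap_eq_inl, Algebra.algebraMap_eq_smul_one]
      rw [map_add, add_mul, mul_add, hl, map_smul, smul_mul_assoc, mul_smul_comm, constHom_one_mul,
        mul_constHom_one]
      congr 1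
      refine (constHom_mul_eta_map_inr _ a).trans (Eq.trans ?_ (eta_map_inr_mul _ a).symm)
      rw [F.part_comm]
  mul_self := by
    rintro g x ⟨a, ha⟩
    replace ha : inr A a = x := ha
    rw [← ha, eta_map_inr_mul, ← SeqAlg.map_eta, ← map_mul, F.part_mul_self]
  mul_ne := by
    rintro g h hgh x ⟨a, ha⟩
    replace ha : inr A a = x := ha
    rw [← ha, eta_map_inr_mul, ← SeqAlg.map_eta, ← map_mul, F.part_mul_ne hgh, map_zero]
  sum_e := by
    rintro x ⟨a, ha⟩
    replace ha : inr A a = x := ha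
    subst ha
    simp_rw [eta_map_inr_mul]
    rw [← map_sum, F.sum_part_mul]
    rfl
  map_e := by
    rintro g h x ⟨a, ha⟩
    replace ha : inr A a = x := ha
    subst ha
    have h1 : EllInf.map ((Unitization.starMap (α.act g) : Unitization ℂ A →⋆ₐ[ℂ] Unitization ℂ A) :
        Unitization ℂ A →⋆ₙₐ[ℂ] Unitization ℂ A) (EllInf.map (inr A) (F.part h)) =
        EllInf.map (inr A) (EllInf.map (α.act g) (F.part h)) := by
      ext n : 2
      exact Unitization.starMap_inr (α.act g) _
    rw [SeqAlg.map_eta, h1, eta_map_inr_mul, eta_map_inr_mul, ← F.seqAct_part_mul]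
    rfl

end CStarAction
-- The crossed product as a matrix algebra.
namespace CStarAction

variable {G : Type w} [Group G] [TopologicalSpace G] [IsTopologicalGroup G]
    [CompactSpace G] [T2Space G] [SecondCountableTopology G] [Fintype G] [DecidableEq G]
    {A : Type u} [NonUnitalCStarAlgebra A] {α : CStarAction G A}

theorem system_act_inr (F : α.RokhlinLift) (g : G) (a : A) :
    F.system.act g (inr A a) = inr A (α.act g a) := Unitization.starMap_inr (α.act g) a

/-- The crossed product by a finite group action with the Rokhlin property is a matrix algebra
over the fixed point algebra. -/
theorem HasRokhlinProperty.nonempty_starAlgEquiv [TopologicalSpace.SeparableSpace A]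
    (hα : α.HasRokhlinProperty) :
    Nonempty (α.CrossedProduct ≃⋆ₐ[ℂ] CStarMatrix G G α.fixedPoints) := by
  obtain ⟨F⟩ := hα.nonempty_rokhlinLift
  let := CStarAlgebra.spectralOrder (Unitization ℂ A)
  have := CStarAlgebra.spectralOrderedRing (Unitization ℂ A)
  let S := F.system.amplify
  let P : α.CrossedProduct →⋆ₙₐ[ℂ] CStarMatrix G G (Unitization ℂ A) :=
    (CStarMatrix.mapₙₐ (inr A)).comp CrossedProduct.regularRepHom
  let Q : CStarMatrix G G α.fixedPoints →⋆ₙₐ[ℂ] CStarMatrix G G (Unitization ℂ A) :=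
    CStarMatrix.mapₙₐ ((inr A).comp α.inclusion)
  have hPa : ∀ c s t, P c s t = inr A (α.act s⁻¹ (c.coeff (s * t⁻¹))) := fun _ _ _ => rfl
  have hQa : ∀ d s t, Q d s t = inr A (d s t : A) := fun _ _ _ => rfl
  have hSJ : ∀ x : CStarMatrix G G (Unitization ℂ A),
      x ∈ S.J ↔ ∀ s t, x s t ∈ Set.range (inr A) := fun _ => Iff.rfl
  let f : (G → G → A) → CStarMatrix G G (Unitization ℂ A) :=
    fun m => CStarMatrix.ofMatrix (Matrix.of fun s t => inr A (m s t))
  have hf : Continuous f := by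
    have hinr : Continuous (inr A) := Unitization.continuous_inr
    refine continuous_pi fun s => continuous_pi fun t => ?_
    exact hinr.comp (continuous_apply_apply s t)
  refine S.nonempty_starAlgEquiv (P := P) (Q := Q) (d := fun i => f (TopologicalSpace.denseSeq _ i))
    ?_ ?_ ?_ ?_ ?_ ?_ ?_ ?_
  · intro x hx
    rw [hSJ] at hx ⊢
    intro s t
    obtain ⟨a, ha⟩ := hx t s
    exact ⟨star a, by rw [map_star, ha]; rfl⟩
  · have : (S.J : Set (CStarMatrix G G (Unitization ℂ A))) =
        ⋂ (s : G) (t : G), {m | m s t ∈ Set.range (inr A)} := by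
      ext x
      simp only [Set.mem_iInter]
      exact hSJ x
    rw [this]
    have hc : ∀ s t : G, Continuous fun m : CStarMatrix G G (Unitization ℂ A) => m s t := fun s t =>
      (continuous_apply_apply s t : Continuous fun m : G → G → Unitization ℂ A => m s t)
    exact isClosed_iInter fun s => isClosed_iInter fun t => isClosed_range_inr.preimage (hc s t)
  · intro i s t
    exact ⟨_, rfl⟩
  · intro x hx
    choose m hm using (hSJ x).1 hx
    have hx : x = f m := CStarMatrix.ext fun s t => (hm s t).symm
    rw [hx]
    have h1 := (TopologicalSpace.denseRange_denseSeq (G → G → A)) m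
    have h2 := image_closure_subset_closure_image hf ⟨m, h1, rfl⟩
    rwa [← Set.range_comp] at h2
  · intro x y hxy
    refine CrossedProduct.regularRep_injective (CStarMatrix.ext fun s t => ?_)
    exact inr_injective (congrFun (congrFun hxy s) t)
  · intro x y hxy
    refine CStarMatrix.ext fun s t => Subtype.ext ?_
    exact inr_injective (congrFun (congrFun hxy s) t)
  · intro x
    constructor
    · rintro ⟨c, rfl⟩
      refine ⟨fun s t => ⟨_, (hPa c s t).symm⟩, fun h => CStarMatrix.ext fun s t => ?_⟩
      rw [F.system.amplify_conj_apply, F.system.amplify_act_apply, hPa, hPa, system_act_inr,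
        ← act_mul]
      simp [mul_assoc]
    · rintro ⟨hx, hfix⟩
      choose m hm using (hSJ x).1 hx
      -- The coefficients are read off the row of the identity; invariance at `h = s⁻¹` carries the
      -- entry `(s, t)` to that row.
      refine ⟨⟨fun g => m 1 g⁻¹⟩, CStarMatrix.ext fun s t => ?_⟩
      have h1 := congrArg (fun z : CStarMatrix G G (Unitization ℂ A) => z s t) (hfix s⁻¹)
      simp only [S, F.system.amplify_conj_apply, F.system.amplify_act_apply] at h1
      rw [hPa, ← h1, ← hm, system_act_inr, mul_inv_cancel]
      change inr A (α.act s⁻¹ (m 1 (s * t⁻¹)⁻¹)) = _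
      rw [mul_inv_rev, inv_inv]
  · intro x
    constructor
    · rintro ⟨d, rfl⟩
      refine ⟨fun s t => ⟨_, (hQa d s t).symm⟩, fun h => CStarMatrix.ext fun s t => ?_⟩
      rw [F.system.amplify_act_apply, hQa, system_act_inr]
      exact congrArg (inr A) ((d s t).2 h)
    · rintro ⟨hx, hfix⟩
      choose m hm using (hSJ x).1 hx
      have hmem : ∀ s t, m s t ∈ α.fixedPoints := fun s t h => inr_injective (by
        have h1 := congrArg (fun z : CStarMatrix G G (Unitization ℂ A) => z s t) (hfix h)
        simp only [S, F.system.amplify_act_apply] at h1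
        rw [← system_act_inr F, hm, h1])
      exact ⟨CStarMatrix.ofMatrix (Matrix.of fun s t => ⟨m s t, hmem s t⟩),
        CStarMatrix.ext fun s t => hm s t⟩

end CStarAction

/-! ### Functional calculus and an approximate polar decomposition. -/

section FunctionalCalculus

variable {W : Type u} [CStarAlgebra W]

theorem aeval_mul_of_mul_eq {a y : W} {l : ℝ} (h : a * y = l • y) (q : Polynomial ℝ) :
    Polynomial.aeval a q * y = q.eval l • y := by
  induction q using Polynomial.induction_on' with
  | add p q hp hq => rw [map_add, add_mul, hp, hq, Polynomial.eval_add, add_smul]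
  | monomial n c =>
    have hn : a ^ n * y = l ^ n • y := by
      induction n with
      | zero => simp
      | succ n ih => rw [pow_succ, mul_assoc, h, mul_smul_comm, ih, smul_smul, pow_succ']
    rw [Polynomial.aeval_monomial, Polynomial.eval_monomial, mul_assoc, hn,
      Algebra.algebraMap_eq_smul_one, smul_mul_assoc, one_mul, smul_smul]

/-- The continuous functional calculus acts on eigenvectors as expected. -/
theorem cfc_mul_of_mul_eq {a y : W} (ha : IsSelfAdjoint a) {l : ℝ} (h : a * y = l • y)
    {f : ℝ → ℝ} (hf : Continuous f) : cfc f a * y = f l • y := by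
  rw [← sub_eq_zero, ← norm_eq_zero]
  refine le_antisymm (le_of_forall_pos_le_add fun ε hε => ?_) (norm_nonneg _)
  -- The interval `[-R, R]` contains the spectrum of `a` as well as the eigenvalue `l`.
  set R := max (‖a‖ * ‖(1 : W)‖) |l|
  obtain ⟨q, hq⟩ := exists_polynomial_near_of_continuousOn (-R) R f hf.continuousOn
    (ε / (2 * (‖y‖ + 1))) (by positivity)
  have h1 : ‖cfc f a - Polynomial.aeval a q‖ ≤ ε / (2 * (‖y‖ + 1)) := by
    rw [← cfc_polynomial q a, ← cfc_sub f q.eval a (hf.continuousOn) (q.continuous.continuousOn)]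
    refine norm_cfc_le (by positivity) fun x hx => ?_
    rw [norm_sub_rev]
    refine (hq x ?_).le
    have := (spectrum.norm_le_norm_mul_of_mem hx).trans (le_max_left _ |l|)
    rw [Real.norm_eq_abs, abs_le] at this
    exact this
  have h2 : ‖q.eval l • y - f l • y‖ ≤ ε / (2 * (‖y‖ + 1)) * ‖y‖ := by
    rw [← sub_smul, norm_smul]
    refine mul_le_mul_of_nonneg_right (hq l ?_).le (norm_nonneg _)
    exact abs_le.1 (le_max_right _ _)
  calc ‖cfc f a * y - f l • y‖
      = ‖(cfc f a - Polynomial.aeval a q) * y + (q.eval l • y - f l • y)‖ := by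
        rw [sub_mul, aeval_mul_of_mul_eq h, sub_add_sub_cancel]
    _ ≤ ε / (2 * (‖y‖ + 1)) * ‖y‖ + ε / (2 * (‖y‖ + 1)) * ‖y‖ :=
        (norm_add_le _ _).trans (add_le_add ((norm_mul_le _ _).trans
          (mul_le_mul_of_nonneg_right h1 (norm_nonneg _))) h2)
    _ = ε * (‖y‖ / (‖y‖ + 1)) := by field_simp; ring
    _ ≤ 0 + ε := by
        rw [zero_add]
        refine mul_le_of_le_one_right hε.le ?_
        rw [div_le_one (by positivity)]
        linarith

theorem cfc_mul_mul_cfc {h : W} (hh : IsSelfAdjoint h) {s : ℝ → ℝ} (hs : Continuous s) :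
    cfc s h * h * cfc s h = cfc (fun t => s t * t * s t) h := by
  have : cfc (fun t : ℝ => t) h = h := cfc_id' ℝ h
  rw [cfc_mul (fun t => s t * t) s h (by fun_prop) (by fun_prop),
    cfc_mul s (fun t => t) h (by fun_prop) (by fun_prop), this]

variable [PartialOrder W] [StarOrderedRing W]

/-- By the C*-identity the left side is `‖s(h) z² s(h)‖`, and `z² ≤ h` bounds it by `‖s(h) h s(h)‖`.
-/
theorem norm_cfc_mul_sq_le {h z : W} (hz : IsSelfAdjoint z) (hh : IsSelfAdjoint h) (hzh : z * z ≤ h)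
    {s : ℝ → ℝ} (hs : Continuous s) {C : ℝ} (hC : ∀ t ∈ spectrum ℝ h, |s t * t * s t| ≤ C) (hC0 : 0 ≤ C) :
    ‖cfc s h * z‖ * ‖cfc s h * z‖ ≤ C := by
  have hsa : IsSelfAdjoint (cfc s h) := cfc_predicate s h
  have h0 : cfc s h * z * star (cfc s h * z) = cfc s h * (z * z) * cfc s h := by
    rw [star_mul, hz.star_eq, hsa.star_eq]
    simp only [mul_assoc]
  have h1 : cfc s h * (z * z) * cfc s h ≤ cfc s h * h * cfc s h := by
    have := star_left_conjugate_le_conjugate hzh (cfc s h)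
    rwa [hsa.star_eq] at this
  rw [← CStarRing.norm_self_mul_star, h0]
  refine (CStarAlgebra.norm_le_norm_of_nonneg_of_le ?_ h1).trans ?_
  · rw [← h0]; exact mul_star_self_nonneg _
  · rw [cfc_mul_mul_cfc hh hs]
    exact norm_cfc_le hC0 hC

/-- With `h = x* x`, the elements `x k(h) z` and `h^{1/2} k(h) z` have the same norm; the previous
estimate with `s(t) = √t k(t)` applies. -/
theorem norm_mul_cfc_mul_le {x z : W} (hz : IsSelfAdjoint z) (hzx : z * z ≤ star x * x)
    {k : ℝ → ℝ} (hk : Continuous k) {C : ℝ} (hC0 : 0 ≤ C) (hC : ∀ t, 0 ≤ t → |t * k t| ≤ C) :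
    ‖x * cfc k (star x * x) * z‖ ≤ C := by
  set h := star x * x with hh
  have hsa : IsSelfAdjoint h := IsSelfAdjoint.star_mul_self x
  have hpos : ∀ t ∈ spectrum ℝ h, 0 ≤ t := fun t ht =>
    spectrum_nonneg_of_nonneg (star_mul_self_nonneg x) ht
  have hksa : IsSelfAdjoint (cfc k h) := cfc_predicate k h
  set j : ℝ → ℝ := fun t => √t * k t
  have hj : Continuous j := by fun_prop
  have hjsa : IsSelfAdjoint (cfc j h) := cfc_predicate j h
  have h1 : cfc k h * h * cfc k h = cfc j h * cfc j h := by
    rw [← cfc_mul j j h (by fun_prop) (by fun_prop), cfc_mul_mul_cfc hsa hk]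
    refine cfc_congr fun t ht => ?_
    have := Real.mul_self_sqrt (hpos t ht)
    simp only [j]
    linear_combination -(k t * k t) * this
  have h2 : ‖x * cfc k h * z‖ * ‖x * cfc k h * z‖ = ‖cfc j h * z‖ * ‖cfc j h * z‖ := by
    rw [← CStarRing.norm_star_mul_self, ← CStarRing.norm_star_mul_self (x := cfc j h * z)]
    congr 1
    simp only [star_mul, hksa.star_eq, hjsa.star_eq, hz.star_eq]
    calc z * (cfc k h * star x) * (x * cfc k h * z) = z * (cfc k h * h * cfc k h) * z := by
          rw [hh]; simp only [mul_assoc]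
      _ = _ := by rw [h1]; simp only [mul_assoc]
  refine (mul_self_le_mul_self_iff (norm_nonneg _) hC0).2 ?_
  rw [h2]
  refine norm_cfc_mul_sq_le hz hsa hzx hj (fun t ht => ?_) (mul_self_nonneg _)
  have h3 := hC t (hpos t ht)
  have h4 : j t * t * j t = (t * k t) * (t * k t) := by
    have := Real.mul_self_sqrt (hpos t ht)
    simp only [j]
    linear_combination (k t * k t * t) * this
  rw [h4, abs_mul]
  exact mul_self_le_mul_self (abs_nonneg _) h3

/-- If `z² ≤ x* x`, then `z² = V* V` for the limit `V` of `x (x* x + ε)^{-1/2} z`. -/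
theorem exists_star_mul_self_eq {x z : W} (hz : IsSelfAdjoint z) (hzx : z * z ≤ star x * x) :
    ∃ V : W, star V * V = z * z ∧ V ∈ closure (Set.range fun m => x * m) ∧
      ∀ {W' : Type u} [CStarAlgebra W'] (Φ : W →⋆ₐ[ℂ] W') (y : W') (l : ℝ), 0 < l →
        Φ (star x * x) * y = l • y → Φ z * y = y → Φ V * y = (√l)⁻¹ • (Φ x * y) := by
  set h := star x * x with hh
  have hsa : IsSelfAdjoint h := IsSelfAdjoint.star_mul_self x
  have hpos : ∀ t ∈ spectrum ℝ h, 0 ≤ t := fun t ht =>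
    spectrum_nonneg_of_nonneg (star_mul_self_nonneg x) ht
  -- Regularized inverse square roots. The regularization `4^{-m}` makes `t k_m(t)` approach `√t`
  -- within `2^{-m}`, uniformly in `t ≥ 0`, which yields a geometric Cauchy bound.
  let k : ℕ → ℝ → ℝ := fun m t => (√(max t 0 + (1 / 4) ^ m))⁻¹
  have hden : ∀ (m : ℕ) (t : ℝ), 0 < max t 0 + (1 / 4 : ℝ) ^ m := fun m t => by positivity
  have hk : ∀ m, Continuous (k m) := fun m => by
    refine Continuous.inv₀ (by fun_prop) fun t => ?_
    exact (Real.sqrt_pos.2 (hden m t)).ne'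
  have hroot : ∀ (m : ℕ) (t : ℝ), 0 ≤ t → |√t - t * k m t| ≤ (1 / 2) ^ m := by
    intro m t ht
    simp only [k, max_eq_left ht]
    have h4 : (1 / 4 : ℝ) ^ m = (1 / 2) ^ m * (1 / 2) ^ m := by
      rw [← mul_pow]; norm_num
    rw [h4]
    set e := (1 / 2 : ℝ) ^ m
    have he : 0 < e := by positivity
    set r := √(t + e * e)
    have hr : r * r = t + e * e := Real.mul_self_sqrt (by positivity)
    have hr0 : 0 < r := Real.sqrt_pos.2 (by positivity)
    have hq : √t * √t = t := Real.mul_self_sqrt ht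
    have hq0 : 0 ≤ √t := Real.sqrt_nonneg t
    have hqr : √t ≤ r := Real.sqrt_le_sqrt (by nlinarith)
    have hre : r ≤ √t + e := by nlinarith
    have h5 : √t - t * r⁻¹ = √t * (r - √t) / r := by
      field_simp
      linear_combination hq
    rw [h5, abs_of_nonneg (by have := sub_nonneg.2 hqr; positivity), div_le_iff₀ hr0]
    nlinarith
  let V : ℕ → W := fun m => x * cfc (k m) h * z
  have hcauchy : CauchySeq V := by
    refine cauchySeq_of_le_geometric (1 / 2) 2 (by norm_num) fun m => ?_
    have h1 : V m - V (m + 1) = x * cfc (fun t => k m t - k (m + 1) t) h * z := by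
      rw [cfc_sub (k m) (k (m + 1)) h ((hk _).continuousOn) ((hk _).continuousOn), mul_sub, sub_mul]
    rw [dist_eq_norm, h1]
    refine norm_mul_cfc_mul_le hz hzx ((hk m).sub (hk (m + 1))) (by positivity) fun t ht => ?_
    have h2 := hroot m t ht
    have h3 := hroot (m + 1) t ht
    have h4 : (1 / 2 : ℝ) ^ (m + 1) ≤ (1 / 2) ^ m :=
      pow_le_pow_of_le_one (by norm_num) (by norm_num) (Nat.le_succ m)
    rw [abs_le] at h2 h3 ⊢
    have h5 : t * (k m - k (m + 1)) t = t * k m t - t * k (m + 1) t := mul_sub _ _ _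
    rw [h5]
    constructor <;> linarith
  obtain ⟨V₀, hV₀⟩ := cauchySeq_tendsto_of_complete hcauchy
  refine ⟨V₀, ?_, ?_, ?_⟩
  · have h1 : Tendsto (fun m => star (V m) * V m) atTop (𝓝 (star V₀ * V₀)) := hV₀.star.mul hV₀
    refine tendsto_nhds_unique h1 ?_
    rw [tendsto_iff_norm_sub_tendsto_zero]
    refine squeeze_zero (fun _ => norm_nonneg _) (fun m => ?_)
      (tendsto_pow_atTop_nhds_zero_of_lt_one (r := (1 / 4 : ℝ)) (by norm_num) (by norm_num))
    -- The defect `z² - V_m* V_m` is the square of `s(h) z`, and `t s(t)² ≤ 4^{-m}` on the spectrum.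
    let s : ℝ → ℝ := fun t => √(1 - k m t * t * k m t)
    have hkm := hk m
    have hs : Continuous s := by fun_prop
    have hssa : IsSelfAdjoint (cfc s h) := cfc_predicate s h
    have hksa : IsSelfAdjoint (cfc (k m) h) := cfc_predicate _ h
    have hkk : ∀ t, 0 ≤ t → k m t * k m t * (t + (1 / 4) ^ m) = 1 := by
      intro t ht
      have h3 := hden m t
      have h2 := Real.mul_self_sqrt h3.le
      have h4 := (Real.sqrt_pos.2 h3).ne'
      simp only [k, max_eq_left ht] at h2 h4 ⊢
      field_simp
      linear_combination -h2
    have hss : ∀ t, 0 ≤ t → s t * s t = 1 - k m t * t * k m t := by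
      intro t ht
      refine Real.mul_self_sqrt ?_
      have h2 := hkk t ht
      have h3 : 0 ≤ k m t * k m t * (1 / 4) ^ m := mul_nonneg (mul_self_nonneg _) (by positivity)
      linarith
    have h2 : star (V m) * V m - z * z = -(star (cfc s h * z) * (cfc s h * z)) := by
      have h3 : cfc s h * cfc s h = 1 - cfc (k m) h * h * cfc (k m) h := by
        rw [← cfc_mul s s h (by fun_prop) (by fun_prop), ← cfc_one ℝ h, cfc_mul_mul_cfc hsa hkm,
          ← cfc_sub _ _ h (by fun_prop) (by fun_prop)]
        exact cfc_congr fun t ht => hss t (hpos t ht)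
      have h4 : star (V m) * V m = z * (cfc (k m) h * h * cfc (k m) h) * z := by
        calc star (V m) * V m = z * (cfc (k m) h * star x) * (x * cfc (k m) h * z) := by
              simp only [V, star_mul, hksa.star_eq, hz.star_eq]
          _ = _ := by rw [hh]; simp only [mul_assoc]
      have h5 : star (cfc s h * z) * (cfc s h * z) = z * (cfc s h * cfc s h) * z := by
        simp only [star_mul, hssa.star_eq, hz.star_eq, mul_assoc]
      rw [h4, h5, h3]
      noncomm_ring
    rw [h2, norm_neg, CStarRing.norm_star_mul_self]
    refine norm_cfc_mul_sq_le hz hsa hzx hs (fun t ht => ?_) (by positivity)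
    have h0 := hpos t ht
    have h3 : s t * t * s t = (t * k m t) * (t * k m t) * 0 + t * (1 - k m t * t * k m t) := by
      linear_combination t * hss t h0
    have h4 : s t * t * s t ≤ (1 / 4) ^ m := by
      have h5 := hkk t h0
      have h6 : 0 ≤ k m t * k m t * ((1 / 4) ^ m * (1 / 4) ^ m) :=
        mul_nonneg (mul_self_nonneg _) (by positivity)
      have h7 : s t * t * s t = (1 / 4) ^ m - k m t * k m t * ((1 / 4) ^ m * (1 / 4) ^ m) := by
        linear_combination h3 - (t - (1 / 4) ^ m) * h5
      linarith
    rw [abs_of_nonneg]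
    · exact h4
    · rw [mul_right_comm]
      exact mul_nonneg (mul_self_nonneg _) h0
  · exact mem_closure_of_tendsto hV₀ (.of_forall fun m => ⟨cfc (k m) h * z, (mul_assoc _ _ _).symm⟩)
  · intro W' _ Φ y l hl hy hzy
    have hΦ : Continuous Φ := NonUnitalStarAlgHom.instContinuousLinearMapClassComplex.map_continuous Φ
    have h1 : ∀ m, Φ (V m) * y = k m l • (Φ x * y) := by
      intro m
      have h2 : Φ (cfc (k m) h) = cfc (k m) (Φ h) :=
        StarAlgHomClass.map_cfc (R := ℝ) Φ (k m) h ((hk m).continuousOn) hΦ hsa (hsa.map Φ)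
      rw [map_mul, map_mul, mul_assoc, hzy, h2, mul_assoc, cfc_mul_of_mul_eq (hsa.map Φ) hy (hk m),
        mul_smul_comm]
    have h2 : Tendsto (fun m => k m l) atTop (𝓝 (√l)⁻¹) := by
      refine Tendsto.inv₀ ?_ (Real.sqrt_pos.2 hl).ne'
      refine (Real.continuous_sqrt.tendsto l).comp ?_
      rw [max_eq_left hl.le]
      simpa using (tendsto_pow_atTop_nhds_zero_of_lt_one (r := (1 / 4 : ℝ)) (by norm_num)
        (by norm_num)).const_add l
    exact tendsto_nhds_unique (((hΦ.tendsto V₀).comp hV₀).mul_const y)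
      ((h2.smul_const (Φ x * y)).congr fun m => (h1 m).symm)

end FunctionalCalculus

/-! ### Matrix units and columns in the sequence algebra. -/

section UnitMatrix

variable {ι : Type w} [Fintype ι] [DecidableEq ι] {D : Type u} [NonUnitalCStarAlgebra D]

/-- The matrix with a single possibly non-zero entry. -/
def unitMatrix (i j : ι) (d : D) : CStarMatrix ι ι D := CStarMatrix.ofMatrix (Matrix.single i j d)

theorem unitMatrix_mul (i j k : ι) (a b : D) :
    unitMatrix i j a * unitMatrix j k b = unitMatrix i k (a * b) :=
  Matrix.single_mul_single_same a i j k b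

theorem unitMatrix_mul_ne (i : ι) {j k : ι} (h : j ≠ k) (l : ι) (a b : D) :
    unitMatrix i j a * unitMatrix k l b = 0 :=
  Matrix.single_mul_single_of_ne a i j k h b

theorem star_unitMatrix (i j : ι) (a : D) : star (unitMatrix i j a) = unitMatrix j i (star a) :=
  Matrix.conjTranspose_single i j a

theorem unitMatrix_sub (i j : ι) (a b : D) :
    unitMatrix i j (a - b) = unitMatrix i j a - unitMatrix i j b := by
  refine CStarMatrix.ext fun s t => ?_
  change Matrix.single i j (a - b) s t = Matrix.single i j a s t - Matrix.single i j b s t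
  simp only [Matrix.single_apply]
  split_ifs <;> simp

theorem eq_sum_unitMatrix (m : CStarMatrix ι ι D) : m = ∑ i, ∑ j, unitMatrix i j (m i j) :=
  Matrix.matrix_eq_sum_single m

/-- The embedding of an algebra as a corner of a matrix algebra. -/
def cornerHom (D : Type u) [NonUnitalCStarAlgebra D] (o : ι) : D →⋆ₙₐ[ℂ] CStarMatrix ι ι D where
  toFun := unitMatrix o o
  map_smul' c a := (Matrix.smul_single c o o a).symm
  map_zero' := Matrix.single_zero o o
  map_add' a b := Matrix.single_add o o a b
  map_mul' a b := (unitMatrix_mul o o o a b).symm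
  map_star' a := (star_unitMatrix o o a).symm

variable {T : Type v} [NonUnitalCStarAlgebra T] (ψ : CStarMatrix ι ι D →⋆ₙₐ[ℂ] T)

/-- The C*-identity in the target reduces this to a diagonal corner, on which `ψ` is a homomorphism
of C*-algebras. No norm on the matrix algebra is used. -/
theorem norm_map_unitMatrix_le (i j : ι) (d : D) : ‖ψ (unitMatrix i j d)‖ ≤ ‖d‖ := by
  refine (mul_self_le_mul_self_iff (norm_nonneg _) (norm_nonneg _)).2 ?_
  rw [← CStarRing.norm_star_mul_self, ← map_star, ← map_mul, star_unitMatrix, unitMatrix_mul,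
    ← CStarRing.norm_star_mul_self]
  exact NonUnitalStarAlgHom.norm_apply_le (ψ.comp (cornerHom D j)) (star d * d)

theorem tendsto_map_unitMatrix (i j : ι) {d : ℕ → D} {a : D} (h : Tendsto d atTop (𝓝 a)) :
    Tendsto (fun n => ψ (unitMatrix i j (d n))) atTop (𝓝 (ψ (unitMatrix i j a))) := by
  rw [tendsto_iff_norm_sub_tendsto_zero] at h ⊢
  refine squeeze_zero (fun _ => norm_nonneg _) (fun n => ?_) h
  rw [← map_sub, ← unitMatrix_sub]
  exact norm_map_unitMatrix_le ψ i j _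

end UnitMatrix

section Column

variable {B : Type v} [NonUnitalCStarAlgebra B]

theorem eventually_eventually_lt {z : ℕ → EllInf B}
    (h : Tendsto (fun m => eta B (z m)) atTop (𝓝 0)) {ε : ℝ} (hε : 0 < ε) :
    ∀ᶠ m in atTop, ∀ᶠ n in atTop, ‖z m n‖ < ε := by
  filter_upwards [(tendsto_order.1 (tendsto_zero_iff_norm_tendsto_zero.1 h)).2 ε hε] with m hm
  exact eventually_norm_lt_of_norm_eta_lt hm

theorem eta_eq_zero_of_eventually {z : EllInf B} (h : ∀ ε > 0, ∀ᶠ n in atTop, ‖z n‖ < ε) :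
    eta B z = 0 :=
  eta_eq_zero_iff.2 (tendsto_order.2 ⟨fun _ ha => .of_forall fun _ => ha.trans_le (norm_nonneg _), h⟩)

variable {ι : Type w} [Fintype ι] [DecidableEq ι] {D : Type u} [NonUnitalCStarAlgebra D]
  [TopologicalSpace.SeparableSpace D]

/-- A `*`-homomorphism from a matrix algebra to a sequence algebra is implemented by a column of
elements which behave as matrix units on the image of a corner. -/
theorem exists_column (o : ι) (ψ : CStarMatrix ι ι D →⋆ₙₐ[ℂ] SeqAlg B) :
    ∃ E : ι → EllInf B,
      (∀ i d, eta B (E i) * ψ (unitMatrix o o d) = ψ (unitMatrix i o d)) ∧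
      (∀ i j, i ≠ j → star (eta B (E i)) * eta B (E j) = 0) ∧
      (∀ i, star (eta B (E i)) * eta B (E i) = star (eta B (E o)) * eta B (E o)) ∧
      ∀ d, star (eta B (E o)) * eta B (E o) * ψ (unitMatrix o o d) = ψ (unitMatrix o o d) := by
  obtain ⟨h, hn, hs, hh⟩ := exists_seq_approximateUnit D
  -- The approximate unit `h_m` stands in for the missing unit of `D`. The Gram relations `Z2` hold
  -- exactly in `B_∞` for each `m`; those in `Z1` and `Z3` hold as `m → ∞`, and reindexing collects
  -- them in one column.
  choose y hy hyn using fun (i : ι) (m : ℕ) => exists_lift_norm_le (ψ (unitMatrix i o (h m)))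
  choose w hw using fun (i : ι) (d : D) => eta_surjective (ψ (unitMatrix i o d))
  let q := TopologicalSpace.denseSeq D
  let Z1 : ι × ℕ → ℕ → EllInf B := fun p m => y p.1 m * w o (q p.2) - w p.1 (q p.2)
  let Z2 : ι × ι → ℕ → EllInf B := fun p m => if p.1 = p.2 then
    star (y p.1 m) * y p.1 m - star (y o m) * y o m else star (y p.1 m) * y p.2 m
  let Z3 : ℕ → ℕ → EllInf B := fun k m => star (y o m) * w o (q k) - w o (q k)
  have key : ∀ i d, Tendsto (fun m => ψ (unitMatrix i o (h m)) * ψ (unitMatrix o o d) -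
      ψ (unitMatrix i o d)) atTop (𝓝 0) := by
    intro i d
    have h1 := (tendsto_map_unitMatrix ψ i o ((hh d).1)).sub_const (ψ (unitMatrix i o d))
    rw [sub_self] at h1
    refine h1.congr fun m => ?_
    rw [← map_mul, unitMatrix_mul]
  have hy2 : ∀ i j m, eta B (star (y i m) * y j m) =
      ψ (unitMatrix o i (h m) * unitMatrix j o (h m)) := by
    intro i j m
    rw [map_mul, map_star, hy, hy, ← map_star, star_unitMatrix, hs, map_mul]
  have hZ1 : ∀ p, Tendsto (fun m => eta B (Z1 p m)) atTop (𝓝 0) := by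
    intro p
    refine (key p.1 (q p.2)).congr fun m => ?_
    rw [map_sub, map_mul, hy, hw, hw]
  have hZ2 : ∀ p, Tendsto (fun m => eta B (Z2 p m)) atTop (𝓝 0) := by
    intro p
    refine tendsto_const_nhds.congr fun m => ?_
    by_cases hp : p.1 = p.2
    · simp only [Z2, if_pos hp, map_sub, hy2]
      rw [unitMatrix_mul, unitMatrix_mul, sub_self]
    · simp only [Z2, if_neg hp, hy2]
      rw [unitMatrix_mul_ne o hp, map_zero]
  have hZ3 : ∀ k, Tendsto (fun m => eta B (Z3 k m)) atTop (𝓝 0) := by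
    intro k
    refine (key o (q k)).congr fun m => ?_
    rw [map_sub, map_mul, map_star, hy, hw, ← map_star, star_unitMatrix, hs]
  obtain ⟨m, hm⟩ := exists_reindexing (ι := (ι × ℕ) ⊕ (ι × ι) ⊕ ℕ)
    (Sum.elim (fun p m n => ‖Z1 p m n‖) (Sum.elim (fun p m n => ‖Z2 p m n‖) fun k m n => ‖Z3 k m n‖))
    (by
      rintro (p | p | k) ε hε
      · exact eventually_eventually_lt (hZ1 p) hε
      · exact eventually_eventually_lt (hZ2 p) hε
      · exact eventually_eventually_lt (hZ3 k) hε)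
  let E : ι → EllInf B := fun i => EllInf.mk (fun n => y i (m n) n) (1 + 1) fun n =>
    (norm_apply_le _ n).trans ((hyn i (m n)).trans (add_le_add_left
      ((norm_map_unitMatrix_le ψ i o _).trans (hn _)) 1))
  have h1 : ∀ i k, eta B (E i) * ψ (unitMatrix o o (q k)) = ψ (unitMatrix i o (q k)) := by
    intro i k
    rw [← hw o, ← hw i, ← sub_eq_zero, ← map_mul, ← map_sub]
    exact eta_eq_zero_of_eventually (hm (Sum.inl (i, k)))
  have h2 : ∀ i j, i ≠ j → star (eta B (E i)) * eta B (E j) = 0 := by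
    intro i j hij
    rw [← map_star, ← map_mul]
    refine eta_eq_zero_of_eventually fun ε hε => ?_
    have := hm (Sum.inr (Sum.inl (i, j))) ε hε
    simp only [Sum.elim_inr, Sum.elim_inl, Z2, if_neg hij] at this
    exact this
  have h3 : ∀ i, star (eta B (E i)) * eta B (E i) = star (eta B (E o)) * eta B (E o) := by
    intro i
    rw [← sub_eq_zero, ← map_star, ← map_star, ← map_mul, ← map_mul, ← map_sub]
    refine eta_eq_zero_of_eventually fun ε hε => ?_
    have := hm (Sum.inr (Sum.inl (i, i))) ε hε
    simp only [Sum.elim_inr, Sum.elim_inl, Z2, if_true] at this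
    exact this
  have h4 : ∀ k, star (eta B (E o)) * ψ (unitMatrix o o (q k)) = ψ (unitMatrix o o (q k)) := by
    intro k
    rw [← hw o, ← sub_eq_zero, ← map_star, ← map_mul, ← map_sub]
    exact eta_eq_zero_of_eventually (hm (Sum.inr (Sum.inr k)))
  have hcont : ∀ i, Continuous fun d : D => ψ (unitMatrix i o d) := fun i =>
    continuous_iff_seqContinuous.2 fun x a hx => tendsto_map_unitMatrix ψ i o hx
  have h1' : ∀ i d, eta B (E i) * ψ (unitMatrix o o d) = ψ (unitMatrix i o d) := fun i d =>
    congrFun ((TopologicalSpace.denseRange_denseSeq D).equalizer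
      (continuous_const.mul (hcont o)) (hcont i) (funext fun k => h1 i k)) d
  have h4' : ∀ d, star (eta B (E o)) * ψ (unitMatrix o o d) = ψ (unitMatrix o o d) := fun d =>
    congrFun ((TopologicalSpace.denseRange_denseSeq D).equalizer
      (continuous_const.mul (hcont o)) (hcont o) (funext fun k => h4 k)) d
  refine ⟨E, h1', h2, h3, fun d => ?_⟩
  rw [mul_assoc, h1', h4']

end Column

/-! ### Making a column exactly orthogonal. -/

section ExactColumn

theorem scalarMatrix_algebraMap {ι : Type w} [Fintype ι] [DecidableEq ι] {U : Type u} [CStarAlgebra U]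
    [PartialOrder U] [StarOrderedRing U] (r : ℝ) :
    scalarMatrix ι U (algebraMap ℝ U r) = algebraMap ℝ (CStarMatrix ι ι U) r := by
  rw [IsScalarTower.algebraMap_apply ℝ ℂ U, IsScalarTower.algebraMap_apply ℝ ℂ (CStarMatrix ι ι U),
    Algebra.algebraMap_eq_smul_one (A := U), map_smul, scalarMatrix_one,
    Algebra.algebraMap_eq_smul_one (A := CStarMatrix ι ι U)]

theorem inv_two_smul_add_self {W : Type u} [CStarAlgebra W] (a : W) : (2 : ℝ)⁻¹ • (a + a) = a := by
  rw [← two_smul ℝ a, smul_smul, inv_mul_cancel₀ two_ne_zero, one_smul]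

/-- A piecewise linear function vanishing for `t ≤ c / 4` and equal to one for `t ≥ (c + 1) / 4`. -/
noncomputable def ramp (c t : ℝ) : ℝ := max 0 (min 1 (4 * t - c))

theorem continuous_ramp (c : ℝ) : Continuous (ramp c) := by
  unfold ramp; fun_prop

theorem ramp_eq_zero {c t : ℝ} (h : 4 * t ≤ c) : ramp c t = 0 :=
  max_eq_left ((min_le_right _ _).trans (by linarith))

theorem ramp_eq_one {c t : ℝ} (h : c + 1 ≤ 4 * t) : ramp c t = 1 := by
  rw [ramp, min_eq_left (by linarith), max_eq_right zero_le_one]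

variable {ι : Type w} [Fintype ι] [DecidableEq ι] {U U' : Type u} [CStarAlgebra U]
  [CStarAlgebra U'] [PartialOrder U] [StarOrderedRing U] [PartialOrder U'] [StarOrderedRing U']

/-- The matrix whose only non-zero row is the given one. -/
def rowMatrix (o : ι) (ε : ι → U) : CStarMatrix ι ι U :=
  CStarMatrix.ofMatrix (Matrix.of fun s t => if s = o then ε t else 0)

theorem rowMatrix_apply (o : ι) (ε : ι → U) (s t : ι) :
    rowMatrix o ε s t = if s = o then ε t else 0 := rfl

theorem star_mul_self_apply_of_row {o : ι} {V : CStarMatrix ι ι U} (hV : ∀ s t, s ≠ o → V s t = 0)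
    (s t : ι) : (star V * V) s t = star (V o s) * V o t := by
  rw [CStarMatrix.mul_apply, Finset.sum_eq_single o]
  · rw [CStarMatrix.star_apply]
  · intro u _ hu
    rw [hV u t hu, mul_zero]
  · intro h; exact absurd (Finset.mem_univ _) h

theorem star_rowMatrix_mul_self_apply (o : ι) (ε : ι → U) (s t : ι) :
    (star (rowMatrix o ε) * rowMatrix o ε) s t = star (ε s) * ε t := by
  rw [star_mul_self_apply_of_row (o := o) (fun s t h => by rw [rowMatrix_apply, if_neg h]),
    rowMatrix_apply, rowMatrix_apply, if_pos rfl, if_pos rfl]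

/-- The Gram matrix dominates `p - 1/4` on the diagonal, and `p ≥ 1/2` where `ramp 2` does not
vanish. There `p - 1/4 ≥ 1/4`, so doubling the column, which multiplies its square by `4`, suffices.
-/
theorem scalar_ramp_le {o : ι} {ε : ι → U} {p : U} (hp : IsSelfAdjoint p)
    (hgram : ‖star (rowMatrix o ε) * rowMatrix o ε - scalarMatrix ι U p‖ ≤ 1 / 4) :
    let Z := scalarMatrix ι U (cfc (ramp 2) p)
    let x := rowMatrix o ε * Z + rowMatrix o ε * Z
    Z * Z ≤ star x * x := by
  intro Z x
  set X := rowMatrix o ε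
  have hF : IsSelfAdjoint (cfc (ramp 2) p) := cfc_predicate _ p
  have hZ : IsSelfAdjoint Z := hF.map (scalarMatrix ι U)
  have h1 : 0 ≤ star X * X - scalarMatrix ι U (p - algebraMap ℝ U (1 / 4)) := by
    have hsa : IsSelfAdjoint (star X * X - scalarMatrix ι U p) :=
      (IsSelfAdjoint.star_mul_self X).sub (hp.map _)
    have h2 := hsa.neg_algebraMap_norm_le_self
    have h3 : algebraMap ℝ (CStarMatrix ι ι U) ‖star X * X - scalarMatrix ι U p‖ ≤
        algebraMap ℝ (CStarMatrix ι ι U) (1 / 4) := algebraMap_mono _ hgram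
    rw [map_sub, scalarMatrix_algebraMap, ← sub_add]
    have h4 : ∀ a n q : CStarMatrix ι ι U, -n ≤ a → n ≤ q → 0 ≤ a + q := fun a n q ha hq =>
      (neg_le_iff_add_nonneg.1 ha).trans (by gcongr)
    exact h4 _ _ _ h2 h3
  have h2 : 0 ≤ Z * (star X * X) * Z - Z * scalarMatrix ι U (p - algebraMap ℝ U (1 / 4)) * Z := by
    have := star_left_conjugate_nonneg h1 Z
    rwa [hZ.star_eq, mul_sub, sub_mul] at this
  have h3 : 0 ≤ Z * scalarMatrix ι U (p - algebraMap ℝ U (1 / 4)) * Z +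
      Z * scalarMatrix ι U (p - algebraMap ℝ U (1 / 4)) * Z +
      (Z * scalarMatrix ι U (p - algebraMap ℝ U (1 / 4)) * Z +
      Z * scalarMatrix ι U (p - algebraMap ℝ U (1 / 4)) * Z) - Z * Z := by
    have hc := continuous_ramp 2
    have h4 : p - algebraMap ℝ U (1 / 4) = cfc (fun t : ℝ => t - 1 / 4) p := by
      rw [cfc_sub _ _ p (by fun_prop) (by fun_prop), cfc_id' ℝ p, cfc_const _ p]
    -- A square root of `4 (t - 1/4) r² - r²` with `r = ramp 2 t`; the radicand is non-negative
    -- because `r = 0` for `4 t ≤ 2`.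
    let k : ℝ → ℝ := fun t => √(ramp 2 t * ramp 2 t * (4 * t - 2))
    have hk : Continuous k := by fun_prop
    have hksa : IsSelfAdjoint (cfc k p) := cfc_predicate _ p
    have hkk : ∀ t, k t * k t = ramp 2 t * (t - 1 / 4) * ramp 2 t + ramp 2 t * (t - 1 / 4) * ramp 2 t +
        (ramp 2 t * (t - 1 / 4) * ramp 2 t + ramp 2 t * (t - 1 / 4) * ramp 2 t) -
        ramp 2 t * ramp 2 t := by
      intro t
      have : 0 ≤ ramp 2 t * ramp 2 t * (4 * t - 2) := by
        rcases le_total (4 * t) 2 with h | h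
        · rw [ramp_eq_zero h]; simp
        · exact mul_nonneg (mul_self_nonneg _) (by linarith)
      rw [Real.mul_self_sqrt this]
      ring
    have h5 : star (scalarMatrix ι U (cfc k p)) * scalarMatrix ι U (cfc k p) =
        Z * scalarMatrix ι U (p - algebraMap ℝ U (1 / 4)) * Z +
        Z * scalarMatrix ι U (p - algebraMap ℝ U (1 / 4)) * Z +
        (Z * scalarMatrix ι U (p - algebraMap ℝ U (1 / 4)) * Z +
        Z * scalarMatrix ι U (p - algebraMap ℝ U (1 / 4)) * Z) - Z * Z := by
      rw [h4, (hksa.map (scalarMatrix ι U)).star_eq]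
      simp only [Z, ← map_mul, ← map_add, ← map_sub]
      congr 1
      rw [← cfc_mul _ _ p (by fun_prop) (by fun_prop), ← cfc_mul _ _ p (by fun_prop) (by fun_prop),
        ← cfc_mul _ _ p (by fun_prop) (by fun_prop), ← cfc_mul _ _ p (by fun_prop) (by fun_prop),
        ← cfc_add p _ _ (by fun_prop) (by fun_prop), ← cfc_add p _ _ (by fun_prop) (by fun_prop),
        ← cfc_sub _ _ p (by fun_prop) (by fun_prop)]
      exact cfc_congr fun t _ => hkk t
    rw [← h5]
    exact star_mul_self_nonneg _
  have h4 : star x * x = Z * (star X * X) * Z + Z * (star X * X) * Z +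
      (Z * (star X * X) * Z + Z * (star X * X) * Z) := by
    simp only [x, star_add, star_mul, hZ.star_eq]
    noncomm_ring
  rw [h4, ← sub_nonneg]
  have h5 := add_nonneg (add_nonneg (add_nonneg h2 h2) (add_nonneg h2 h2)) h3
  refine h5.trans_eq ?_
  abel

/-- An approximately orthogonal column can be replaced by an exactly orthogonal one, without
changing its action on the eigenvectors of its Gram matrix. -/
theorem exists_orthogonal_column (Φ : U →⋆ₐ[ℂ] U') {o : ι} {ε : ι → U} {p : U} (hp : IsSelfAdjoint p)
    (hgram : ‖star (rowMatrix o ε) * rowMatrix o ε - scalarMatrix ι U p‖ ≤ 1 / 4)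
    (hΦ : ∀ i j, Φ (star (ε i) * ε j) = if i = j then Φ p else 0) :
    ∃ (v : ι → U) (F K : U), IsSelfAdjoint F ∧ IsSelfAdjoint K ∧ F * K = K ∧
      (∀ i, star (v i) * v i = F * F) ∧ (∀ i j, i ≠ j → star (v i) * v j = 0) ∧
      ∀ y, Φ p * y = y → Φ F * y = y ∧ Φ K * y = y ∧ ∀ i, Φ (v i) * y = Φ (ε i) * y := by
  set X := rowMatrix o ε
  set F := cfc (ramp 2) p
  set Z := scalarMatrix ι U F with hZdef
  have hF : IsSelfAdjoint F := cfc_predicate _ p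
  have hZ : IsSelfAdjoint Z := hF.map (scalarMatrix ι U)
  obtain ⟨V, hVV, hVc, hV⟩ := exists_star_mul_self_eq hZ (scalar_ramp_le hp hgram)
  -- Being a limit of right multiples of the row matrix, `V` is supported in the same row.
  have hrow : ∀ s t, s ≠ o → V s t = 0 := by
    intro s t hs
    have hcl : IsClosed {m : CStarMatrix ι ι U | m s t = 0} := isClosed_eq
      (continuous_apply_apply s t : Continuous fun m : ι → ι → U => m s t) continuous_const
    refine closure_minimal ?_ hcl hVc
    rintro _ ⟨m, rfl⟩
    change ((X * Z + X * Z) * m) s t = 0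
    have h0 : ∀ n : CStarMatrix ι ι U, (X * n) s t = 0 := by
      intro n
      rw [CStarMatrix.mul_apply]
      exact Finset.sum_eq_zero fun u _ => by rw [show X s u = 0 from if_neg hs, zero_mul]
    rw [← mul_add, mul_assoc, h0]
  have hent : ∀ i j, star (V o i) * V o j = if i = j then F * F else 0 := by
    intro i j
    rw [← star_mul_self_apply_of_row hrow, hVV, hZdef, ← map_mul, scalarMatrix_apply]
  have hcfc : ∀ (c : ℝ), c ≤ 3 → ∀ y, Φ p * y = y → Φ (cfc (ramp c) p) * y = y := by
    intro c hc y hy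
    have hΦc : Continuous Φ := NonUnitalStarAlgHom.instContinuousLinearMapClassComplex.map_continuous Φ
    rw [StarAlgHomClass.map_cfc (R := ℝ) Φ (ramp c) p ((continuous_ramp c).continuousOn) hΦc hp
      (hp.map Φ), cfc_mul_of_mul_eq (hp.map Φ) (l := 1) (by rw [hy, one_smul]) (continuous_ramp c),
      ramp_eq_one (by linarith), one_smul]
  refine ⟨fun i => V o i, F, cfc (ramp 3) p, hF, cfc_predicate _ p, ?_,
    fun i => by rw [hent, if_pos rfl], fun i j hij => by rw [hent, if_neg hij],
    fun y hy => ⟨hcfc 2 (by norm_num) y hy, hcfc 3 le_rfl y hy, fun i => ?_⟩⟩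
  · rw [← cfc_mul _ _ p ((continuous_ramp 2).continuousOn) ((continuous_ramp 3).continuousOn)]
    refine cfc_congr fun t _ => ?_
    rcases le_total (4 * t) 3 with h | h
    · simp only [ramp_eq_zero h, mul_zero]
    · simp only [ramp_eq_one (c := 2) (t := t) (by linarith), one_mul]
  · let Ψ : CStarMatrix ι ι U →⋆ₐ[ℂ] CStarMatrix ι ι U' := entrywise Φ
    set Y := scalarMatrix ι U' y with hY
    have hZY : Ψ Z * Y = Y := by
      change entrywise Φ (scalarMatrix ι U F) * Y = Y
      rw [entrywise_scalarMatrix, hY, ← map_mul, hcfc 2 (by norm_num) y hy]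
    have hXY : Ψ (star X * X) * Y = Y := by
      have : Ψ (star X * X) = scalarMatrix ι U' (Φ p) := by
        refine CStarMatrix.ext fun s t => ?_
        change Φ ((star X * X) s t) = _
        rw [star_rowMatrix_mul_self_apply, hΦ, scalarMatrix_apply]
      rw [this, hY, ← map_mul, hy]
    have hx : Ψ (X * Z + X * Z) * Y = Ψ X * Y + Ψ X * Y := by
      rw [map_add, add_mul, map_mul, mul_assoc, hZY]
    have h4 : Ψ (star (X * Z + X * Z) * (X * Z + X * Z)) * Y = (4 : ℝ) • Y := by
      have h5 : Ψ (star X) * (Ψ X * Y) = Y := by rw [← mul_assoc, ← map_mul, hXY]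
      rw [map_mul, mul_assoc, hx, star_add, map_add, star_mul, hZ.star_eq, map_mul, add_mul, mul_add,
        mul_assoc, h5, hZY, show (4 : ℝ) = 1 + 1 + (1 + 1) by norm_num, add_smul, add_smul, one_smul]
    -- The square of the doubled column has eigenvalue `4` on `Y`, and dividing by `√4 = 2` undoes
    -- the doubling.
    have h6 := hV Ψ Y 4 (by norm_num) h4 hZY
    have hsq : √(4 : ℝ) = 2 := by
      rw [show (4 : ℝ) = 2 ^ 2 by norm_num]; exact Real.sqrt_sq (by norm_num)
    rw [hx, hsq] at h6
    replace h6 := h6.trans (inv_two_smul_add_self _)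
    have h7 := congrArg (fun m : CStarMatrix ι ι U' => m o i) h6
    simp only [hY, mul_scalarMatrix_apply] at h7
    change Φ (V o i) * y = Φ (X o i) * y at h7
    rw [h7, show X o i = ε i from if_pos rfl]

end ExactColumn

section Tail

variable {B : Type v} [NonUnitalCStarAlgebra B]

theorem EllInf.tail_mul (N : ℕ) (x y : EllInf B) :
    EllInf.tail N (x * y) = EllInf.tail N x * EllInf.tail N y := by
  ext n
  change (if n < N then 0 else x n * y n) = (if n < N then 0 else x n) * (if n < N then 0 else y n)
  split_ifs <;> simp

theorem EllInf.tail_star (N : ℕ) (x : EllInf B) :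
    EllInf.tail N (star x) = star (EllInf.tail N x) := by
  ext n
  change (if n < N then 0 else star (x n)) = star (if n < N then 0 else x n)
  split_ifs <;> simp

theorem EllInf.tail_sub (N : ℕ) (x y : EllInf B) :
    EllInf.tail N (x - y) = EllInf.tail N x - EllInf.tail N y := by
  ext n
  change (if n < N then 0 else x n - y n) = (if n < N then 0 else x n) - (if n < N then 0 else y n)
  split_ifs <;> simp

theorem EllInf.tendsto_tail {x : EllInf B} (hx : eta B x = 0) :
    Tendsto (fun N => EllInf.tail N x) atTop (𝓝 0) := by
  rw [Metric.tendsto_atTop]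
  intro ε hε
  obtain ⟨N, hN⟩ := eventually_atTop.1 ((tendsto_order.1 (eta_eq_zero_iff.1 hx)).2 (ε / 2) (half_pos hε))
  refine ⟨N, fun M hM => ?_⟩
  rw [dist_zero_right]
  refine (EllInf.norm_le (half_pos hε).le fun n => ?_).trans_lt (half_lt_self hε)
  rw [EllInf.tail_apply]
  split_ifs with h
  · rw [norm_zero]; exact (half_pos hε).le
  · exact (hN n (hM.trans (not_lt.1 h))).le

end Tail

section

variable {B : Type v} [NonUnitalCStarAlgebra B] {ι : Type w} [Fintype ι] [DecidableEq ι]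

theorem star_inr_mul_inr {A : Type u} [NonUnitalCStarAlgebra A] (a b : A) :
    star (inr A a) * inr A b = inr A (star a * b) := by
  rw [map_mul, map_star]

/-- The quotient map of a sequence algebra, extended to unitizations. -/
noncomputable def unitizationEta (B : Type v) [NonUnitalCStarAlgebra B] :
    Unitization ℂ (EllInf B) →⋆ₐ[ℂ] Unitization ℂ (SeqAlg B) := Unitization.starMap (eta B)

theorem unitizationEta_inr (x : EllInf B) :
    unitizationEta B (inr _ x) = inr _ (eta B x) := Unitization.starMap_inr (eta B) x

/-- The Gram relations hold modulo null sequences, so deleting enough initial terms makes the Gram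
matrix uniformly within `1/4` of a diagonal one without changing classes in `B_∞`. Then
`exists_orthogonal_column` applies. -/
theorem exists_exact_column (o : ι) (E : ι → EllInf B)
    (hne : ∀ i j, i ≠ j → star (eta B (E i)) * eta B (E j) = 0)
    (hself : ∀ i, star (eta B (E i)) * eta B (E i) = star (eta B (E o)) * eta B (E o)) :
    ∃ (v : ι → Unitization ℂ (EllInf B)) (F K : Unitization ℂ (EllInf B)),
      IsSelfAdjoint F ∧ IsSelfAdjoint K ∧ F * K = K ∧
      (∀ i, star (v i) * v i = F * F) ∧ (∀ i j, i ≠ j → star (v i) * v j = 0) ∧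
      ∀ y, star (eta B (E o)) * eta B (E o) * y = y →
        unitizationEta B K * inr _ y = inr _ y ∧
          ∀ i, unitizationEta B (v i) * inr _ y = inr _ (eta B (E i) * y) := by
  let := CStarAlgebra.spectralOrder (Unitization ℂ (EllInf B))
  have := CStarAlgebra.spectralOrderedRing (Unitization ℂ (EllInf B))
  let := CStarAlgebra.spectralOrder (Unitization ℂ (SeqAlg B))
  have := CStarAlgebra.spectralOrderedRing (Unitization ℂ (SeqAlg B))
  let ε : ℕ → ι → Unitization ℂ (EllInf B) := fun N i => inr _ (EllInf.tail N (E i))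
  let p : ℕ → Unitization ℂ (EllInf B) := fun N => star (ε N o) * ε N o
  have hgram : Tendsto (fun N => star (rowMatrix o (ε N)) * rowMatrix o (ε N) -
      scalarMatrix ι _ (p N)) atTop (𝓝 0) := by
    refine tendsto_pi_nhds.2 fun s => tendsto_pi_nhds.2 fun t => ?_
    change Tendsto (fun N => (star (rowMatrix o (ε N)) * rowMatrix o (ε N)) s t -
      scalarMatrix ι _ (p N) s t) atTop (𝓝 0)
    simp only [star_rowMatrix_mul_self_apply, scalarMatrix_apply]
    have hcont : Continuous (inr (EllInf B)) := Unitization.continuous_inr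
    have h0 : ∀ {x : EllInf B}, eta B x = 0 →
        Tendsto (fun N => inr _ (EllInf.tail N x)) atTop (𝓝 0) := fun hx => by
      have := (hcont.tendsto 0).comp (EllInf.tendsto_tail hx)
      rwa [map_zero] at this
    by_cases hst : s = t
    · subst hst
      refine (h0 (x := star (E s) * E s - star (E o) * E o) ?_).congr fun N => ?_
      · rw [map_sub, map_mul, map_mul, map_star, map_star, hself, sub_self]
      · rw [if_pos rfl, EllInf.tail_sub, EllInf.tail_mul, EllInf.tail_mul, EllInf.tail_star,
          EllInf.tail_star, map_sub, ← star_inr_mul_inr, ← star_inr_mul_inr]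
    · refine (h0 (x := star (E s) * E t) ?_).congr fun N => ?_
      · rw [map_mul, map_star, hne s t hst]
      · rw [if_neg hst, sub_zero, EllInf.tail_mul, EllInf.tail_star, ← star_inr_mul_inr]
  obtain ⟨N, hN⟩ := ((tendsto_order.1 (tendsto_zero_iff_norm_tendsto_zero.1 hgram)).2 (1 / 4)
    (by norm_num)).exists
  have hE : ∀ i j, unitizationEta B (star (ε N i) * ε N j) =
      inr _ (star (eta B (E i)) * eta B (E j)) := by
    intro i j
    rw [star_inr_mul_inr, unitizationEta_inr, map_mul (eta B), map_star (eta B), EllInf.eta_tail,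
      EllInf.eta_tail]
  have hΦ : ∀ i j, unitizationEta B (star (ε N i) * ε N j) =
      if i = j then unitizationEta B (p N) else 0 := by
    intro i j
    rw [hE, hE]
    split_ifs with hij
    · subst hij
      rw [hself]
    · rw [hne i j hij, map_zero]
  obtain ⟨v, F, K, hF, hK, hFK, hv, hv', hy⟩ := exists_orthogonal_column (unitizationEta B)
    (IsSelfAdjoint.star_mul_self _) hN.le hΦ
  refine ⟨v, F, K, hF, hK, hFK, hv, hv', fun y h => ?_⟩
  have h1 : unitizationEta B (p N) * inr _ y = inr _ y := by
    rw [hE, ← map_mul, h]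
  refine ⟨(hy _ h1).2.1, fun i => ?_⟩
  rw [(hy _ h1).2.2 i]
  change unitizationEta B (inr _ (EllInf.tail N (E i))) * _ = _
  rw [unitizationEta_inr, EllInf.eta_tail, map_mul]

end

theorem exists_hom_of_ker_le {R S T T' : Type*} [NonUnitalRing R] [StarRing R] [Module ℂ R]
    [NonUnitalRing S] [StarRing S] [Module ℂ S] [NonUnitalRing T] [StarRing T] [Module ℂ T]
    [NonUnitalRing T'] [StarRing T'] [Module ℂ T']
    (f : R →⋆ₙₐ[ℂ] T) (q : S →⋆ₙₐ[ℂ] T) (κ : S →⋆ₙₐ[ℂ] T') (h : ∀ r, ∃ s, q s = f r)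
    (hκ : ∀ s, q s = 0 → κ s = 0) : ∃ f' : R →⋆ₙₐ[ℂ] T', ∀ r s, q s = f r → f' r = κ s := by
  choose F hF using h
  have key : ∀ {s s'}, q s = q s' → κ s = κ s' := by
    intro s s' hs
    rw [← sub_eq_zero, ← map_sub] at hs ⊢
    exact hκ _ hs
  refine ⟨{ toFun := fun r => κ (F r)
            map_smul' := fun c r => ?_
            map_zero' := ?_
            map_add' := fun r s => ?_
            map_mul' := fun r s => ?_
            map_star' := fun r => ?_ }, fun r s hs => key ((hF r).trans hs.symm)⟩
  · exact (key (by simp [hF])).trans (map_smul κ c (F r))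
  · exact (key (by simp [hF])).trans (map_zero κ)
  · exact (key (by simp [hF])).trans (map_add κ (F r) (F s))
  · exact (key (by simp [hF])).trans (map_mul κ (F r) (F s))
  · refine (key ?_).trans (map_star κ (F r))
    rw [hF, map_star f, map_star q, hF]

/-! ### Lifting with a prescribed local unit. -/

section Coordinates

variable {B : Type v} [NonUnitalCStarAlgebra B]

/-- The projection of bounded sequences to a single coordinate. -/
noncomputable def EllInf.coord (n : ℕ) : EllInf B →⋆ₙₐ[ℂ] EllInf B where
  toFun y := EllInf.mk (fun k => if k = n then y k else 0) ‖y‖ (fun k => by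
    dsimp only
    split_ifs
    · exact norm_apply_le y k
    · simp)
  map_smul' c y := by
    ext k
    change (if k = n then c • y k else 0) = c • (if k = n then y k else 0)
    split_ifs <;> simp
  map_zero' := by
    ext k
    change (if k = n then (0 : B) else 0) = 0
    split_ifs <;> rfl
  map_add' x y := by
    ext k
    change (if k = n then x k + y k else 0) = (if k = n then x k else 0) + (if k = n then y k else 0)
    split_ifs <;> simp
  map_mul' x y := by
    ext k
    change (if k = n then x k * y k else 0) = (if k = n then x k else 0) * (if k = n then y k else 0)
    split_ifs <;> simp
  map_star' y := by
    ext k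
    change (if k = n then star (y k) else 0) = star (if k = n then y k else 0)
    split_ifs <;> simp

theorem EllInf.coord_apply (n k : ℕ) (y : EllInf B) :
    EllInf.coord n y k = if k = n then y k else 0 := rfl

theorem EllInf.norm_coord_le (n : ℕ) (y : EllInf B) : ‖EllInf.coord n y‖ ≤ ‖y n‖ := by
  refine EllInf.norm_le (norm_nonneg _) fun k => ?_
  rw [EllInf.coord_apply]
  split_ifs with h
  · rw [h]
  · simp

/-- The elements of `ℓ^∞(ℕ, B)` for which a given self-adjoint element acts as a unit. -/
def unitFor (F : Unitization ℂ (EllInf B)) (hF : IsSelfAdjoint F) :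
    NonUnitalStarSubalgebra ℂ (EllInf B) where
  carrier := {y | F * inr _ y = inr _ y ∧ inr _ y * F = inr _ y}
  add_mem' hx hy := by
    simp only [Set.mem_ofPred_eq, map_add, mul_add, add_mul] at *
    rw [hx.1, hx.2, hy.1, hy.2]
    exact ⟨rfl, rfl⟩
  zero_mem' := by simp
  mul_mem' hx hy := by
    simp only [Set.mem_ofPred_eq, map_mul] at *
    rw [← mul_assoc, hx.1, mul_assoc, hy.2]
    exact ⟨rfl, rfl⟩
  smul_mem' c x hx := by
    simp only [Set.mem_ofPred_eq, map_smul, mul_smul_comm, smul_mul_assoc] at *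
    rw [hx.1, hx.2]
    exact ⟨rfl, rfl⟩
  star_mem' {x} hx := by
    have h1 := congrArg star hx.1
    have h2 := congrArg star hx.2
    rw [star_mul, hF.star_eq] at h1 h2
    simp only [Set.mem_ofPred_eq, map_star]
    exact ⟨h2, h1⟩

variable {F : Unitization ℂ (EllInf B)} {hF : IsSelfAdjoint F}

theorem mem_unitFor {y : EllInf B} :
    y ∈ unitFor F hF ↔ F * inr _ y = inr _ y ∧ inr _ y * F = inr _ y := Iff.rfl

instance isClosed_unitFor : IsClosed (unitFor F hF : Set (EllInf B)) := by
  have hc : Continuous (inr (EllInf B)) := Unitization.continuous_inr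
  exact (isClosed_eq (continuous_const.mul hc) hc).inter
    (isClosed_eq (hc.mul continuous_const) hc)

/-- Membership in `unitFor` can be checked coordinatewise. -/
theorem mem_unitFor_iff {y : EllInf B} : y ∈ unitFor F hF ↔
    ∀ n, F.fst • y n + F.snd n * y n = y n ∧ F.fst • y n + y n * F.snd n = y n := by
  have h1 : F * inr _ y = inr _ (F.fst • y + F.snd * y) := by
    conv_lhs => rw [← Unitization.inl_fst_add_inr_snd_eq F]
    change (_ + _) * ((y : EllInf B) : Unitization ℂ (EllInf B)) =
      ((F.fst • y + F.snd * y : EllInf B) : Unitization ℂ (EllInf B))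
    rw [add_mul, Unitization.inl_mul_inr, ← Unitization.inr_mul, Unitization.inr_add]
  have h2 : inr _ y * F = inr _ (F.fst • y + y * F.snd) := by
    conv_lhs => rw [← Unitization.inl_fst_add_inr_snd_eq F]
    change ((y : EllInf B) : Unitization ℂ (EllInf B)) * (_ + _) =
      ((F.fst • y + y * F.snd : EllInf B) : Unitization ℂ (EllInf B))
    rw [mul_add, Unitization.inr_mul_inl, ← Unitization.inr_mul, Unitization.inr_add]
  rw [mem_unitFor, h1, h2, inr_injective.eq_iff, inr_injective.eq_iff, forall_and]
  constructor
  · exact fun h => ⟨fun n => congrArg (fun z : EllInf B => z n) h.1,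
      fun n => congrArg (fun z : EllInf B => z n) h.2⟩
  · exact fun h => ⟨lp.ext (funext h.1), lp.ext (funext h.2)⟩

theorem coord_mem_unitFor {y : EllInf B} (hy : y ∈ unitFor F hF) (n : ℕ) :
    EllInf.coord n y ∈ unitFor F hF := by
  rw [mem_unitFor_iff] at hy ⊢
  intro k
  rw [EllInf.coord_apply]
  split_ifs
  · exact hy k
  · simp

/-- The embedding of `unitFor F` into its own bounded sequences by coordinates. -/
noncomputable def spread (F : Unitization ℂ (EllInf B)) (hF : IsSelfAdjoint F) :
    unitFor F hF →⋆ₙₐ[ℂ] EllInf (unitFor F hF) where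
  toFun y := EllInf.mk (fun n => ⟨EllInf.coord n (y : EllInf B), coord_mem_unitFor y.2 n⟩) ‖y‖
    fun n => (EllInf.norm_coord_le n _).trans (norm_apply_le _ n)
  map_smul' c y := by ext n : 2; exact Subtype.ext (map_smul (EllInf.coord n) c (y : EllInf B))
  map_zero' := by ext n : 2; exact Subtype.ext (map_zero (EllInf.coord n))
  map_add' x y := by ext n : 2; exact Subtype.ext (map_add (EllInf.coord n) (x : EllInf B) y)
  map_mul' x y := by ext n : 2; exact Subtype.ext (map_mul (EllInf.coord n) (x : EllInf B) y)
  map_star' y := by ext n : 2; exact Subtype.ext (map_star (EllInf.coord n) (y : EllInf B))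

/-- The diagonal of a bounded sequence of bounded sequences. -/
noncomputable def diagonal (F : Unitization ℂ (EllInf B)) (hF : IsSelfAdjoint F) :
    EllInf (unitFor F hF) →⋆ₙₐ[ℂ] EllInf B where
  toFun z := EllInf.mk (fun n => (z n : EllInf B) n) ‖z‖
    fun n => (norm_apply_le (z n : EllInf B) n).trans (norm_apply_le z n)
  map_smul' _ _ := rfl
  map_zero' := rfl
  map_add' _ _ := rfl
  map_mul' _ _ := rfl
  map_star' _ := rfl

theorem diagonal_mem (z : EllInf (unitFor F hF)) : diagonal F hF z ∈ unitFor F hF := by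
  rw [mem_unitFor_iff]
  intro n
  exact mem_unitFor_iff.1 (z n).2 n

/-- Weak semiprojectivity is applied with `unitFor F` itself as target. A sequence spreads to its
single coordinates, each still in `unitFor F` because membership is tested coordinatewise, and null
sequences spread to null sequences. After lifting, the diagonal returns to `ℓ^∞(ℕ, B)` and stays in
`unitFor F`. -/
theorem WeaklySemiprojective.exists_lift_mem_unitFor {D : Type u} [NonUnitalCStarAlgebra D]
    (hD : WeaklySemiprojective.{u, v} D) (π : D →⋆ₙₐ[ℂ] SeqAlg B)
    (h : ∀ d, ∃ y ∈ unitFor F hF, eta B y = π d) :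
    ∃ δ : D →⋆ₙₐ[ℂ] EllInf B, (∀ d, δ d ∈ unitFor F hF) ∧ ∀ d, eta B (δ d) = π d := by
  let q : unitFor F hF →⋆ₙₐ[ℂ] SeqAlg B :=
    (eta B).comp (NonUnitalStarSubalgebraClass.subtype (unitFor F hF))
  obtain ⟨ψ, hψ⟩ := exists_hom_of_ker_le π q ((eta _).comp (spread F hF))
    (fun d => by
      obtain ⟨y, hy, hyd⟩ := h d
      exact ⟨⟨y, hy⟩, hyd⟩)
    (fun y hy => by
      refine eta_eq_zero_iff.2 (squeeze_zero (fun _ => norm_nonneg _) (fun n => ?_)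
        (eta_eq_zero_iff.1 (show eta B (y : EllInf B) = 0 from hy)))
      exact EllInf.norm_coord_le n _)
  obtain ⟨δ, hδ⟩ := hD (unitFor F hF) ψ
  refine ⟨(diagonal F hF).comp δ, fun d => diagonal_mem _, fun d => ?_⟩
  obtain ⟨y, hy, hyd⟩ := h d
  have h1 : eta _ (δ d) = eta _ (spread F hF ⟨y, hy⟩) :=
    (DFunLike.congr_fun hδ d).trans (hψ d ⟨y, hy⟩ hyd)
  rw [← hyd]
  refine eta_eq_iff.2 (squeeze_zero (fun _ => norm_nonneg _) (fun n => ?_) (eta_eq_iff.1 h1))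
  have h2 := norm_apply_le ((δ d n - spread F hF ⟨y, hy⟩ n : unitFor F hF) : EllInf B) n
  have h3 : ((δ d n - spread F hF ⟨y, hy⟩ n : unitFor F hF) : EllInf B) n =
      (δ d n : EllInf B) n - y n := by
    change (δ d n : EllInf B) n - EllInf.coord n y n = _
    rw [EllInf.coord_apply, if_pos rfl]
  rw [h3] at h2
  exact h2

end Coordinates

/-! ### Lifting homomorphisms of matrix algebras. -/

section MatrixLift

variable {ι : Type w} [Fintype ι] [DecidableEq ι] {D : Type u} [NonUnitalCStarAlgebra D]

/-- A column of elements with orthogonal ranges and common support `S` turns a homomorphism on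
which `S` acts as a unit into a homomorphism of the matrix algebra. -/
def columnHom {U : Type v} [Ring U] [StarRing U] [Algebra ℂ U] [StarModule ℂ U]
    (d : D →⋆ₙₐ[ℂ] U) (v : ι → U) (S : U)
    (hself : ∀ i, star (v i) * v i = S) (hne : ∀ i j, i ≠ j → star (v i) * v j = 0)
    (hS : ∀ a, S * d a = d a) : CStarMatrix ι ι D →⋆ₙₐ[ℂ] U where
  toFun m := ∑ i, ∑ j, v i * d (m i j) * star (v j)
  map_smul' c m := by
    simp only [MonoidHom.id_apply, Finset.smul_sum]
    refine Finset.sum_congr rfl fun i _ => Finset.sum_congr rfl fun j _ => ?_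
    rw [CStarMatrix.smul_apply, map_smul, mul_smul_comm, smul_mul_assoc]
  map_zero' := by
    refine Finset.sum_eq_zero fun i _ => Finset.sum_eq_zero fun j _ => ?_
    rw [CStarMatrix.zero_apply, map_zero, mul_zero, zero_mul]
  map_add' m n := by
    simp only [← Finset.sum_add_distrib]
    refine Finset.sum_congr rfl fun i _ => Finset.sum_congr rfl fun j _ => ?_
    rw [CStarMatrix.add_apply, map_add, mul_add, add_mul]
  map_mul' m n := by
    have h : ∀ i j k l, v i * d (m i j) * star (v j) * (v k * d (n k l) * star (v l)) =
        if j = k then v i * (d (m i j) * d (n k l)) * star (v l) else 0 := by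
      intro i j k l
      have h1 : v i * d (m i j) * star (v j) * (v k * d (n k l) * star (v l)) =
          v i * (d (m i j) * (star (v j) * v k * d (n k l))) * star (v l) := by
        simp only [mul_assoc]
      rw [h1]
      split_ifs with hjk
      · rw [hjk, hself, hS]
      · rw [hne j k hjk, zero_mul, mul_zero, mul_zero, zero_mul]
    simp only [Finset.sum_mul, Finset.mul_sum, h, Finset.sum_ite_eq',
      Finset.mem_univ, if_true, CStarMatrix.mul_apply, map_sum, map_mul]
    rw [Finset.sum_comm, Finset.sum_congr rfl fun _ _ => Finset.sum_comm]
    exact Finset.sum_comm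
  map_star' m := by
    rw [star_sum, Finset.sum_comm]
    refine Finset.sum_congr rfl fun j _ => ?_
    rw [star_sum]
    refine Finset.sum_congr rfl fun i _ => ?_
    rw [star_mul, star_mul, star_star, ← map_star, mul_assoc]
    rfl

theorem columnHom_unitMatrix {U : Type v} [Ring U] [StarRing U] [Algebra ℂ U] [StarModule ℂ U]
    (d : D →⋆ₙₐ[ℂ] U) (v : ι → U) (S : U)
    (hself : ∀ i, star (v i) * v i = S) (hne : ∀ i j, i ≠ j → star (v i) * v j = 0)
    (hS : ∀ a, S * d a = d a) (i j : ι) (a : D) :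
    columnHom d v S hself hne hS (unitMatrix i j a) = v i * d a * star (v j) := by
  have h : ∀ s t, unitMatrix i j a s t = if i = s ∧ j = t then a else 0 := fun _ _ => rfl
  change ∑ s, ∑ t, v s * d (unitMatrix i j a s t) * star (v t) = _
  rw [Finset.sum_eq_single i, Finset.sum_eq_single j]
  · rw [h, if_pos ⟨rfl, rfl⟩]
  · intro t _ ht
    rw [h, if_neg fun h => ht h.2.symm, map_zero, mul_zero, zero_mul]
  · intro h; exact absurd (Finset.mem_univ _) h
  · intro s _ hs
    refine Finset.sum_eq_zero fun t _ => ?_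
    rw [h, if_neg fun h => hs h.1.symm, map_zero, mul_zero, zero_mul]
  · intro h; exact absurd (Finset.mem_univ _) h

variable {B : Type v} [NonUnitalCStarAlgebra B] [TopologicalSpace.SeparableSpace D]

/-- Homomorphisms from matrix algebras over weakly semiprojective algebras lift. -/
theorem WeaklySemiprojective.exists_matrix_lift (hD : WeaklySemiprojective.{u, v} D)
    (ψ : CStarMatrix ι ι D →⋆ₙₐ[ℂ] SeqAlg B) :
    ∃ φ : CStarMatrix ι ι D →⋆ₙₐ[ℂ] EllInf B, (eta B).comp φ = ψ := by
  rcases isEmpty_or_nonempty ι with hι | ⟨⟨o⟩⟩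
  · refine ⟨0, NonUnitalStarAlgHom.ext fun m => ?_⟩
    rw [show m = 0 from Subsingleton.elim (α := ι → ι → D) m 0, map_zero, map_zero]
  obtain ⟨E, hE, hEne, hEself, hEo⟩ := exists_column o ψ
  obtain ⟨v, F, K, hF, hK, hFK, hvself, hvne, hy⟩ := exists_exact_column o E hEne hEself
  have hKF : K * F = K := by
    have := congrArg star hFK
    rwa [star_mul, hF.star_eq, hK.star_eq] at this
  have hKψ : ∀ d, unitizationEta B K * inr _ (ψ (unitMatrix o o d)) =
      inr _ (ψ (unitMatrix o o d)) := fun d => (hy _ (hEo d)).1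
  have hψK : ∀ d, inr _ (ψ (unitMatrix o o d)) * unitizationEta B K =
      inr _ (ψ (unitMatrix o o d)) := by
    intro d
    have := congrArg star (hKψ (star d))
    rwa [star_mul, ← map_star, ← map_star, star_unitMatrix, star_star, ← map_star,
      hK.star_eq] at this
  obtain ⟨δ, hδF, hδ⟩ := hD.exists_lift_mem_unitFor (F := F) (hF := hF) (ψ.comp (cornerHom D o))
    (by
      intro d
      obtain ⟨w, hw⟩ := eta_surjective (ψ (unitMatrix o o d))
      -- Compressing by `K` puts the representative in `unitFor F`, since `F K = K = K F`, and keeps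
      -- its class, since `K` acts as a unit on the image of the corner.
      obtain ⟨y, hyw⟩ : K * inr _ w * K ∈ Set.range (inr (EllInf B)) := by
        rw [mem_range_inr, Unitization.fst_mul, Unitization.fst_mul]
        change K.fst * 0 * K.fst = 0
        simp
      refine ⟨y, mem_unitFor.2 ⟨?_, ?_⟩, inr_injective ?_⟩
      · rw [hyw, ← mul_assoc, ← mul_assoc, hFK]
      · rw [hyw, mul_assoc, hKF]
      · rw [← unitizationEta_inr, hyw, map_mul, map_mul, unitizationEta_inr, hw, hKψ, hψK]
        rfl)
  have hFδ : ∀ d, F * F * (inr (EllInf B)).comp δ d = (inr (EllInf B)).comp δ d := by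
    intro d
    change F * F * inr _ (δ d) = inr _ (δ d)
    rw [mul_assoc, (hδF d).1, (hδF d).1]
  let f := columnHom ((inr (EllInf B)).comp δ) v (F * F) hvself hvne hFδ
  have hf : ∀ m, (f m).fst = 0 := by
    intro m
    change (Unitization.fstHom ℂ (EllInf B)) (∑ i, ∑ j, v i * inr _ (δ (m i j)) * star (v j)) = 0
    rw [map_sum]
    refine Finset.sum_eq_zero fun i _ => ?_
    rw [map_sum]
    refine Finset.sum_eq_zero fun j _ => ?_
    rw [map_mul, map_mul]
    change _ * 0 * _ = (0 : ℂ)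
    simp
  obtain ⟨φ, hφ⟩ := exists_factorization f (inr _) inr_injective fun m => mem_range_inr.2 (hf m)
  have hv : ∀ i a, unitizationEta B (v i) * inr _ (eta B (δ a)) = inr _ (ψ (unitMatrix i o a)) := by
    intro i a
    rw [hδ]
    exact ((hy _ (hEo a)).2 i).trans (congrArg _ (hE i a))
  -- The column is only known beside elements of the corner, so each of `v i` and `star (v j)` needs
  -- its own factor; the approximate unit then removes the restriction to products.
  have hmul : ∀ i j a b, eta B (φ (unitMatrix i j (a * b))) = ψ (unitMatrix i j (a * b)) := by
    intro i j a b
    have h1 : f (unitMatrix i j (a * b)) = v i * inr _ (δ a) * star (v j * inr _ (δ (star b))) := by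
      refine (columnHom_unitMatrix _ _ _ hvself hvne hFδ i j (a * b)).trans ?_
      rw [star_mul, ← map_star, ← map_star, star_star, map_mul]
      simp only [mul_assoc]
      rfl
    apply inr_injective
    rw [← unitizationEta_inr, hφ, h1, map_mul, map_star, map_mul, map_mul, unitizationEta_inr,
      unitizationEta_inr, hv, hv, ← map_star, ← map_star, star_unitMatrix, star_star, ← map_mul,
      ← map_mul, unitMatrix_mul]
  obtain ⟨h, -, -, hh⟩ := exists_seq_approximateUnit D
  have hall : ∀ i j a, eta B (φ (unitMatrix i j a)) = ψ (unitMatrix i j a) := by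
    intro i j a
    refine tendsto_nhds_unique (tendsto_map_unitMatrix ((eta B).comp φ) i j (hh a).1)
      ((tendsto_map_unitMatrix ψ i j (hh a).1).congr fun n => ?_)
    exact (hmul i j _ _).symm
  refine ⟨φ, NonUnitalStarAlgHom.ext fun m => ?_⟩
  change eta B (φ m) = ψ m
  rw [eq_sum_unitMatrix m]
  simp only [map_sum]
  exact Finset.sum_congr rfl fun i _ => Finset.sum_congr rfl fun j _ => hall i j _

end MatrixLift

theorem CStarAction.HasRokhlinProperty.weaklySemiprojective_crossedProduct {G : Type w} [Group G]
    [TopologicalSpace G] [IsTopologicalGroup G] [CompactSpace G] [T2Space G]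
    [SecondCountableTopology G] [Fintype G]
    {A : Type u} [NonUnitalCStarAlgebra A] [TopologicalSpace.SeparableSpace A]
    {α : CStarAction G A} (hα : α.HasRokhlinProperty) (hA : WeaklySemiprojective.{u, v} A) :
    WeaklySemiprojective.{max u w, v} α.CrossedProduct := by
  classical
  obtain ⟨e⟩ := hα.nonempty_starAlgEquiv
  -- Second countability passes to the subspace `A^α`, making it separable as the matrix lifting
  -- requires.
  have := UniformSpace.secondCountable_of_separable A
  have hfix : WeaklySemiprojective.{u, v} α.fixedPoints :=
    hα.sequenceAlgebraExtendible.weaklySemiprojective hA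
  intro B _ ψ
  obtain ⟨φ, hφ⟩ := hfix.exists_matrix_lift
    (ψ.comp (e.symm : CStarMatrix G G α.fixedPoints →⋆ₙₐ[ℂ] α.CrossedProduct))
  refine ⟨φ.comp (e : α.CrossedProduct →⋆ₙₐ[ℂ] CStarMatrix G G α.fixedPoints),
    NonUnitalStarAlgHom.ext fun x => ?_⟩
  refine (DFunLike.congr_fun hφ (e x)).trans ?_
  exact congrArg ψ (e.symm_apply_apply x)

end RokhlinFP

theorem mainTheorem11 {G : Type w} [Group G] [TopologicalSpace G] [IsTopologicalGroup G]
    [CompactSpace G] [T2Space G] [SecondCountableTopology G]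
    {A : Type u} [NonUnitalCStarAlgebra A] [TopologicalSpace.SeparableSpace A]
    (α : RokhlinFP.CStarAction G A) (hα : α.HasRokhlinProperty) :
    RokhlinFP.SequenceAlgebraExtendible.{u, v} α.inclusion ∧
    (RokhlinFP.WeaklySemiprojective.{u, v} A →
      RokhlinFP.WeaklySemiprojective.{u, v} α.fixedPoints) ∧
    (∀ [Fintype G],
      Nonempty (α.CrossedProduct ≃⋆ₐ[ℂ]
        CStarMatrix (Fin (Fintype.card G)) (Fin (Fintype.card G)) α.fixedPoints) ∧
      (RokhlinFP.WeaklySemiprojective.{u, v} A →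
        RokhlinFP.WeaklySemiprojective.{max u w, v} α.CrossedProduct)) := by
  refine ⟨hα.sequenceAlgebraExtendible,
    fun hA => hα.sequenceAlgebraExtendible.weaklySemiprojective hA, fun {_} =>
      ⟨?_, fun hA => hα.weaklySemiprojective_crossedProduct hA⟩⟩
  classical
  obtain ⟨e⟩ := hα.nonempty_starAlgEquiv
  exact ⟨e.trans (CStarMatrix.reindexₐ ℂ _ (Fintype.equivFin G))⟩
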